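/- Fix $n\in\mathbb N$ and $1<p<\infty$. Let $\Lambda\in C^\infty(\mathbb R^n)$ be a positive weight function with polynomial growth: there are constants $0<\mu_0\le\mu_1\le\mu$ and $0<C_0\le C_1$ with $C_0(1+|\xi|)^{\mu_0}\le\Lambda(\xi)\le C_1(1+|\xi|)^{\mu_1}$ for all $\xi\in\mathbb R^n$, and for all multi-indices $\alpha$ and all $\gamma\in\{0,1\}^n$ there is $C_{\alpha,\gamma}>0$ with $|\xi^\gamma(\partial^{\alpha+\gamma}\Lambda)(\xi)|\le C_{\alpha,\gamma}\Lambda(\xi)^{1-|\alpha|/\mu}$ for all $\xi$. Let $\rho\in(0,1/\mu]$. For $m_1,m_2\in\mathbb R$, let $S^{m_1,m_2}_{\rho,\Lambda}$ be the set of all $\sigma\in C^\infty(\mathbb R^n\times\mathbb R^n)$ such that for all multi-indices $\alpha,\beta$ there is $C_{\alpha,\beta}>0$ with $$|(\partial_x^\alpha\partial_\xi^\beta\sigma)(x,\xi)|\le C_{\alpha,\beta}\,\Lambda(x)^{m_2-\rho|\alpha|}\Lambda(\xi)^{m_1-\rho|\beta|},\qquad x,\xi\in\mathbb R^n,$$ and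 let $M^{m_1,m_2}_{\rho,\Lambda}$ be the set of all $\sigma\in C^\infty(\mathbb R^n\times\mathbb R^n)$ with $\xi^\gamma\partial_\xi^\gamma\sigma\in S^{m_1,m_2}_{\rho,\Lambda}$ for every $\gamma\in\{0,1\}^n$. For a symbol $\sigma\in S^{m_1,m_2}_{\rho,\Lambda}$ and a Schwartz function $\varphi$ put $$(T_\sigma\varphi)(x)=(2\pi)^{-n/2}\int_{\mathbb R^n}e^{ix\cdot\xi}\sigma(x,\xi)\hat\varphi(\xi)\,d\xi,\qquad \hat\varphi(\xi)=(2\pi)^{-n/2}\int_{\mathbb R^n}e^{-ix\cdot\xi}\varphi(x)\,dx,$$ and extend $T_\sigma$ to tempered distributions by $(T_\sigma u)(\varphi)=u(\overline{T_\sigma^*\overline\varphi})$, where $T_\sigma^*$ is the formal adjoint of $T_\sigma$ on the Schwartz space, with respect to $(f,g)=\int f\overline g$. Let $J_{m_1,m_2}=T_{\sigma_{m_1,m_2}}$ with $\sigma_{m_1,m_2}(x,\xi)=\Lambda(x)^{-m_2}\Lambda(\xi)^{-m_1}$. For $s_1,s_2\in\mathbb R$ let $H^{s_1,s_2,p}_\Lambda$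 be the Banach space of all tempered distributions $u$ with $J_{-s_1,-s_2}u\in L^p(\mathbb R^n)$, with norm $\|u\|_{s_1,s_2,p,\Lambda}=\|J_{-s_1,-s_2}u\|_{L^p(\mathbb R^n)}$. **Theorem.** Let $m_1,m_2\in\mathbb R$ and $\sigma\in M^{m_1,m_2}_{\rho,\Lambda}$, and suppose that for some $s_1,s_2\in\mathbb R$ the operator $$T_\sigma:H^{s_1,s_2,p}_\Lambda\to H^{s_1-m_1,s_2-m_2,p}_\Lambda$$ is a (bounded) Fredholm operator. Then $T_\sigma$ is SG $M$-elliptic, that is, there are constants $C,R>0$ such that $$|\sigma(x,\xi)|\ge C\,\Lambda(x)^{m_2}\Lambda(\xi)^{m_1}\qquad\text{for all }x,\xi\in\mathbb R^n\text{ with }|x|^2+|\xi|^2\ge R^2 .$$ -/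

import Mathlib

open MeasureTheory
open scoped SchwartzMap ContDiff ENNReal ComplexConjugate

noncomputable section

/-! ### Multi-indices and partial derivatives on `ℝⁿ` -/

/-- `ℝⁿ` with its Euclidean norm. -/
abbrev Rn (n : ℕ) : Type := EuclideanSpace ℝ (Fin n)

/-- The length `|α|` of a multi-index. -/
def miLength {n : ℕ} (α : Fin n → ℕ) : ℕ := ∑ i, α i

/-- The monomial `ξ^γ`. -/
def miPow {n : ℕ} (ξ : Rn n) (γ : Fin n → ℕ) : ℝ := ∏ i, ξ i ^ γ i

/-- The partial derivative `∂_i f`. -/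
def pderivAt {n : ℕ} {F : Type*} [NormedAddCommGroup F] [NormedSpace ℝ F] (i : Fin n)
    (f : Rn n → F) : Rn n → F :=
  fun x => fderiv ℝ f x (EuclideanSpace.single i 1)

/-- The iterated partial derivative `∂^α f = ∂_1^{α_1} ⋯ ∂_n^{α_n} f`. -/
def miDeriv {n : ℕ} {F : Type*} [NormedAddCommGroup F] [NormedSpace ℝ F] (α : Fin n → ℕ)
    (f : Rn n → F) : Rn n → F :=
  (List.finRange n).foldr (fun i g => (pderivAt i)^[α i] g) f

/-- `(∂_x^α ∂_ξ^β σ)(x, ξ)`. -/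
def symbolDeriv {n : ℕ} (α β : Fin n → ℕ) (σ : Rn n → Rn n → ℂ) (x ξ : Rn n) : ℂ :=
  miDeriv α (fun y => miDeriv β (σ y) ξ) x

/-! ### Weight functions and symbol classes -/

/-- `Λ` is a weight function with polynomial growth on `ℝⁿ`, with associated constant `μ`. -/
structure IsWeightFunction {n : ℕ} (Λ : Rn n → ℝ) (μ : ℝ) : Prop where
  smooth : ContDiff ℝ ∞ Λ
  pos : ∀ ξ, 0 < Λ ξ
  growth : ∃ μ₀ μ₁ C₀ C₁ : ℝ, 0 < μ₀ ∧ μ₀ ≤ μ₁ ∧ μ₁ ≤ μ ∧ 0 < C₀ ∧ C₀ ≤ C₁ ∧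
    ∀ ξ, C₀ * (1 + ‖ξ‖) ^ μ₀ ≤ Λ ξ ∧ Λ ξ ≤ C₁ * (1 + ‖ξ‖) ^ μ₁
  deriv_bound : ∀ α γ : Fin n → ℕ, (∀ j, γ j ≤ 1) → ∃ C : ℝ, 0 < C ∧
    ∀ ξ, |miPow ξ γ * miDeriv (α + γ) Λ ξ| ≤ C * Λ ξ ^ (1 - (miLength α : ℝ) / μ)

/-- The SG class `S^{m₁,m₂}_{ρ,Λ}`: smooth symbols with
`|∂_x^α ∂_ξ^β σ(x, ξ)| ≤ C_{α,β} Λ(x)^{m₂ - ρ|α|} Λ(ξ)^{m₁ - ρ|β|}`. -/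
structure IsSGSymbol {n : ℕ} (Λ : Rn n → ℝ) (ρ m₁ m₂ : ℝ) (σ : Rn n → Rn n → ℂ) : Prop where
  smooth : ContDiff ℝ ∞ (fun z : Rn n × Rn n => σ z.1 z.2)
  bound : ∀ α β : Fin n → ℕ, ∃ C : ℝ, 0 < C ∧ ∀ x ξ, ‖symbolDeriv α β σ x ξ‖ ≤
    C * Λ x ^ (m₂ - ρ * (miLength α : ℝ)) * Λ ξ ^ (m₁ - ρ * (miLength β : ℝ))

/-- The SG class `M^{m₁,m₂}_{ρ,Λ}`: smooth symbols such that `ξ^γ ∂_ξ^γ σ` is in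
`S^{m₁,m₂}_{ρ,Λ}` for every `γ ∈ {0,1}ⁿ` (for `γ = 0` this says that `σ` itself is). -/
def IsSGMSymbol {n : ℕ} (Λ : Rn n → ℝ) (ρ m₁ m₂ : ℝ) (σ : Rn n → Rn n → ℂ) : Prop :=
  ContDiff ℝ ∞ (fun z : Rn n × Rn n => σ z.1 z.2) ∧
  ∀ γ : Fin n → ℕ, (∀ j, γ j ≤ 1) →
    IsSGSymbol Λ ρ m₁ m₂ (fun x ξ => (miPow ξ γ : ℂ) * miDeriv γ (σ x) ξ)

/-- SG `M`-ellipticity of a symbol of order `(m₁, m₂)`. -/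
def IsSGMElliptic {n : ℕ} (Λ : Rn n → ℝ) (m₁ m₂ : ℝ) (σ : Rn n → Rn n → ℂ) : Prop :=
  ∃ C R : ℝ, 0 < C ∧ 0 < R ∧ ∀ x ξ : Rn n, R ^ 2 ≤ ‖x‖ ^ 2 + ‖ξ‖ ^ 2 →
    C * Λ x ^ m₂ * Λ ξ ^ m₁ ≤ ‖σ x ξ‖

/-! ### Pseudo-differential operators -/

/-- The Fourier transform `φ̂(ξ) = (2π)^{-n/2} ∫ e^{-i x·ξ} φ(x) dx`. -/
def fourierRn {n : ℕ} (φ : Rn n → ℂ) (ξ : Rn n) : ℂ :=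
  (((2 * Real.pi) ^ (-(n : ℝ) / 2) : ℝ) : ℂ) *
    ∫ x : Rn n, Complex.exp (-Complex.I * (inner ℝ x ξ : ℝ)) * φ x

/-- `(T_σ φ)(x) = (2π)^{-n/2} ∫ e^{i x·ξ} σ(x, ξ) φ̂(ξ) dξ` for a Schwartz function `φ`. -/
def psdo {n : ℕ} (σ : Rn n → Rn n → ℂ) (φ : 𝓢(Rn n, ℂ)) (x : Rn n) : ℂ :=
  (((2 * Real.pi) ^ (-(n : ℝ) / 2) : ℝ) : ℂ) *
    ∫ ξ : Rn n, Complex.exp (Complex.I * (inner ℝ x ξ : ℝ)) * σ x ξ * fourierRn φ ξ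

/-- `A` is a formal adjoint of `T_σ`: `(T_σ φ, ψ) = (φ, A ψ)` for all Schwartz functions, where
`(f, g) = ∫ f ḡ`. -/
def IsFormalAdjoint {n : ℕ} (σ : Rn n → Rn n → ℂ) (A : 𝓢(Rn n, ℂ) →L[ℂ] 𝓢(Rn n, ℂ)) : Prop :=
  ∀ φ ψ : 𝓢(Rn n, ℂ), ∫ x, psdo σ φ x * conj (ψ x) = ∫ x, φ x * conj (A ψ x)

/-- A formal adjoint is unique. -/
theorem IsFormalAdjoint.unique {n : ℕ} {σ : Rn n → Rn n → ℂ}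
    {A B : 𝓢(Rn n, ℂ) →L[ℂ] 𝓢(Rn n, ℂ)} (hA : IsFormalAdjoint σ A) (hB : IsFormalAdjoint σ B) :
    A = B := by
  ext1 ψ
  have hint : ∀ f g : 𝓢(Rn n, ℂ), Integrable (fun x => f x * conj (g x)) := by
    intro f g
    have hf : MemLp f 2 (volume : Measure (Rn n)) := f.memLp 2
    have hg : MemLp (star (g : Rn n → ℂ)) 2 (volume : Measure (Rn n)) := (g.memLp 2 volume).star
    exact hf.integrable_mul hg
  set d : 𝓢(Rn n, ℂ) := A ψ - B ψ with hd
  have h0 : ∫ x, d x * conj (d x) = 0 := by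
    have h1 : ∀ x, d x * conj (d x) = d x * conj (A ψ x) - d x * conj (B ψ x) := by
      intro x
      have h2 : conj (d x) = conj (A ψ x) - conj (B ψ x) := by
        rw [← map_sub]; rfl
      rw [h2, mul_sub]
    simp_rw [h1]
    rw [integral_sub (hint _ _) (hint _ _), ← hA, ← hB, sub_self]
  have h3 : ∀ x, d x * conj (d x) = ((‖d x‖ ^ 2 : ℝ) : ℂ) := by
    intro x
    rw [Complex.mul_conj, Complex.normSq_eq_norm_sq]
  simp_rw [h3] at h0
  rw [integral_complex_ofReal, Complex.ofReal_eq_zero] at h0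
  have hcont : Continuous (fun x => ‖d x‖ ^ 2) := by fun_prop
  have hi : Integrable (fun x => ‖d x‖ ^ 2) := by
    have h4 := (hint d d).norm
    refine h4.congr (Filter.Eventually.of_forall fun x => ?_)
    simp [pow_two]
  have h5 := (integral_eq_zero_iff_of_nonneg (fun x => by positivity) hi).1 h0
  have h6 : (fun x => ‖d x‖ ^ 2) = 0 :=
    Continuous.ae_eq_iff_eq volume hcont continuous_zero |>.1 h5
  have h7 : d = 0 := by
    ext x
    have h8 := congrFun h6 x
    simpa using h8
  exact sub_eq_zero.1 h7

open Classical in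
/-- The formal adjoint `T_σ^*`, as an operator on the Schwartz space. It exists for every symbol
in one of the classes above; where no formal adjoint exists the value is `0` by convention. -/
def formalAdjoint {n : ℕ} (σ : Rn n → Rn n → ℂ) : 𝓢(Rn n, ℂ) →L[ℂ] 𝓢(Rn n, ℂ) :=
  if h : ∃ A, IsFormalAdjoint σ A then h.choose else 0

theorem IsFormalAdjoint.formalAdjoint_eq {n : ℕ} {σ : Rn n → Rn n → ℂ}
    {A : 𝓢(Rn n, ℂ) →L[ℂ] 𝓢(Rn n, ℂ)} (hA : IsFormalAdjoint σ A) : formalAdjoint σ = A := by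
  have h : ∃ A, IsFormalAdjoint σ A := ⟨A, hA⟩
  rw [formalAdjoint, dif_pos h]
  exact h.choose_spec.unique hA

/-- Complex conjugation `φ ↦ φ̄` on the Schwartz space. -/
def schwartzConj (n : ℕ) : 𝓢(Rn n, ℂ) →SL[starRingEnd ℂ] 𝓢(Rn n, ℂ) where
  toFun φ := SchwartzMap.postcompCLM (𝕜 := ℝ) (Complex.conjCLE : ℂ →L[ℝ] ℂ) φ
  map_add' φ ψ := map_add _ φ ψ
  map_smul' c φ := by
    ext x
    simp
  cont := (SchwartzMap.postcompCLM (𝕜 := ℝ) (Complex.conjCLE : ℂ →L[ℝ] ℂ)).continuous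

theorem schwartzConj_apply {n : ℕ} (φ : 𝓢(Rn n, ℂ)) (x : Rn n) :
    schwartzConj n φ x = conj (φ x) := rfl

/-- The operator `T_σ` on tempered distributions: `(T_σ u)(φ) = u(conj (T_σ^* (conj φ)))`. -/
def psdoDist {n : ℕ} (σ : Rn n → Rn n → ℂ) : 𝓢'(Rn n, ℂ) →L[ℂ] 𝓢'(Rn n, ℂ) :=
  PointwiseConvergenceCLM.precomp ℂ
    ((schwartzConj n).comp ((formalAdjoint σ).comp (schwartzConj n)))

theorem psdoDist_apply {n : ℕ} (σ : Rn n → Rn n → ℂ) (u : 𝓢'(Rn n, ℂ)) (φ : 𝓢(Rn n, ℂ)) :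
    psdoDist σ u φ = u (schwartzConj n (formalAdjoint σ (schwartzConj n φ))) := rfl

/-! ### SG Sobolev spaces -/

/-- The symbol `σ_{m₁,m₂}(x, ξ) = Λ(x)^{-m₂} Λ(ξ)^{-m₁}`. -/
def sgBesselSymbol {n : ℕ} (Λ : Rn n → ℝ) (m₁ m₂ : ℝ) (x ξ : Rn n) : ℂ :=
  ((Λ x ^ (-m₂) * Λ ξ ^ (-m₁) : ℝ) : ℂ)

/-- The operator `J_{m₁,m₂} = T_{σ_{m₁,m₂}}` on tempered distributions. -/
def sgBessel {n : ℕ} (Λ : Rn n → ℝ) (m₁ m₂ : ℝ) : 𝓢'(Rn n, ℂ) →L[ℂ] 𝓢'(Rn n, ℂ) :=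
  psdoDist (sgBesselSymbol Λ m₁ m₂)

/-- The embedding of `L^p(ℝⁿ)` into the tempered distributions. -/
def lpToDist (n : ℕ) (p : ℝ≥0∞) [Fact (1 ≤ p)] :
    Lp ℂ p (volume : Measure (Rn n)) →ₗ[ℂ] 𝓢'(Rn n, ℂ) :=
  (Lp.toTemperedDistributionCLM ℂ (volume : Measure (Rn n)) p).toLinearMap

theorem lpToDist_injective (n : ℕ) (p : ℝ≥0∞) [Fact (1 ≤ p)] :
    Function.Injective (lpToDist n p) :=
  LinearMap.ker_eq_bot.1 Lp.ker_toTemperedDistributionCLM_eq_bot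

/-- `H^{s₁,s₂,p}_Λ = {u ∈ 𝓢' : J_{-s₁,-s₂} u ∈ L^p}` as a subspace of the tempered
distributions. -/
def sgSobolevSubmodule {n : ℕ} (Λ : Rn n → ℝ) (s₁ s₂ : ℝ) (p : ℝ≥0∞) [Fact (1 ≤ p)] :
    Submodule ℂ 𝓢'(Rn n, ℂ) :=
  (LinearMap.range (lpToDist n p)).comap (sgBessel Λ (-s₁) (-s₂)).toLinearMap

/-- `H^{s₁,s₂,p}_Λ` as a space of its own, carrying the Sobolev norm and not the topology of the
tempered distributions. -/
def SGSobolev {n : ℕ} (Λ : Rn n → ℝ) (s₁ s₂ : ℝ) (p : ℝ≥0∞) [Fact (1 ≤ p)] : Type :=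
  sgSobolevSubmodule Λ s₁ s₂ p

namespace SGSobolev

variable {n : ℕ} {Λ : Rn n → ℝ} {s₁ s₂ : ℝ} {p : ℝ≥0∞} [Fact (1 ≤ p)]

instance : AddCommGroup (SGSobolev Λ s₁ s₂ p) :=
  inferInstanceAs (AddCommGroup (sgSobolevSubmodule Λ s₁ s₂ p))

instance : Module ℂ (SGSobolev Λ s₁ s₂ p) :=
  inferInstanceAs (Module ℂ (sgSobolevSubmodule Λ s₁ s₂ p))

/-- The underlying tempered distribution. -/
def toDist : SGSobolev Λ s₁ s₂ p →ₗ[ℂ] 𝓢'(Rn n, ℂ) :=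
  (sgSobolevSubmodule Λ s₁ s₂ p).subtype

/-- The function `J_{-s₁,-s₂} u ∈ L^p(ℝⁿ)`. -/
def toLp : SGSobolev Λ s₁ s₂ p →ₗ[ℂ] Lp ℂ p (volume : Measure (Rn n)) :=
  (LinearEquiv.ofInjective (lpToDist n p) (lpToDist_injective n p)).symm.toLinearMap ∘ₗ
    LinearMap.codRestrict (LinearMap.range (lpToDist n p))
      ((sgBessel Λ (-s₁) (-s₂)).toLinearMap ∘ₗ (sgSobolevSubmodule Λ s₁ s₂ p).subtype)
      (fun u => u.2)

theorem lpToDist_toLp (u : SGSobolev Λ s₁ s₂ p) :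
    lpToDist n p (toLp u) = sgBessel Λ (-s₁) (-s₂) (toDist u) :=
  congrArg Subtype.val
    ((LinearEquiv.ofInjective (lpToDist n p) (lpToDist_injective n p)).apply_symm_apply
      ⟨sgBessel Λ (-s₁) (-s₂) (toDist u), u.2⟩)

/-- The norm `‖u‖_{s₁,s₂,p,Λ} = ‖J_{-s₁,-s₂} u‖_{L^p}`. -/
instance : SeminormedAddCommGroup (SGSobolev Λ s₁ s₂ p) :=
  SeminormedAddCommGroup.induced _ _ (toLp (Λ := Λ) (s₁ := s₁) (s₂ := s₂) (p := p))

theorem norm_def (u : SGSobolev Λ s₁ s₂ p) : ‖u‖ = ‖toLp u‖ := rfl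

instance : NormedSpace ℂ (SGSobolev Λ s₁ s₂ p) :=
  NormedSpace.induced ℂ _ _ (toLp (Λ := Λ) (s₁ := s₁) (s₂ := s₂) (p := p))

end SGSobolev

/-- `T_σ` maps `H^{s₁,s₂,p}_Λ` boundedly into `H^{t₁,t₂,p}_Λ`, and is a Fredholm operator between
these two spaces. -/
def IsSGFredholm {n : ℕ} (Λ : Rn n → ℝ) (p : ℝ≥0∞) [Fact (1 ≤ p)] (s₁ s₂ t₁ t₂ : ℝ)
    (σ : Rn n → Rn n → ℂ) : Prop :=
  ∃ A : SGSobolev Λ s₁ s₂ p →L[ℂ] SGSobolev Λ t₁ t₂ p,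
    (∀ u, SGSobolev.toDist (A u) = psdoDist σ (SGSobolev.toDist u)) ∧ A.IsFredholm

end

open MeasureTheory
open scoped SchwartzMap ContDiff ENNReal ComplexConjugate

/-! ### Iterated directional derivatives -/

noncomputable section

variable {V W F : Type*} [NormedAddCommGroup V] [NormedSpace ℝ V] [NormedAddCommGroup W]
  [NormedSpace ℝ W] [NormedAddCommGroup F] [NormedSpace ℝ F]

/-! If ellipticity fails, there are points `(x_k, ξ_k)` of phase space tending to infinity at which
`Λ(x_k)^{-m₂} Λ(ξ_k)^{-m₁} σ(x_k, ξ_k)` tends to `0` (`exists_seq_of_not_isSGMElliptic`). Wave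
packets `e^{i x·ξ_k} φ((x - x_k) / h_k)` concentrated at these points form a singular sequence for
`T_σ`, which a Fredholm operator cannot have.

Conjugation by such a packet replaces `σ` by `σ(x_k + h_k x, ξ_k + h_k⁻¹ ξ)` (`psdo_wavePacket`).
The function `Λ^ρ` is Lipschitz, so `Λ` varies slowly on the scales in question
(`IsWeightFunction.exists_slowly_varying`). After division by `Λ(x_k)^{m₂} Λ(ξ_k)^{m₁}`, each
`x`-derivative of the rescaled symbol therefore gains `h_k Λ(x_k)^{-ρ}` and each `ξ`-derivative
gains `h_k⁻¹ Λ(ξ_k)^{-ρ}`, up to polynomial factors (`HasSGBounds.exists_scaledSymbol_bound`). If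
`|x_k| → ∞`, the choice `h_k = Λ(x_k)^{ρ/2}` makes both gains at most a multiple `ε_k` of
`Λ(x_k)^{-ρ/2}`, which tends to `0`; if `|ξ_k| → ∞`, take `h_k = Λ(ξ_k)^{-ρ/2}`. The rescaled
symbols thus become constant, and the operators converge on the Schwartz space to multiplication by
the limit of their values at the centre (`HasSGBounds.tendsto_psdoSw_scaledSymbol`).

This limit is `1` for the symbols defining the Sobolev norms and `0` for `σ`. With packets `u_k`
normalized in `L^p` and multiplied by `Λ(x_k)^{-s₂} Λ(ξ_k)^{-s₁}`, the Sobolev norm of `u_k` tends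
to `‖φ‖_p ≠ 0` and that of `T_σ u_k` tends to `0`. Since `h_k` tends to `∞` or to `0` and `1 < p <
∞`, the functions `J_{-s₁,-s₂} u_k` tend to zero when tested against Schwartz functions
(`tendsto_integral_wavePacket_mul`). A Fredholm operator is bounded below modulo a
finite-dimensional space, where such weak convergence is norm convergence, so the norms of `u_k`
would have to tend to `0` (`SGSobolev.tendsto_norm_zero_of_isFredholm`).
`not_isSGFredholm_of_isScaling` assembles the contradiction. -/

/-- The derivative of `f` in the direction `v`. -/
def dirDeriv (v : V) (f : V → F) : V → F := fun z => fderiv ℝ f z v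

/-- The iterated derivative of `f` along a list of directions, the last one being taken first. -/
def iterDirDeriv (L : List V) (f : V → F) : V → F := L.foldr dirDeriv f

@[simp] theorem iterDirDeriv_nil (f : V → F) : iterDirDeriv [] f = f := rfl

@[simp] theorem iterDirDeriv_cons (v : V) (L : List V) (f : V → F) :
    iterDirDeriv (v :: L) f = dirDeriv v (iterDirDeriv L f) := rfl

theorem iterDirDeriv_append (L L' : List V) (f : V → F) :
    iterDirDeriv (L ++ L') f = iterDirDeriv L (iterDirDeriv L' f) := by
  simp [iterDirDeriv, List.foldr_append]

theorem ContDiff.dirDeriv {f : V → F} (hf : ContDiff ℝ ∞ f) (v : V) :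
    ContDiff ℝ ∞ (dirDeriv v f) :=
  (hf.fderiv_right (m := ∞) (by simp)).clm_apply contDiff_const

theorem ContDiff.iterDirDeriv {f : V → F} (hf : ContDiff ℝ ∞ f) (L : List V) :
    ContDiff ℝ ∞ (iterDirDeriv L f) := by
  induction L with
  | nil => exact hf
  | cons v L ih => exact ih.dirDeriv v

theorem ContDiff.differentiable_infty {f : V → F} (hf : ContDiff ℝ ∞ f) : Differentiable ℝ f :=
  hf.differentiable (by simp)

/-- Symmetry of the second derivative. It makes lists of directions insensitive to order, which is
what allows them to replace multi-indices. -/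
theorem dirDeriv_comm {f : V → F} (hf : ContDiff ℝ ∞ f) (v w : V) :
    dirDeriv v (dirDeriv w f) = dirDeriv w (dirDeriv v f) := by
  have h2 : ContDiff ℝ 2 f := hf.of_le (WithTop.coe_le_coe.2 le_top)
  have key : ∀ a b : V, ∀ z, dirDeriv a (dirDeriv b f) z = fderiv ℝ (fderiv ℝ f) z a b := by
    intro a b z
    have hd : DifferentiableAt ℝ (fderiv ℝ f) z :=
      (hf.fderiv_right (m := ∞) (by simp)).differentiable_infty z
    change fderiv ℝ (fun z => (fderiv ℝ f z) b) z a = _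
    rw [fderiv_clm_apply hd (differentiableAt_const b)]
    simp
  funext z
  rw [key, key]
  exact (h2.contDiffAt.isSymmSndFDerivAt (by simp)).eq v w

theorem iterDirDeriv_perm {f : V → F} (hf : ContDiff ℝ ∞ f) {L L' : List V} (h : L.Perm L') :
    iterDirDeriv L f = iterDirDeriv L' f := by
  induction h with
  | nil => rfl
  | cons v _ ih => simp [ih]
  | swap v w L => exact dirDeriv_comm (hf.iterDirDeriv L) _ _
  | trans _ _ ih₁ ih₂ => exact ih₁.trans ih₂

/-- The inner map has constant derivative, so the chain rule only transports the directions and no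
further terms arise. Restriction to sections, exchange of variables and rescaling are all instances.
-/
theorem iterDirDeriv_comp_affine {f : W → F} (hf : ContDiff ℝ ∞ f) (w : W) (A : V →L[ℝ] W)
    (L : List V) :
    iterDirDeriv L (fun z => f (w + A z)) =
      fun z => iterDirDeriv (L.map A) f (w + A z) := by
  induction L with
  | nil => rfl
  | cons v L ih =>
    funext z
    rw [iterDirDeriv_cons, ih, List.map_cons, iterDirDeriv_cons]
    have h1 : HasFDerivAt (iterDirDeriv (L.map A) f)
        (fderiv ℝ (iterDirDeriv (L.map A) f) (w + A z)) (w + A z) :=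
      ((hf.iterDirDeriv _).differentiable_infty _).hasFDerivAt
    have h2 : HasFDerivAt (fun z => w + A z) A z := A.hasFDerivAt.const_add w
    simp only [dirDeriv]
    rw [show (fun z => iterDirDeriv (L.map A) f (w + A z)) =
      iterDirDeriv (L.map A) f ∘ (fun z => w + A z) from rfl, (h1.comp z h2).fderiv]
    rfl

theorem dirDeriv_add {f g : V → F} (hf : ContDiff ℝ ∞ f) (hg : ContDiff ℝ ∞ g) (v : V) :
    dirDeriv v (fun z => f z + g z) = fun z => dirDeriv v f z + dirDeriv v g z := by
  funext z
  simp only [dirDeriv]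
  rw [fderiv_fun_add (hf.differentiable_infty z) (hg.differentiable_infty z)]
  rfl

theorem dirDeriv_smul_left (c : ℝ) (v : V) (f : V → F) :
    dirDeriv (c • v) f = fun z => c • dirDeriv v f z := by
  funext z
  simp [dirDeriv]

theorem iterDirDeriv_const_smul {f : V → F} (hf : ContDiff ℝ ∞ f) (c : ℝ) (L : List V) :
    iterDirDeriv L (fun z => c • f z) = fun z => c • iterDirDeriv L f z := by
  induction L with
  | nil => rfl
  | cons v L ih =>
    rw [iterDirDeriv_cons, ih]
    funext z
    simp only [dirDeriv, iterDirDeriv_cons]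
    rw [fderiv_fun_const_smul ((hf.iterDirDeriv L).differentiable_infty z)]
    rfl

/-- The innermost derivative, which sits at the end of the list, already kills the constant. -/
theorem iterDirDeriv_sub_const {f : V → F} (c : F) {L : List V} (hL : L ≠ []) :
    iterDirDeriv L (fun z => f z - c) = iterDirDeriv L f := by
  obtain ⟨L', v, rfl⟩ := List.eq_nil_or_concat L |>.resolve_left hL
  rw [List.concat_eq_append, iterDirDeriv_append, iterDirDeriv_append]
  congr 1
  funext z
  simp [dirDeriv, fderiv_sub_const]

end

/-! ### Coordinate directions -/

noncomputable section

/-- The `i`-th standard basis vector of `ℝⁿ`. -/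
def stdVec {n : ℕ} (i : Fin n) : Rn n := EuclideanSpace.single i 1

/-- The coordinate directions of `ℝⁿ × ℝⁿ`: `inl i` stands for `∂_{x_i}`, `inr i` for
`∂_{ξ_i}`. -/
def phaseVec {n : ℕ} : Fin n ⊕ Fin n → Rn n × Rn n
  | Sum.inl i => (stdVec i, 0)
  | Sum.inr i => (0, stdVec i)

/-- The list of coordinate indices in which `i` occurs `α i` times. -/
def miList {n : ℕ} (α : Fin n → ℕ) : List (Fin n) :=
  (List.finRange n).flatMap (fun i => List.replicate (α i) i)

theorem miDeriv_eq_iterDirDeriv {n : ℕ} {F : Type*} [NormedAddCommGroup F] [NormedSpace ℝ F]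
    (α : Fin n → ℕ) (f : Rn n → F) :
    miDeriv α f = iterDirDeriv ((miList α).map stdVec) f := by
  unfold miDeriv miList
  induction List.finRange n with
  | nil => rfl
  | cons i l ih =>
    rw [List.foldr_cons, ih, List.flatMap_cons, List.map_append, iterDirDeriv_append]
    generalize iterDirDeriv ((l.flatMap fun i => List.replicate (α i) i).map stdVec) f = g
    induction α i with
    | zero => rfl
    | succ k ih => rw [Function.iterate_succ_apply', ih]; rfl

theorem perm_miList_count {n : ℕ} (L : List (Fin n)) : L.Perm (miList (fun i => L.count i)) := by
  rw [List.perm_iff_count]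
  intro a
  rw [miList, List.count_flatMap]
  have h : (List.count a ∘ fun i => List.replicate (L.count i) i) =
      fun i => if i = a then L.count a else 0 := by
    funext i
    by_cases h : i = a
    · subst h; simp
    · simp [List.count_replicate, h]
  rw [h, ← List.ofFn_eq_map, List.sum_ofFn]
  simp

theorem miLength_count {n : ℕ} (L : List (Fin n)) : miLength (fun i => L.count i) = L.length := by
  unfold miLength
  induction L with
  | nil => simp
  | cons a L ih =>
    simp only [List.count_cons, List.length_cons, Finset.sum_add_distrib, ih]
    simp

theorem iterDirDeriv_map_stdVec {n : ℕ} {F : Type*} [NormedAddCommGroup F] [NormedSpace ℝ F]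
    {f : Rn n → F} (hf : ContDiff ℝ ∞ f) (L : List (Fin n)) :
    iterDirDeriv (L.map stdVec) f = miDeriv (fun i => L.count i) f := by
  rw [miDeriv_eq_iterDirDeriv]
  exact iterDirDeriv_perm hf ((perm_miList_count L).map _)

theorem iterDirDeriv_section_right {n : ℕ} {F : Type*} [NormedAddCommGroup F] [NormedSpace ℝ F]
    {S : Rn n × Rn n → F} (hS : ContDiff ℝ ∞ S) (x : Rn n) (L : List (Fin n)) (ξ : Rn n) :
    iterDirDeriv (L.map stdVec) (fun ξ => S (x, ξ)) ξ =
      iterDirDeriv ((L.map Sum.inr).map phaseVec) S (x, ξ) := by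
  have h := congrFun (iterDirDeriv_comp_affine hS (x, 0) (ContinuousLinearMap.inr ℝ (Rn n) (Rn n))
    (L.map stdVec)) ξ
  simp only [ContinuousLinearMap.inr_apply, Prod.mk_add_mk, add_zero, zero_add, List.map_map] at h
  rw [h, List.map_map]
  rfl

theorem iterDirDeriv_section_left {n : ℕ} {F : Type*} [NormedAddCommGroup F] [NormedSpace ℝ F]
    {S : Rn n × Rn n → F} (hS : ContDiff ℝ ∞ S) (ξ : Rn n) (L : List (Fin n)) (x : Rn n) :
    iterDirDeriv (L.map stdVec) (fun x => S (x, ξ)) x =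
      iterDirDeriv ((L.map Sum.inl).map phaseVec) S (x, ξ) := by
  have h := congrFun (iterDirDeriv_comp_affine hS (0, ξ) (ContinuousLinearMap.inl ℝ (Rn n) (Rn n))
    (L.map stdVec)) x
  simp only [ContinuousLinearMap.inl_apply, Prod.mk_add_mk, add_zero, zero_add, List.map_map] at h
  rw [h, List.map_map]
  rfl

theorem symbolDeriv_eq_iterDirDeriv {n : ℕ} {σ : Rn n → Rn n → ℂ}
    (hσ : ContDiff ℝ ∞ (fun z : Rn n × Rn n => σ z.1 z.2)) (α β : Fin n → ℕ) (x ξ : Rn n) :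
    symbolDeriv α β σ x ξ = iterDirDeriv
      (((miList α).map Sum.inl ++ (miList β).map Sum.inr).map phaseVec)
      (fun z : Rn n × Rn n => σ z.1 z.2) (x, ξ) := by
  unfold symbolDeriv
  have h1 : ∀ y, miDeriv β (σ y) ξ = iterDirDeriv (((miList β).map Sum.inr).map phaseVec)
      (fun z : Rn n × Rn n => σ z.1 z.2) (y, ξ) := by
    intro y
    rw [miDeriv_eq_iterDirDeriv]
    exact iterDirDeriv_section_right hσ y _ ξ
  simp_rw [h1]
  rw [miDeriv_eq_iterDirDeriv, iterDirDeriv_section_left (hσ.iterDirDeriv _), List.map_append,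
    iterDirDeriv_append]

/-- The number of derivatives `∂_{x_i}` in a list of coordinate directions. -/
def leftCount {n : ℕ} (L : List (Fin n ⊕ Fin n)) : ℕ := L.countP Sum.isLeft

/-- The number of derivatives `∂_{ξ_i}` in a list of coordinate directions. -/
def rightCount {n : ℕ} (L : List (Fin n ⊕ Fin n)) : ℕ := L.countP Sum.isRight

theorem perm_inl_append_inr {n : ℕ} (L : List (Fin n ⊕ Fin n)) :
    ∃ A B : List (Fin n), L.Perm (A.map Sum.inl ++ B.map Sum.inr) ∧
      A.length = leftCount L ∧ B.length = rightCount L := by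
  induction L with
  | nil => exact ⟨[], [], by simp, rfl, rfl⟩
  | cons d L ih =>
    obtain ⟨A, B, h, hA, hB⟩ := ih
    cases d with
    | inl i =>
      refine ⟨i :: A, B, by simpa using h, ?_, ?_⟩
      · simp [leftCount, hA, List.countP_cons]
      · simp [rightCount, hB]
    | inr i =>
      refine ⟨A, i :: B, ?_, ?_, ?_⟩
      · rw [List.map_cons]
        exact (h.cons _).trans List.perm_middle.symm
      · simp [leftCount, hA]
      · simp [rightCount, hB, List.countP_cons]

/-- Sorting the directions, first by variable and then by index, reduces derivatives taken in any
order to those controlled by the symbol estimates. -/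
theorem exists_symbolDeriv_eq_iterDirDeriv {n : ℕ} {σ : Rn n → Rn n → ℂ}
    (hσ : ContDiff ℝ ∞ (fun z : Rn n × Rn n => σ z.1 z.2)) (L : List (Fin n ⊕ Fin n)) :
    ∃ α β : Fin n → ℕ, miLength α = leftCount L ∧ miLength β = rightCount L ∧ ∀ x ξ,
      iterDirDeriv (L.map phaseVec) (fun z : Rn n × Rn n => σ z.1 z.2) (x, ξ) =
        symbolDeriv α β σ x ξ := by
  obtain ⟨A, B, h, hA, hB⟩ := perm_inl_append_inr L
  refine ⟨fun i => A.count i, fun i => B.count i, by rw [miLength_count, hA],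
    by rw [miLength_count, hB], fun x ξ => ?_⟩
  rw [symbolDeriv_eq_iterDirDeriv hσ]
  refine congrFun (iterDirDeriv_perm hσ (List.Perm.map _ ?_)) _
  exact h.trans (((perm_miList_count A).map _).append ((perm_miList_count B).map _))

/-- Write `fderiv f = ∑ T_i (∂_i f)`, where `T_i` tensors with the `i`-th coordinate functional and
has norm at most `1`. -/
theorem norm_iteratedFDeriv_succ_le_sum {n : ℕ} {F : Type*} [NormedAddCommGroup F]
    [NormedSpace ℝ F] {f : Rn n → F} {m : ℕ} (hf : ContDiff ℝ (m + 1 : ℕ) f) (x : Rn n) :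
    ‖iteratedFDeriv ℝ (m + 1) f x‖ ≤ ∑ i, ‖iteratedFDeriv ℝ m (dirDeriv (stdVec i) f) x‖ := by
  have hd : ContDiff ℝ m (fderiv ℝ f) := hf.fderiv_right (by norm_cast)
  have hdi : ∀ i : Fin n, ContDiff ℝ m (dirDeriv (stdVec i) f) := fun i =>
    hd.clm_apply contDiff_const
  let T : Fin n → F →L[ℝ] (Rn n →L[ℝ] F) := fun i =>
    ContinuousLinearMap.smulRightL ℝ (Rn n) F (EuclideanSpace.proj i)
  have hT : ∀ i, ‖T i‖ ≤ 1 := by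
    intro i
    refine ContinuousLinearMap.opNorm_le_bound _ zero_le_one fun y => ?_
    refine ContinuousLinearMap.opNorm_le_bound _ (by positivity) fun v => ?_
    change ‖v i • y‖ ≤ 1 * ‖y‖ * ‖v‖
    rw [norm_smul, one_mul, mul_comm]
    gcongr
    exact PiLp.norm_apply_le v i
  have hsum : fderiv ℝ f = fun y => ∑ i, T i (dirDeriv (stdVec i) f y) := by
    funext y
    ext v
    have hv : v = ∑ i, v i • stdVec i := by
      have h := (EuclideanSpace.basisFun (Fin n) ℝ).sum_repr v
      simpa [stdVec] using h.symm
    rw [sum_apply]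
    change _ = ∑ i, v i • fderiv ℝ f y (stdVec i)
    conv_lhs => rw [hv]
    simp
  have hTd : ∀ i, ContDiff ℝ m (fun y => T i (dirDeriv (stdVec i) f y)) := fun i =>
    (T i).contDiff.comp (hdi i)
  rw [← norm_iteratedFDeriv_fderiv, hsum, iteratedFDeriv_fun_sum_apply
    (fun i _ => (hTd i).contDiffAt)]
  refine (norm_sum_le _ _).trans (Finset.sum_le_sum fun i _ => ?_)
  have h := (T i).norm_iteratedFDeriv_comp_left (f := dirDeriv (stdVec i) f) (x := x)
    ((hdi i).contDiffAt) (n := m) le_rfl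
  exact h.trans (mul_le_of_le_one_left (norm_nonneg _) (hT i))

theorem norm_iteratedFDeriv_le_of_iterDirDeriv {n : ℕ} {F : Type*} [NormedAddCommGroup F]
    [NormedSpace ℝ F] (m : ℕ) {f : Rn n → F} (hf : ContDiff ℝ ∞ f) (x : Rn n) {C : ℝ}
    (h : ∀ L : List (Fin n), L.length = m → ‖iterDirDeriv (L.map stdVec) f x‖ ≤ C) :
    ‖iteratedFDeriv ℝ m f x‖ ≤ (n : ℝ) ^ m * C := by
  induction m generalizing f with
  | zero => simpa using h [] rfl
  | succ m ih =>
    refine (norm_iteratedFDeriv_succ_le_sum (hf.of_le (by exact_mod_cast le_top)) x).trans ?_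
    have h1 : ∀ i : Fin n, ‖iteratedFDeriv ℝ m (dirDeriv (stdVec i) f) x‖ ≤ (n : ℝ) ^ m * C := by
      intro i
      -- The induction peels off the derivative taken first, so the new index is appended at the end
      -- of the list.
      refine ih (hf.dirDeriv _) fun L hL => ?_
      have := h (L ++ [i]) (by simp [hL])
      rwa [List.map_append, iterDirDeriv_append] at this
    refine (Finset.sum_le_sum fun i _ => h1 i).trans (le_of_eq ?_)
    simp [pow_succ]
    ring

theorem finite_setOf_length_eq {n : ℕ} (m : ℕ) : {L : List (Fin n) | L.length = m}.Finite :=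
  List.finite_length_eq (Fin n) m

end

/-! ### An increasing sequence of seminorms on the Schwartz space -/

noncomputable section

open scoped FourierTransform

/-- The supremum of the Schwartz seminorms of indices at most `(N, N)`. -/
def swNorm {n : ℕ} (N : ℕ) : Seminorm ℂ 𝓢(Rn n, ℂ) :=
  (Finset.Iic (N, N)).sup (fun m => SchwartzMap.seminorm ℂ m.1 m.2)

theorem swNorm_mono {n : ℕ} {N M : ℕ} (h : N ≤ M) (φ : 𝓢(Rn n, ℂ)) : swNorm N φ ≤ swNorm M φ :=
  Seminorm.le_def.1 (Finset.sup_mono (Finset.Iic_subset_Iic.2 (Prod.mk_le_mk.2 ⟨h, h⟩))) φ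

theorem swNorm_nonneg {n : ℕ} (N : ℕ) (φ : 𝓢(Rn n, ℂ)) : 0 ≤ swNorm N φ := apply_nonneg _ _

theorem exists_sup_le_swNorm {n : ℕ} (s : Finset (ℕ × ℕ)) :
    ∃ N, s.sup (schwartzSeminormFamily ℂ (Rn n) ℂ) ≤ swNorm N := by
  refine ⟨s.sup (fun m => m.1 + m.2), Finset.sup_mono fun m hm => ?_⟩
  have h : m.1 + m.2 ≤ s.sup (fun m => m.1 + m.2) := Finset.le_sup (f := fun m => m.1 + m.2) hm
  exact Finset.mem_Iic.2 (Prod.mk_le_mk.2 ⟨by omega, by omega⟩)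

theorem seminorm_le_swNorm {n : ℕ} {k j N : ℕ} (hk : k ≤ N) (hj : j ≤ N) (φ : 𝓢(Rn n, ℂ)) :
    SchwartzMap.seminorm ℂ k j φ ≤ swNorm N φ :=
  Seminorm.le_def.1 (Finset.le_sup (f := fun m : ℕ × ℕ => SchwartzMap.seminorm ℂ m.1 m.2)
    (Finset.mem_Iic.2 (Prod.mk_le_mk.2 ⟨hk, hj⟩) : (k, j) ∈ Finset.Iic (N, N))) φ

theorem pow_mul_norm_iteratedFDeriv_le_swNorm {n : ℕ} {k j N : ℕ} (hk : k ≤ N) (hj : j ≤ N)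
    (φ : 𝓢(Rn n, ℂ)) (x : Rn n) :
    (1 + ‖x‖) ^ k * ‖iteratedFDeriv ℝ j φ x‖ ≤ 2 ^ N * swNorm N φ :=
  SchwartzMap.one_add_le_sup_seminorm_apply (𝕜 := ℂ) (m := (N, N)) hk hj φ x

theorem pow_mul_norm_le_swNorm {n : ℕ} (N : ℕ) (φ : 𝓢(Rn n, ℂ)) (x : Rn n) :
    (1 + ‖x‖) ^ N * ‖φ x‖ ≤ 2 ^ N * swNorm N φ := by
  simpa using pow_mul_norm_iteratedFDeriv_le_swNorm le_rfl (Nat.zero_le N) φ x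

theorem swNorm_le {n : ℕ} {N : ℕ} {φ : 𝓢(Rn n, ℂ)} {C : ℝ} (hC : 0 ≤ C)
    (h : ∀ j ≤ N, ∀ x, (1 + ‖x‖) ^ N * ‖iteratedFDeriv ℝ j φ x‖ ≤ C) : swNorm N φ ≤ C := by
  refine Seminorm.finset_sup_apply_le hC fun m hm => ?_
  have hm' := Prod.mk_le_mk.1 (Finset.mem_Iic.1 hm)
  refine SchwartzMap.seminorm_le_bound ℂ m.1 m.2 φ hC fun x => ?_
  refine le_trans ?_ (h m.2 hm'.2 x)
  gcongr
  calc ‖x‖ ^ m.1 ≤ (1 + ‖x‖) ^ m.1 := by gcongr; linarith [norm_nonneg x]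
    _ ≤ (1 + ‖x‖) ^ N := pow_le_pow_right₀ (by linarith [norm_nonneg x]) hm'.1

theorem continuous_swNorm {n : ℕ} (N : ℕ) : Continuous (swNorm N : Seminorm ℂ 𝓢(Rn n, ℂ)) := by
  exact (schwartz_withSeminorms ℂ (Rn n) ℂ).finset_sups.continuous_seminorm (Finset.Iic (N, N))

theorem exists_swNorm_comp_le {n : ℕ} (T : 𝓢(Rn n, ℂ) →L[ℂ] 𝓢(Rn n, ℂ)) (N : ℕ) :
    ∃ (M : ℕ) (C : ℝ), 0 ≤ C ∧ ∀ φ, swNorm N (T φ) ≤ C * swNorm M φ := by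
  obtain ⟨s, C, -, h⟩ := Seminorm.bound_of_continuous (schwartz_withSeminorms ℂ (Rn n) ℂ)
    ((swNorm N).comp T.toLinearMap) ((continuous_swNorm N).comp T.continuous)
  obtain ⟨M, hM⟩ := exists_sup_le_swNorm (n := n) s
  refine ⟨M, C, C.2, fun φ => (Seminorm.le_def.1 h φ).trans ?_⟩
  exact mul_le_mul_of_nonneg_left (Seminorm.le_def.1 hM φ) C.2

theorem tendsto_schwartz_iff {n : ℕ} {ι : Type*} {l : Filter ι} {u : ι → 𝓢(Rn n, ℂ)}
    {φ : 𝓢(Rn n, ℂ)} :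
    Filter.Tendsto u l (nhds φ) ↔
      ∀ N, Filter.Tendsto (fun k => swNorm N (u k - φ)) l (nhds 0) := by
  constructor
  · intro h N
    have h1 : Filter.Tendsto (fun k => swNorm N (u k - φ)) l (nhds (swNorm N (φ - φ))) :=
      ((continuous_swNorm N).tendsto _).comp (h.sub_const φ)
    simpa using h1
  · intro h
    rw [(schwartz_withSeminorms ℂ (Rn n) ℂ).tendsto_nhds]
    intro m ε hε
    filter_upwards [(h (m.1 + m.2)).eventually (gt_mem_nhds hε)] with k hk
    exact (seminorm_le_swNorm (Nat.le_add_right _ _) (Nat.le_add_left _ _) _).trans_lt hk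

/-! ### Amplitudes -/

/-- A family of smooth amplitudes on `ℝⁿ × ℝⁿ` satisfying polynomial bounds that are uniform in
the family; the growth in the first variable may depend on the derivatives in that variable, but
not on those in the second variable. -/
structure IsAmplitude {n : ℕ} {ι : Type*} (a : ι → Rn n × Rn n → ℂ) : Prop where
  smooth : ∀ k, ContDiff ℝ ∞ (a k)
  bound : ∀ A : List (Fin n), ∃ N : ℕ, ∀ B : List (Fin n), ∃ (C : ℝ) (M : ℕ), ∀ k x y,
    ‖iterDirDeriv ((B.map Sum.inr ++ A.map Sum.inl).map phaseVec) (a k) (x, y)‖ ≤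
      C * (1 + ‖x‖) ^ N * (1 + ‖y‖) ^ M

namespace IsAmplitude

variable {n : ℕ} {ι : Type*} {a : ι → Rn n × Rn n → ℂ}

theorem dirDeriv_inl (ha : IsAmplitude a) (i : Fin n) :
    IsAmplitude (fun k => dirDeriv (phaseVec (Sum.inl i)) (a k)) := by
  refine ⟨fun k => (ha.smooth k).dirDeriv _, fun A => ?_⟩
  obtain ⟨N, hN⟩ := ha.bound (A ++ [i])
  refine ⟨N, fun B => ?_⟩
  obtain ⟨C, M, h⟩ := hN B
  refine ⟨C, M, fun k x y => ?_⟩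
  have := h k x y
  rwa [List.map_append (f := Sum.inl), ← List.append_assoc, List.map_append (f := phaseVec),
    iterDirDeriv_append] at this

/-- No derivative falls on the first variable here, so the power `N` of `1 + ‖x‖` is the one
belonging to the empty list and serves every order `m`. -/
theorem exists_iteratedFDeriv_section_bound (ha : IsAmplitude a) :
    ∃ N : ℕ, ∀ m : ℕ, ∃ (C : ℝ) (M : ℕ), 0 ≤ C ∧ ∀ k x y, ∀ j ≤ m,
      ‖iteratedFDeriv ℝ j (fun y => a k (x, y)) y‖ ≤ C * (1 + ‖x‖) ^ N * (1 + ‖y‖) ^ M := by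
  obtain ⟨N, hN⟩ := ha.bound []
  choose C M h using hN
  have hsec : ∀ k x, ContDiff ℝ ∞ (fun y => a k (x, y)) := fun k x =>
    (ha.smooth k).comp (contDiff_const.prodMk contDiff_id)
  have key : ∀ j : ℕ, ∃ (C : ℝ) (M : ℕ), 0 ≤ C ∧ ∀ k x y,
      ‖iteratedFDeriv ℝ j (fun y => a k (x, y)) y‖ ≤ C * (1 + ‖x‖) ^ N * (1 + ‖y‖) ^ M := by
    intro j
    set s : Finset (List (Fin n)) := (finite_setOf_length_eq (n := n) j).toFinset
    refine ⟨(n : ℝ) ^ j * ∑ B ∈ s, |C B|, ∑ B ∈ s, M B, by positivity, fun k x y => ?_⟩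
    have := norm_iteratedFDeriv_le_of_iterDirDeriv j (hsec k x) y
      (C := (∑ B ∈ s, |C B|) * (1 + ‖x‖) ^ N * (1 + ‖y‖) ^ (∑ B ∈ s, M B)) ?_
    · simpa only [mul_assoc] using this
    · intro B hB
      have hBs : B ∈ s := by simpa [s] using hB
      have h1 := h B k x y
      rw [List.map_nil, List.append_nil, ← iterDirDeriv_section_right (ha.smooth k)] at h1
      refine h1.trans ?_
      have h2 : C B ≤ ∑ B ∈ s, |C B| := (le_abs_self _).trans
        (Finset.single_le_sum (f := fun B => |C B|) (fun _ _ => abs_nonneg _) hBs)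
      have h3 : (1 + ‖y‖) ^ (M B) ≤ (1 + ‖y‖) ^ (∑ B ∈ s, M B) :=
        pow_le_pow_right₀ (by linarith [norm_nonneg y])
          (Finset.single_le_sum (f := M) (fun _ _ => Nat.zero_le _) hBs)
      have h4 : 0 ≤ ∑ B ∈ s, |C B| := Finset.sum_nonneg fun _ _ => abs_nonneg _
      gcongr
  choose C M hC h using key
  refine ⟨N, fun m => ⟨∑ j ∈ Finset.range (m + 1), C j, ∑ j ∈ Finset.range (m + 1), M j,
    Finset.sum_nonneg fun j _ => hC j, fun k x y j hj => (h j k x y).trans ?_⟩⟩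
  have hjm : j ∈ Finset.range (m + 1) := Finset.mem_range_succ_iff.2 hj
  have h2 : C j ≤ ∑ j ∈ Finset.range (m + 1), C j :=
    Finset.single_le_sum (fun j _ => hC j) hjm
  have h3 : (1 + ‖y‖) ^ (M j) ≤ (1 + ‖y‖) ^ (∑ j ∈ Finset.range (m + 1), M j) :=
    pow_le_pow_right₀ (by linarith [norm_nonneg y])
      (Finset.single_le_sum (f := M) (fun _ _ => Nat.zero_le _) hjm)
  have h4 : 0 ≤ ∑ j ∈ Finset.range (m + 1), C j := Finset.sum_nonneg fun j _ => hC j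
  gcongr

theorem hasTemperateGrowth_section (ha : IsAmplitude a) (k : ι) (x : Rn n) :
    Function.HasTemperateGrowth (fun y => a k (x, y)) := by
  obtain ⟨N, hN⟩ := ha.exists_iteratedFDeriv_section_bound
  refine ⟨(ha.smooth k).comp (contDiff_const.prodMk contDiff_id), fun m => ?_⟩
  obtain ⟨C, M, -, h⟩ := hN m
  exact ⟨M, C * (1 + ‖x‖) ^ N, fun y => h k x y m le_rfl⟩

/-- Leibniz' rule. It matters that `N` is fixed before the seminorm `m`: the growth in `x` can then
be beaten by choosing a stronger seminorm. -/
theorem exists_swNorm_smulLeft_le (ha : IsAmplitude a) :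
    ∃ N : ℕ, ∀ m : ℕ, ∃ (C : ℝ) (M : ℕ), 0 ≤ C ∧ ∀ k x φ,
      swNorm m (SchwartzMap.smulLeftCLM ℂ (fun y => a k (x, y)) φ) ≤
        C * (1 + ‖x‖) ^ N * swNorm M φ := by
  obtain ⟨N, hN⟩ := ha.exists_iteratedFDeriv_section_bound
  refine ⟨N, fun m => ?_⟩
  obtain ⟨C, M, hC, h⟩ := hN m
  -- The factor `2 ^ m` bounds the sum of binomial coefficients; `2 ^ (m + M)` is the cost of
  -- passing from `‖y‖` to `1 + ‖y‖` in the Schwartz seminorms.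
  refine ⟨2 ^ m * C * 2 ^ (m + M), m + M, by positivity, fun k x φ => ?_⟩
  have hpos : 0 ≤ swNorm (m + M) φ := swNorm_nonneg _ _
  refine swNorm_le (by positivity) fun j hj y => ?_
  have hfun : ⇑(SchwartzMap.smulLeftCLM ℂ (fun y => a k (x, y)) φ) =
      fun y => a k (x, y) * φ y := by
    funext y
    rw [SchwartzMap.smulLeftCLM_apply_apply (ha.hasTemperateGrowth_section k x), smul_eq_mul]
  rw [hfun]
  have hL := norm_iteratedFDeriv_mul_le (N := ∞) (n := j)
    (ha.hasTemperateGrowth_section k x).1 (φ.smooth ⊤) y (by exact_mod_cast le_top)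
  have hterm : ∀ i ∈ Finset.range (j + 1),
      (j.choose i : ℝ) * ‖iteratedFDeriv ℝ i (fun y => a k (x, y)) y‖ *
        ‖iteratedFDeriv ℝ (j - i) φ y‖ ≤
      (j.choose i : ℝ) * (C * (1 + ‖x‖) ^ N * (1 + ‖y‖) ^ M * ‖iteratedFDeriv ℝ (j - i) φ y‖) := by
    intro i hi
    have := h k x y i ((Finset.mem_range_succ_iff.1 hi).trans hj)
    rw [mul_assoc]
    gcongr
  have hterm2 : ∀ i, (1 + ‖y‖) ^ m * ((1 + ‖y‖) ^ M * ‖iteratedFDeriv ℝ (j - i) φ y‖) ≤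
      2 ^ (m + M) * swNorm (m + M) φ := by
    intro i
    rw [← mul_assoc, ← pow_add]
    exact pow_mul_norm_iteratedFDeriv_le_swNorm le_rfl (by omega) φ y
  calc (1 + ‖y‖) ^ m * ‖iteratedFDeriv ℝ j (fun y => a k (x, y) * φ y) y‖
      ≤ (1 + ‖y‖) ^ m * ∑ i ∈ Finset.range (j + 1), (j.choose i : ℝ) *
          (C * (1 + ‖x‖) ^ N * (1 + ‖y‖) ^ M * ‖iteratedFDeriv ℝ (j - i) φ y‖) := by
        gcongr
        exact hL.trans (Finset.sum_le_sum hterm)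
    _ = ∑ i ∈ Finset.range (j + 1), (j.choose i : ℝ) * (C * (1 + ‖x‖) ^ N *
          ((1 + ‖y‖) ^ m * ((1 + ‖y‖) ^ M * ‖iteratedFDeriv ℝ (j - i) φ y‖))) := by
        rw [Finset.mul_sum]
        refine Finset.sum_congr rfl fun i _ => by ring
    _ ≤ ∑ i ∈ Finset.range (j + 1), (j.choose i : ℝ) * (C * (1 + ‖x‖) ^ N *
          (2 ^ (m + M) * swNorm (m + M) φ)) := by
        refine Finset.sum_le_sum fun i _ => ?_
        exact mul_le_mul_of_nonneg_left
          (mul_le_mul_of_nonneg_left (hterm2 i) (by positivity)) (by positivity)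
    _ = 2 ^ j * (C * (1 + ‖x‖) ^ N * (2 ^ (m + M) * swNorm (m + M) φ)) := by
        rw [← Finset.sum_mul]
        congr 1
        exact_mod_cast Nat.sum_range_choose j
    _ ≤ 2 ^ m * (C * (1 + ‖x‖) ^ N * (2 ^ (m + M) * swNorm (m + M) φ)) := by
        gcongr
        norm_num
    _ = _ := by ring

end IsAmplitude

/-! ### Oscillatory integral operators -/

/-- The function `x ↦ ∫ e^{i x·y} a(x, y) φ(y) dy`. -/
def ampOp {n : ℕ} (a : Rn n × Rn n → ℂ) (φ : Rn n → ℂ) (x : Rn n) : ℂ :=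
  ∫ y : Rn n, Complex.exp (Complex.I * (inner ℝ x y : ℝ)) * a (x, y) * φ y

theorem norm_exp_I_mul_ofReal (t : ℝ) : ‖Complex.exp (Complex.I * (t : ℂ))‖ = 1 := by
  rw [mul_comm]
  exact Complex.norm_exp_ofReal_mul_I t

namespace IsAmplitude

variable {n : ℕ} {ι : Type*} {a : ι → Rn n × Rn n → ℂ}

/-- With `x` frozen in the amplitude, the oscillatory integral is an inverse Fourier transform; the
argument `x / 2π` corrects for the `2π` in the exponent of `𝓕⁻`. -/
theorem ampOp_eq_fourierInv (ha : IsAmplitude a) (k : ι) (φ : 𝓢(Rn n, ℂ)) (x : Rn n) :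
    ampOp (a k) φ x =
      (𝓕⁻ (SchwartzMap.smulLeftCLM ℂ (fun y => a k (x, y)) φ)) ((2 * Real.pi)⁻¹ • x) := by
  rw [SchwartzMap.fourierInv_coe, Real.fourierInv_eq']
  unfold ampOp
  congr 1
  funext y
  rw [SchwartzMap.smulLeftCLM_apply_apply (ha.hasTemperateGrowth_section k x), smul_eq_mul,
    smul_eq_mul, real_inner_smul_right, real_inner_comm, mul_assoc]
  congr 2
  rw [mul_inv_cancel_left₀ (by positivity)]
  ring

theorem integrable (ha : IsAmplitude a) (k : ι) (φ : 𝓢(Rn n, ℂ)) (x : Rn n) :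
    Integrable (fun y => Complex.exp (Complex.I * (inner ℝ x y : ℝ)) * a k (x, y) * φ y) := by
  have h := (SchwartzMap.smulLeftCLM ℂ (fun y => a k (x, y)) φ).integrable (μ := volume)
  have h2 : Integrable (fun y => Complex.exp (Complex.I * (inner ℝ x y : ℝ)) *
      (SchwartzMap.smulLeftCLM ℂ (fun y => a k (x, y)) φ) y) := by
    refine h.bdd_mul (c := 1) ?_ ?_
    · exact (by fun_prop : Continuous fun y : Rn n =>
        Complex.exp (Complex.I * (inner ℝ x y : ℝ))).aestronglyMeasurable
    · exact Filter.Eventually.of_forall fun y => (norm_exp_I_mul_ofReal _).le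
  refine h2.congr (Filter.Eventually.of_forall fun y => ?_)
  simp only
  rw [SchwartzMap.smulLeftCLM_apply_apply (ha.hasTemperateGrowth_section k x), smul_eq_mul,
    mul_assoc]

/-- The inverse Fourier transform of a Schwartz function decays to every order. Decay of order `K +
N` is requested, of which `N` powers pay for the growth of the amplitude in `x`. -/
theorem exists_norm_ampOp_le (ha : IsAmplitude a) (K : ℕ) :
    ∃ (M : ℕ) (C : ℝ), 0 ≤ C ∧ ∀ k (φ : 𝓢(Rn n, ℂ)) x,
      (1 + ‖x‖) ^ K * ‖ampOp (a k) φ x‖ ≤ C * swNorm M φ := by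
  obtain ⟨N, hN⟩ := ha.exists_swNorm_smulLeft_le
  obtain ⟨M₁, C₁, hC₁, h₁⟩ := exists_swNorm_comp_le
    (n := n) (FourierTransform.fourierInvCLM ℂ 𝓢(Rn n, ℂ)) (K + N)
  obtain ⟨C₂, M₂, hC₂, h₂⟩ := hN M₁
  have hpi : (1 : ℝ) ≤ 2 * Real.pi := by linarith [Real.pi_gt_three]
  refine ⟨M₂, (2 * Real.pi) ^ (K + N) * (2 ^ (K + N) * (C₁ * C₂)), by positivity,
    fun k φ x => ?_⟩
  rw [ha.ampOp_eq_fourierInv]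
  set ψ := SchwartzMap.smulLeftCLM ℂ (fun y => a k (x, y)) φ
  set z := (2 * Real.pi)⁻¹ • x
  have hz : 1 + ‖x‖ ≤ 2 * Real.pi * (1 + ‖z‖) := by
    have : ‖z‖ = (2 * Real.pi)⁻¹ * ‖x‖ := by
      rw [norm_smul, Real.norm_of_nonneg (by positivity)]
    rw [this, mul_add, mul_inv_cancel_left₀ (by positivity)]
    linarith
  have h3 := pow_mul_norm_le_swNorm (K + N) (𝓕⁻ ψ) z
  have h4 : swNorm (K + N) (𝓕⁻ ψ) ≤ C₁ * swNorm M₁ ψ := h₁ ψ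
  have h5 := h₂ k x φ
  have hx : 0 < (1 + ‖x‖) ^ N := by positivity
  refine le_of_mul_le_mul_left ?_ hx
  calc (1 + ‖x‖) ^ N * ((1 + ‖x‖) ^ K * ‖(𝓕⁻ ψ) z‖)
      = (1 + ‖x‖) ^ (K + N) * ‖(𝓕⁻ ψ) z‖ := by ring
    _ ≤ (2 * Real.pi * (1 + ‖z‖)) ^ (K + N) * ‖(𝓕⁻ ψ) z‖ := by gcongr
    _ = (2 * Real.pi) ^ (K + N) * ((1 + ‖z‖) ^ (K + N) * ‖(𝓕⁻ ψ) z‖) := by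
      rw [mul_pow, mul_assoc]
    _ ≤ (2 * Real.pi) ^ (K + N) *
        (2 ^ (K + N) * (C₁ * (C₂ * (1 + ‖x‖) ^ N * swNorm M₂ φ))) := by
      refine mul_le_mul_of_nonneg_left (h3.trans ?_) (by positivity)
      refine mul_le_mul_of_nonneg_left (h4.trans ?_) (by positivity)
      exact mul_le_mul_of_nonneg_left h5 hC₁
    _ = _ := by ring

end IsAmplitude

end

/-! ### Differentiation of oscillatory integrals and continuity on the Schwartz space -/

noncomputable section

theorem eq_sum_stdVec {n : ℕ} (v : Rn n) : v = ∑ i, v i • stdVec i := by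
  have h := (EuclideanSpace.basisFun (Fin n) ℝ).sum_repr v
  simpa [stdVec] using h.symm

theorem clm_apply_eq_sum_stdVec {n : ℕ} {F : Type*} [NormedAddCommGroup F] [NormedSpace ℝ F]
    (A : Rn n →L[ℝ] F) (v : Rn n) : A v = ∑ i, v i • A (stdVec i) := by
  conv_lhs => rw [eq_sum_stdVec v]
  simp

theorem opNorm_le_sum_stdVec {n : ℕ} {F : Type*} [NormedAddCommGroup F] [NormedSpace ℝ F]
    (A : Rn n →L[ℝ] F) : ‖A‖ ≤ ∑ i, ‖A (stdVec i)‖ := by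
  refine A.opNorm_le_bound (Finset.sum_nonneg fun _ _ => norm_nonneg _) fun v => ?_
  rw [clm_apply_eq_sum_stdVec, Finset.sum_mul]
  refine (norm_sum_le _ _).trans (Finset.sum_le_sum fun i _ => ?_)
  rw [norm_smul, mul_comm]
  gcongr
  exact PiLp.norm_apply_le v i

theorem contDiff_succ_of_dirDeriv {n : ℕ} {F : Type*} [NormedAddCommGroup F] [NormedSpace ℝ F]
    {f : Rn n → F} {m : ℕ} (hf : Differentiable ℝ f)
    (h : ∀ i, ContDiff ℝ m (dirDeriv (stdVec i) f)) : ContDiff ℝ (m + 1 : ℕ) f := by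
  rw [Nat.cast_add, Nat.cast_one, contDiff_succ_iff_fderiv_apply]
  refine ⟨hf, by simp, fun v => ?_⟩
  have h1 : (fun x => fderiv ℝ f x v) = fun x => ∑ i, v i • dirDeriv (stdVec i) f x := by
    funext x
    exact clm_apply_eq_sum_stdVec _ _
  rw [h1]
  exact ContDiff.sum fun i _ => contDiff_const.smul (h i)

/-- Multiplication by `i y_j` on the Schwartz space. -/
def coordMul {n : ℕ} (j : Fin n) : 𝓢(Rn n, ℂ) →L[ℂ] 𝓢(Rn n, ℂ) :=
  SchwartzMap.smulLeftCLM ℂ (fun y : Rn n => Complex.I * (inner ℝ (stdVec j) y : ℝ))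

theorem coordMul_apply {n : ℕ} (j : Fin n) (φ : 𝓢(Rn n, ℂ)) (y : Rn n) :
    coordMul j φ y = Complex.I * (inner ℝ (stdVec j) y : ℝ) * φ y := by
  rw [coordMul, SchwartzMap.smulLeftCLM_apply_apply, smul_eq_mul]
  exact (Function.HasTemperateGrowth.const _).mul
    (Function.Complex.hasTemperateGrowth_ofReal.comp (Function.hasTemperateGrowth_inner_right (stdVec j)))

theorem integrable_one_add_norm_pow_mul {n : ℕ} (φ : 𝓢(Rn n, ℂ)) (M : ℕ) :
    Integrable (fun y => (1 + ‖y‖) ^ M * ‖φ y‖) := by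
  have h : (fun y => (1 + ‖y‖) ^ M * ‖φ y‖) = fun y => ∑ k ∈ Finset.range (M + 1),
      (M.choose k : ℝ) * (‖y‖ ^ k * ‖φ y‖) := by
    funext y
    rw [add_comm, add_pow, Finset.sum_mul]
    refine Finset.sum_congr rfl fun k _ => ?_
    simp only [one_pow]
    ring
  rw [h]
  exact integrable_finsetSum _ fun k _ =>
    (SchwartzMap.integrable_pow_mul volume φ k).const_mul _

/-- The derivative of the phase produces the factor `i y_i`, which is absorbed into `φ`. Hence an
`x`-derivative of an oscillatory integral is a sum of two integrals of the same kind, and all orders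
follow by induction. -/
theorem dirDeriv_exp_mul_mul {n : ℕ} {a : Rn n × Rn n → ℂ} (ha : ContDiff ℝ ∞ a)
    (φ : 𝓢(Rn n, ℂ)) (i : Fin n) (x y : Rn n) :
    dirDeriv (phaseVec (Sum.inl i)) (fun z : Rn n × Rn n =>
        Complex.exp (Complex.I * (inner ℝ z.1 z.2 : ℝ)) * a z * φ z.2) (x, y) =
      Complex.exp (Complex.I * (inner ℝ x y : ℝ)) * dirDeriv (phaseVec (Sum.inl i)) a (x, y) *
          φ y +
        Complex.exp (Complex.I * (inner ℝ x y : ℝ)) * a (x, y) * coordMul i φ y := by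
  have hin : HasFDerivAt (fun z : Rn n × Rn n => (inner ℝ z.1 z.2 : ℝ))
      (fderiv ℝ (fun z : Rn n × Rn n => (inner ℝ z.1 z.2 : ℝ)) (x, y)) (x, y) :=
    (differentiableAt_fst.inner ℝ differentiableAt_snd).hasFDerivAt
  have h1 := ((Complex.ofRealCLM.hasFDerivAt.comp (x, y) hin).const_mul Complex.I).cexp
  have h2 := (ha.differentiable_infty (x, y)).hasFDerivAt
  have h3 : HasFDerivAt (fun z : Rn n × Rn n => φ z.2) _ (x, y) :=
    (φ.hasFDerivAt y).comp (x, y) hasFDerivAt_snd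
  have h4 := ((h1.mul h2).mul h3).fderiv
  have h5 : fderiv ℝ (fun z : Rn n × Rn n => (inner ℝ z.1 z.2 : ℝ)) (x, y)
      (phaseVec (Sum.inl i)) = inner ℝ (stdVec i) y := by
    rw [fderiv_inner_apply ℝ differentiableAt_fst differentiableAt_snd]
    simp [phaseVec, fderiv_fst, fderiv_snd]
  rw [dirDeriv]
  refine (congrArg (fun A => A (phaseVec (Sum.inl i))) h4).trans ?_
  simp only [Function.comp_apply, add_apply, smul_apply, ContinuousLinearMap.coe_comp,
    smul_eq_mul, h5, Complex.ofRealCLM_apply, coordMul_apply, ContinuousLinearMap.coe_snd',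
    dirDeriv]
  simp [phaseVec]
  ring

namespace IsAmplitude

variable {n : ℕ} {ι : Type*} {a : ι → Rn n × Rn n → ℂ}

theorem exists_norm_le (ha : IsAmplitude a) :
    ∃ (C : ℝ) (N M : ℕ), 0 ≤ C ∧ ∀ k x y,
      ‖a k (x, y)‖ ≤ C * (1 + ‖x‖) ^ N * (1 + ‖y‖) ^ M := by
  obtain ⟨N, hN⟩ := ha.exists_iteratedFDeriv_section_bound
  obtain ⟨C, M, hC, h⟩ := hN 0
  exact ⟨C, N, M, hC, fun k x y => by simpa using h k x y 0 le_rfl⟩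

/-- Differentiation under the integral sign. The majorant is uniform on the unit ball about `x`,
where `1 + ‖z‖ ≤ 2 + ‖x‖`, and is integrable in `y` by the decay of `φ`. -/
theorem hasFDerivAt_ampOp (ha : IsAmplitude a) (k : ι) (φ : 𝓢(Rn n, ℂ)) (x : Rn n) :
    ∃ A : Rn n →L[ℝ] ℂ, HasFDerivAt (ampOp (a k) φ) A x ∧ ∀ i, A (stdVec i) =
      ampOp (dirDeriv (phaseVec (Sum.inl i)) (a k)) φ x + ampOp (a k) (coordMul i φ) x := by
  set G : Rn n × Rn n → ℂ := fun z =>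
    Complex.exp (Complex.I * (inner ℝ z.1 z.2 : ℝ)) * a k z * φ z.2 with hG
  have hGs : ContDiff ℝ ∞ G := by
    have h1 : ContDiff ℝ ∞ (fun z : Rn n × Rn n => (inner ℝ z.1 z.2 : ℝ)) :=
      contDiff_fst.inner ℝ contDiff_snd
    have h2 : ContDiff ℝ ∞ (fun z : Rn n × Rn n =>
        Complex.exp (Complex.I * (inner ℝ z.1 z.2 : ℝ))) :=
      (contDiff_const.mul (Complex.ofRealCLM.contDiff.comp h1)).cexp
    exact (h2.mul (ha.smooth k)).mul ((φ.smooth ⊤).comp contDiff_snd)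
  let F' : Rn n → Rn n → (Rn n →L[ℝ] ℂ) := fun x y =>
    (fderiv ℝ G (x, y)).comp (ContinuousLinearMap.inl ℝ (Rn n) (Rn n))
  have hF'e : ∀ x y i, F' x y (stdVec i) =
      Complex.exp (Complex.I * (inner ℝ x y : ℝ)) * dirDeriv (phaseVec (Sum.inl i)) (a k) (x, y) *
          φ y +
        Complex.exp (Complex.I * (inner ℝ x y : ℝ)) * a k (x, y) * coordMul i φ y := by
    intro x y i
    rw [← dirDeriv_exp_mul_mul (ha.smooth k)]
    rfl
  have hF'c : ∀ x, Continuous (F' x) := by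
    intro x
    have h1 : Continuous (fderiv ℝ G) := hGs.continuous_fderiv (by simp)
    exact (h1.comp (by fun_prop : Continuous fun y => (x, y))).clm_comp continuous_const
  have hbd : ∀ i, ∃ b : Rn n → ℝ, Integrable b ∧
      ∀ y, ∀ z ∈ Metric.ball x 1, ‖F' z y (stdVec i)‖ ≤ b y := by
    intro i
    obtain ⟨C, N, M, hC, h1⟩ := ha.exists_norm_le
    obtain ⟨C', N', M', hC', h2⟩ := (ha.dirDeriv_inl i).exists_norm_le
    refine ⟨fun y => C' * (2 + ‖x‖) ^ N' * ((1 + ‖y‖) ^ M' * ‖φ y‖) +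
      C * (2 + ‖x‖) ^ N * ((1 + ‖y‖) ^ M * ‖coordMul i φ y‖),
      ((integrable_one_add_norm_pow_mul _ _).const_mul _).add
        ((integrable_one_add_norm_pow_mul _ _).const_mul _), fun y z hz => ?_⟩
    have hzx : 1 + ‖z‖ ≤ 2 + ‖x‖ := by
      have h3 : ‖z - x‖ < 1 := by simpa [dist_eq_norm] using hz
      have h4 : ‖z‖ ≤ ‖z - x‖ + ‖x‖ := by simpa using norm_add_le (z - x) x
      linarith
    rw [hF'e]
    refine (norm_add_le _ _).trans (add_le_add ?_ ?_)
    · rw [norm_mul, norm_mul, norm_exp_I_mul_ofReal, one_mul, ← mul_assoc]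
      refine mul_le_mul_of_nonneg_right ((h2 k z y).trans ?_) (norm_nonneg _)
      gcongr
    · rw [norm_mul, norm_mul, norm_exp_I_mul_ofReal, one_mul, ← mul_assoc]
      refine mul_le_mul_of_nonneg_right ((h1 k z y).trans ?_) (norm_nonneg _)
      gcongr
  choose b hbi hb using hbd
  have hF'b : ∀ y, ∀ z ∈ Metric.ball x 1, ‖F' z y‖ ≤ ∑ i, b i y := fun y z hz =>
    (opNorm_le_sum_stdVec _).trans (Finset.sum_le_sum fun i _ => hb i y z hz)
  have hbint : Integrable (fun y => ∑ i, b i y) := integrable_finsetSum _ fun i _ => hbi i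
  have hF'int : Integrable (F' x) := hbint.mono' (hF'c x).aestronglyMeasurable
    (Filter.Eventually.of_forall fun y => hF'b y x (Metric.mem_ball_self one_pos))
  refine ⟨∫ y, F' x y, ?_, fun i => ?_⟩
  · refine hasFDerivAt_integral_of_dominated_of_fderiv_le (F := fun x y => G (x, y))
      (bound := fun y => ∑ i, b i y) (Metric.ball_mem_nhds x one_pos) ?_ (ha.integrable k φ x)
      (hF'c x).aestronglyMeasurable (Filter.Eventually.of_forall hF'b) hbint ?_
    · exact Filter.Eventually.of_forall fun z =>
        (hGs.continuous.comp (by fun_prop : Continuous fun y => (z, y))).aestronglyMeasurable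
    · refine Filter.Eventually.of_forall fun y z _ => ?_
      have h1 : HasFDerivAt G (fderiv ℝ G (z, y)) (z, y) :=
        (hGs.differentiable_infty _).hasFDerivAt
      exact HasFDerivAt.comp (f := fun e => (e, y)) z h1 (hasFDerivAt_prodMk_left z y)
  · rw [ContinuousLinearMap.integral_apply hF'int]
    simp_rw [hF'e]
    exact integral_add ((ha.dirDeriv_inl i).integrable k φ x) (ha.integrable k (coordMul i φ) x)

theorem dirDeriv_ampOp (ha : IsAmplitude a) (k : ι) (φ : 𝓢(Rn n, ℂ)) (i : Fin n) :
    dirDeriv (stdVec i) (ampOp (a k) φ) = fun x =>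
      ampOp (dirDeriv (phaseVec (Sum.inl i)) (a k)) φ x + ampOp (a k) (coordMul i φ) x := by
  funext x
  obtain ⟨A, hA, h⟩ := ha.hasFDerivAt_ampOp k φ x
  rw [dirDeriv, hA.fderiv, h]

theorem contDiff_ampOp (ha : IsAmplitude a) (k : ι) (φ : 𝓢(Rn n, ℂ)) :
    ContDiff ℝ ∞ (ampOp (a k) φ) := by
  rw [contDiff_infty]
  intro m
  induction m generalizing a φ with
  | zero =>
    have hd : Differentiable ℝ (ampOp (a k) φ) := fun x => by
      obtain ⟨A, hA, -⟩ := ha.hasFDerivAt_ampOp k φ x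
      exact hA.differentiableAt
    exact contDiff_zero.2 hd.continuous
  | succ m ih =>
    refine contDiff_succ_of_dirDeriv (fun x => ?_) fun i => ?_
    · obtain ⟨A, hA, -⟩ := ha.hasFDerivAt_ampOp k φ x
      exact hA.differentiableAt
    · rw [ha.dirDeriv_ampOp]
      exact (ih (ha.dirDeriv_inl i) φ).add (ih ha (coordMul i φ))

theorem exists_norm_iteratedFDeriv_ampOp_le (ha : IsAmplitude a) (m K : ℕ) :
    ∃ (M : ℕ) (C : ℝ), 0 ≤ C ∧ ∀ k (φ : 𝓢(Rn n, ℂ)) x,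
      (1 + ‖x‖) ^ K * ‖iteratedFDeriv ℝ m (ampOp (a k) φ) x‖ ≤ C * swNorm M φ := by
  induction m generalizing a with
  | zero => simpa using ha.exists_norm_ampOp_le K
  | succ m ih =>
    have key : ∀ i : Fin n, ∃ (M : ℕ) (C : ℝ), 0 ≤ C ∧ ∀ k (φ : 𝓢(Rn n, ℂ)) x,
        (1 + ‖x‖) ^ K * ‖iteratedFDeriv ℝ m (dirDeriv (stdVec i) (ampOp (a k) φ)) x‖ ≤
          C * swNorm M φ := by
      intro i
      obtain ⟨M₁, C₁, hC₁, h₁⟩ := ih (ha.dirDeriv_inl i)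
      obtain ⟨M₂, C₂, hC₂, h₂⟩ := ih ha
      obtain ⟨M₃, C₃, hC₃, h₃⟩ := exists_swNorm_comp_le (coordMul i) M₂
      refine ⟨M₁ + M₃, C₁ + C₂ * C₃, by positivity, fun k φ x => ?_⟩
      rw [ha.dirDeriv_ampOp, fun_iteratedFDeriv_add_apply
        (((ha.dirDeriv_inl i).contDiff_ampOp k φ).of_le (by exact_mod_cast le_top)).contDiffAt
        ((ha.contDiff_ampOp k (coordMul i φ)).of_le (by exact_mod_cast le_top)).contDiffAt]
      have h4 := h₁ k φ x
      have h5 := h₂ k (coordMul i φ) x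
      have h6 := swNorm_mono (Nat.le_add_right M₁ M₃) φ
      have h7 := swNorm_mono (Nat.le_add_left M₃ M₁) φ
      calc _ ≤ (1 + ‖x‖) ^ K * (‖iteratedFDeriv ℝ m
                (ampOp (dirDeriv (phaseVec (Sum.inl i)) (a k)) φ) x‖ +
              ‖iteratedFDeriv ℝ m (ampOp (a k) (coordMul i φ)) x‖) := by
            gcongr
            exact norm_add_le _ _
        _ ≤ C₁ * swNorm M₁ φ + C₂ * (C₃ * swNorm M₃ φ) := by
            rw [mul_add]
            exact add_le_add h4 (h5.trans (mul_le_mul_of_nonneg_left (h₃ φ) hC₂))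
        _ ≤ C₁ * swNorm (M₁ + M₃) φ + C₂ * (C₃ * swNorm (M₁ + M₃) φ) := by gcongr
        _ = _ := by ring
    choose M C hC h using key
    refine ⟨∑ i, M i, ∑ i, C i, Finset.sum_nonneg fun i _ => hC i, fun k φ x => ?_⟩
    have h1 := norm_iteratedFDeriv_succ_le_sum (m := m)
      ((ha.contDiff_ampOp k φ).of_le (by exact_mod_cast le_top)) x
    calc _ ≤ (1 + ‖x‖) ^ K * ∑ i, ‖iteratedFDeriv ℝ m
              (dirDeriv (stdVec i) (ampOp (a k) φ)) x‖ := by gcongr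
      _ ≤ ∑ i, C i * swNorm (∑ i, M i) φ := by
        rw [Finset.mul_sum]
        refine Finset.sum_le_sum fun i _ => (h i k φ x).trans ?_
        exact mul_le_mul_of_nonneg_left (swNorm_mono
          (Finset.single_le_sum (f := M) (fun _ _ => Nat.zero_le _) (Finset.mem_univ i)) φ) (hC i)
      _ = _ := by rw [Finset.sum_mul]

/-- The operator with amplitude `a k`, as a continuous operator on the Schwartz space. -/
def toCLM (ha : IsAmplitude a) (k : ι) : 𝓢(Rn n, ℂ) →L[ℂ] 𝓢(Rn n, ℂ) :=
  SchwartzMap.mkCLM (fun φ => ampOp (a k) φ)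
    (fun φ ψ x => by
      simp only [ampOp, add_apply, mul_add]
      exact integral_add (ha.integrable k φ x) (ha.integrable k ψ x))
    (fun c φ x => by
      simp only [ampOp, smul_apply, smul_eq_mul, RingHom.id_apply]
      rw [← integral_const_mul]
      congr 1
      funext y
      ring)
    (fun φ => ha.contDiff_ampOp k φ)
    (fun m => by
      obtain ⟨M, C, hC, h⟩ := ha.exists_norm_iteratedFDeriv_ampOp_le m.2 m.1
      refine ⟨Finset.Iic (M, M), C, hC, fun φ x => le_trans ?_ (h k φ x)⟩
      gcongr
      linarith [norm_nonneg x])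

/-- Equicontinuity of the whole family: `M` and `C` do not depend on `k`. This is what makes the
remainder in `tendsto_psdoSw` vanish. -/
theorem exists_swNorm_toCLM_le (ha : IsAmplitude a) (m : ℕ) :
    ∃ (M : ℕ) (C : ℝ), 0 ≤ C ∧ ∀ k (φ : 𝓢(Rn n, ℂ)), swNorm m (ha.toCLM k φ) ≤ C * swNorm M φ := by
  have key := fun j => ha.exists_norm_iteratedFDeriv_ampOp_le j m
  choose M C hC h using key
  refine ⟨∑ j ∈ Finset.range (m + 1), M j, ∑ j ∈ Finset.range (m + 1), C j,
    Finset.sum_nonneg fun j _ => hC j, fun k φ => ?_⟩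
  refine swNorm_le (mul_nonneg (Finset.sum_nonneg fun j _ => hC j) (swNorm_nonneg _ _))
    fun j hj x => (h j k φ x).trans ?_
  have hjm : j ∈ Finset.range (m + 1) := Finset.mem_range_succ_iff.2 hj
  refine mul_le_mul (Finset.single_le_sum (fun j _ => hC j) hjm) (swNorm_mono
    (Finset.single_le_sum (f := M) (fun _ _ => Nat.zero_le _) hjm) φ) (swNorm_nonneg _ _)
    (Finset.sum_nonneg fun j _ => hC j)

end IsAmplitude

end

/-! ### The Fourier transform in the normalization of pseudo-differential operators -/

noncomputable section

open scoped FourierTransform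

/-- The normalizing constant `(2π)^{-n/2}`. -/
def fourierConst (n : ℕ) : ℂ := (((2 * Real.pi) ^ (-(n : ℝ) / 2) : ℝ) : ℂ)

theorem fourierConst_ne_zero (n : ℕ) : fourierConst n ≠ 0 := by
  rw [fourierConst, Complex.ofReal_ne_zero]
  positivity

theorem fourierConst_sq_mul (n : ℕ) :
    fourierConst n * fourierConst n * (((2 * Real.pi) ^ n : ℝ) : ℂ) = 1 := by
  rw [fourierConst, ← Complex.ofReal_mul, ← Complex.ofReal_mul, ← Complex.ofReal_one,
    Complex.ofReal_inj, ← Real.rpow_add (by positivity), ← Real.rpow_natCast,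
    ← Real.rpow_add (by positivity)]
  rw [show -(n : ℝ) / 2 + -(n : ℝ) / 2 + n = 0 by ring, Real.rpow_zero]

theorem conj_fourierConst (n : ℕ) : conj (fourierConst n) = fourierConst n :=
  Complex.conj_ofReal _

/-- The dilation `x ↦ c x` for `c ≠ 0`. -/
def dilation (n : ℕ) (c : ℝ) (hc : c ≠ 0) : Rn n ≃L[ℝ] Rn n :=
  ContinuousLinearEquiv.smulLeft (Units.mk0 c hc)

theorem dilation_apply {n : ℕ} {c : ℝ} (hc : c ≠ 0) (x : Rn n) : dilation n c hc x = c • x := rfl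

theorem two_pi_ne_zero' : (2 * Real.pi) ≠ 0 := by positivity

/-- The Fourier transform `φ ↦ φ̂` on the Schwartz space. -/
def fourierSw (n : ℕ) : 𝓢(Rn n, ℂ) →L[ℂ] 𝓢(Rn n, ℂ) :=
  fourierConst n • (SchwartzMap.compCLMOfContinuousLinearEquiv ℂ
    (dilation n (2 * Real.pi)⁻¹ (inv_ne_zero two_pi_ne_zero'))).comp
      (FourierTransform.fourierCLM ℂ 𝓢(Rn n, ℂ))

/-- The inverse Fourier transform on the Schwartz space. -/
def fourierInvSw (n : ℕ) : 𝓢(Rn n, ℂ) →L[ℂ] 𝓢(Rn n, ℂ) :=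
  (fourierConst n)⁻¹ • (FourierTransform.fourierInvCLM ℂ 𝓢(Rn n, ℂ)).comp
    (SchwartzMap.compCLMOfContinuousLinearEquiv ℂ (dilation n (2 * Real.pi) two_pi_ne_zero'))

theorem fourierSw_apply' {n : ℕ} (φ : 𝓢(Rn n, ℂ)) (ξ : Rn n) :
    fourierSw n φ ξ = fourierConst n * (𝓕 φ) ((2 * Real.pi)⁻¹ • ξ) := rfl

theorem fourierSw_apply {n : ℕ} (φ : 𝓢(Rn n, ℂ)) (ξ : Rn n) :
    fourierSw n φ ξ = fourierRn φ ξ := by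
  rw [fourierSw_apply', SchwartzMap.fourier_coe, Real.fourier_eq', fourierRn, fourierConst]
  congr 2
  funext x
  rw [real_inner_smul_right, smul_eq_mul]
  congr 2
  rw [← mul_assoc, mul_assoc (-2) Real.pi, mul_comm (-2)]
  push_cast
  have : (Real.pi : ℂ) ≠ 0 := by exact_mod_cast Real.pi_ne_zero
  field_simp

theorem fourierInvSw_fourierSw {n : ℕ} (φ : 𝓢(Rn n, ℂ)) :
    fourierInvSw n (fourierSw n φ) = φ := by
  have h : SchwartzMap.compCLMOfContinuousLinearEquiv ℂ
      (dilation n (2 * Real.pi) two_pi_ne_zero') (fourierSw n φ) = fourierConst n • 𝓕 φ := by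
    ext x
    rw [SchwartzMap.compCLMOfContinuousLinearEquiv_apply, Function.comp_apply, fourierSw_apply',
      dilation_apply, smul_smul, inv_mul_cancel₀ two_pi_ne_zero', one_smul]
    rfl
  change (fourierConst n)⁻¹ • (FourierTransform.fourierInvCLM ℂ 𝓢(Rn n, ℂ))
    (SchwartzMap.compCLMOfContinuousLinearEquiv ℂ
      (dilation n (2 * Real.pi) two_pi_ne_zero') (fourierSw n φ)) = φ
  rw [h, map_smul, smul_smul, inv_mul_cancel₀ (fourierConst_ne_zero n), one_smul]
  change 𝓕⁻ (𝓕 φ : 𝓢(Rn n, ℂ)) = φ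
  exact FourierTransform.fourierInv_fourier_eq φ

theorem fourierInvSw_apply {n : ℕ} (φ : 𝓢(Rn n, ℂ)) (x : Rn n) :
    fourierInvSw n φ x =
      fourierConst n * ∫ ξ, Complex.exp (Complex.I * (inner ℝ x ξ : ℝ)) * φ ξ := by
  have h : fourierInvSw n φ x = (fourierConst n)⁻¹ * (𝓕⁻ (SchwartzMap.compCLMOfContinuousLinearEquiv
      ℂ (dilation n (2 * Real.pi) two_pi_ne_zero') φ)) x := rfl
  rw [h, SchwartzMap.fourierInv_coe, Real.fourierInv_eq']
  have h2 := Measure.integral_comp_smul (volume : Measure (Rn n))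
    (fun ξ => Complex.exp (Complex.I * (inner ℝ x ξ : ℝ)) * φ ξ) (2 * Real.pi)
  rw [finrank_euclideanSpace_fin] at h2
  have h3 : ∀ v : Rn n, Complex.exp (((2 * Real.pi * inner ℝ v x : ℝ) : ℂ) * Complex.I) •
      (SchwartzMap.compCLMOfContinuousLinearEquiv ℂ
        (dilation n (2 * Real.pi) two_pi_ne_zero') φ) v =
      Complex.exp (Complex.I * (inner ℝ x ((2 * Real.pi) • v) : ℝ)) * φ ((2 * Real.pi) • v) := by
    intro v
    rw [SchwartzMap.compCLMOfContinuousLinearEquiv_apply, Function.comp_apply, dilation_apply,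
      smul_eq_mul, real_inner_smul_right, real_inner_comm, mul_comm Complex.I]
  simp_rw [h3]
  rw [h2, abs_of_pos (by positivity), Complex.real_smul, ← mul_assoc]
  congr 1
  have h4 := fourierConst_sq_mul n
  have h5 : (((2 * Real.pi) ^ n : ℝ) : ℂ) ≠ 0 := by
    rw [Complex.ofReal_ne_zero]; positivity
  rw [Complex.ofReal_inv]
  field_simp [fourierConst_ne_zero n]
  linear_combination -h4

/-- Parseval's formula for `𝓕`, transported by the dilation by `2π`; the Jacobian `(2π)^n` is
cancelled by the square of the normalizing constant. -/
theorem integral_fourierSw_mul_conj {n : ℕ} (φ ψ : 𝓢(Rn n, ℂ)) :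
    ∫ ξ, fourierSw n φ ξ * conj (ψ ξ) = ∫ x, φ x * conj (fourierInvSw n ψ x) := by
  have h2 := Measure.integral_comp_smul (volume : Measure (Rn n))
    (fun ξ => fourierSw n φ ξ * conj (ψ ξ)) (2 * Real.pi)
  rw [finrank_euclideanSpace_fin, abs_of_pos (by positivity)] at h2
  set χ := SchwartzMap.compCLMOfContinuousLinearEquiv ℂ
        (dilation n (2 * Real.pi) two_pi_ne_zero') ψ with hχ
  have h3 : ∀ ξ : Rn n, fourierSw n φ ((2 * Real.pi) • ξ) * conj (ψ ((2 * Real.pi) • ξ)) =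
      fourierConst n * conj (conj (𝓕 φ ξ) * χ ξ) := by
    intro ξ
    rw [fourierSw_apply', smul_smul, inv_mul_cancel₀ two_pi_ne_zero', one_smul, hχ,
      SchwartzMap.compCLMOfContinuousLinearEquiv_apply, Function.comp_apply, dilation_apply,
      map_mul, Complex.conj_conj, mul_assoc]
  have h4 := SchwartzMap.integral_sesq_fourier_eq φ χ (innerSL ℂ)
  simp only [innerSL_apply_apply, RCLike.inner_apply] at h4
  simp_rw [h3, integral_const_mul, integral_conj, mul_comm (conj (𝓕 φ _))] at h2
  rw [h4, ← integral_conj] at h2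
  have h5 : ∀ x, φ x * conj (fourierInvSw n ψ x) = (fourierConst n)⁻¹ *
      conj ((𝓕⁻ χ) x * conj (φ x)) := by
    intro x
    have : fourierInvSw n ψ x = (fourierConst n)⁻¹ * (𝓕⁻ χ) x := rfl
    rw [this, map_mul, map_mul, map_inv₀, conj_fourierConst, Complex.conj_conj]
    ring
  simp_rw [h5]
  rw [integral_const_mul]
  have h6 := fourierConst_sq_mul n
  have h7 : (((2 * Real.pi) ^ n : ℝ) : ℂ) ≠ 0 := by
    rw [Complex.ofReal_ne_zero]; positivity
  rw [Complex.real_smul, Complex.ofReal_inv] at h2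
  have hc := fourierConst_ne_zero n
  field_simp at h2 ⊢
  linear_combination (-fourierConst n) * h2 +
    (∫ x, conj ((𝓕⁻ χ) x * conj (φ x))) * h6

/-! ### Pseudo-differential operators on the Schwartz space -/

/-- The operator `T_σ` on the Schwartz space. -/
def psdoSw {n : ℕ} {σ : Rn n → Rn n → ℂ}
    (hσ : IsAmplitude (fun (_ : Unit) (z : Rn n × Rn n) => σ z.1 z.2)) :
    𝓢(Rn n, ℂ) →L[ℂ] 𝓢(Rn n, ℂ) :=
  fourierConst n • (hσ.toCLM ()).comp (fourierSw n)

theorem psdoSw_apply {n : ℕ} {σ : Rn n → Rn n → ℂ}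
    (hσ : IsAmplitude (fun (_ : Unit) (z : Rn n × Rn n) => σ z.1 z.2)) (φ : 𝓢(Rn n, ℂ))
    (x : Rn n) : psdoSw hσ φ x = psdo σ φ x := by
  change fourierConst n * ampOp _ (fourierSw n φ) x = _
  simp only [ampOp, psdo, fourierConst, fourierSw_apply]

/-- By Parseval and Fubini the adjoint is the inverse Fourier transform of `ξ ↦ (2π)^{-n/2} ∫ e^{-i
x·ξ} conj (σ(x, ξ)) ψ(x) dx`. For fixed `ξ` this integrates over `x`, so the symbol must be an
amplitude with its variables exchanged as well. -/
theorem exists_isFormalAdjoint {n : ℕ} {σ : Rn n → Rn n → ℂ}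
    (hσ : IsAmplitude (fun (_ : Unit) (z : Rn n × Rn n) => σ z.1 z.2))
    (hσ' : IsAmplitude (fun (_ : Unit) (z : Rn n × Rn n) => σ z.2 z.1)) :
    ∃ A, IsFormalAdjoint σ A := by
  refine ⟨(fourierInvSw n).comp (fourierConst n •
    ((schwartzConj n).comp ((hσ'.toCLM ()).comp (schwartzConj n)))), fun φ ψ => ?_⟩
  set η : 𝓢(Rn n, ℂ) := fourierSw n φ with hη
  set χ : 𝓢(Rn n, ℂ) := schwartzConj n ψ with hχ
  have h1 : ∀ x, psdo σ φ x * conj (ψ x) = ∫ ξ, fourierConst n *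
      (Complex.exp (Complex.I * (inner ℝ x ξ : ℝ)) * σ x ξ * η ξ * χ x) := by
    intro x
    rw [← psdoSw_apply hσ]
    change fourierConst n * (∫ ξ, _) * χ x = _
    rw [integral_const_mul, mul_assoc, ← integral_mul_const]
    rfl
  have h2 : ∀ ξ, η ξ * conj ((fourierConst n • ((schwartzConj n).comp
      ((hσ'.toCLM ()).comp (schwartzConj n)))) ψ ξ) = ∫ x, fourierConst n *
      (Complex.exp (Complex.I * (inner ℝ x ξ : ℝ)) * σ x ξ * η ξ * χ x) := by
    intro ξ
    change η ξ * conj (fourierConst n * conj (∫ x, _)) = _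
    rw [map_mul, conj_fourierConst, Complex.conj_conj, integral_const_mul, mul_left_comm,
      ← integral_const_mul]
    congr 2
    funext x
    rw [real_inner_comm]
    change η ξ * (Complex.exp (Complex.I * (inner ℝ x ξ : ℝ)) * σ x ξ * χ x) = _
    ring
  change _ = ∫ x, φ x * conj (fourierInvSw n ((fourierConst n • ((schwartzConj n).comp
      ((hσ'.toCLM ()).comp (schwartzConj n)))) ψ) x)
  rw [← integral_fourierSw_mul_conj]
  simp_rw [h1]
  refine Eq.trans ?_ (integral_congr_ae (Filter.Eventually.of_forall h2)).symm
  refine integral_integral_swap ?_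
  obtain ⟨C, N, M, hC, hb⟩ := hσ.exists_norm_le
  have hdom : Integrable (fun z : Rn n × Rn n => (C * ((1 + ‖z.1‖) ^ N * ‖χ z.1‖)) *
      ((1 + ‖z.2‖) ^ M * ‖η z.2‖)) (volume.prod volume) :=
    ((integrable_one_add_norm_pow_mul χ N).const_mul C).mul_prod
      (integrable_one_add_norm_pow_mul η M)
  refine Integrable.const_mul (hdom.mono' ?_ (Filter.Eventually.of_forall fun z => ?_)) _
  · have hc : Continuous (fun z : Rn n × Rn n => σ z.1 z.2) := (hσ.smooth ()).continuous
    have h3 : Continuous (fun z : Rn n × Rn n => (inner ℝ z.1 z.2 : ℝ)) :=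
      continuous_fst.inner continuous_snd
    have h4 : Continuous (fun z : Rn n × Rn n =>
        Complex.exp (Complex.I * (inner ℝ z.1 z.2 : ℝ))) := by fun_prop
    exact (((h4.mul hc).mul (η.continuous.comp continuous_snd)).mul
      (χ.continuous.comp continuous_fst)).aestronglyMeasurable
  · change ‖Complex.exp (Complex.I * (inner ℝ z.1 z.2 : ℝ)) * σ z.1 z.2 * η z.2 * χ z.1‖ ≤ _
    rw [norm_mul, norm_mul, norm_mul, norm_exp_I_mul_ofReal, one_mul]
    calc _ ≤ C * (1 + ‖z.1‖) ^ N * (1 + ‖z.2‖) ^ M * ‖η z.2‖ * ‖χ z.1‖ := by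
          gcongr
          exact hb () z.1 z.2
      _ = _ := by ring

theorem lpToDist_toLp_apply {n : ℕ} {p : ℝ≥0∞} [Fact (1 ≤ p)] (f ψ : 𝓢(Rn n, ℂ)) :
    lpToDist n p (f.toLp p) ψ = ∫ x, f x * ψ x := by
  refine (Lp.toTemperedDistribution_apply (f.toLp p volume) ψ).trans (integral_congr_ae ?_)
  filter_upwards [f.coeFn_toLp p volume] with x hx
  rw [hx, smul_eq_mul, mul_comm]

/-- On Schwartz functions the extension by duality agrees with the integral formula; uniqueness of
the formal adjoint identifies the chosen one. -/
theorem psdoDist_lpToDist {n : ℕ} {p : ℝ≥0∞} [Fact (1 ≤ p)] {σ : Rn n → Rn n → ℂ}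
    (hσ : IsAmplitude (fun (_ : Unit) (z : Rn n × Rn n) => σ z.1 z.2))
    (hσ' : IsAmplitude (fun (_ : Unit) (z : Rn n × Rn n) => σ z.2 z.1)) (φ : 𝓢(Rn n, ℂ)) :
    psdoDist σ (lpToDist n p (φ.toLp p)) = lpToDist n p ((psdoSw hσ φ).toLp p) := by
  obtain ⟨A, hA⟩ := exists_isFormalAdjoint hσ hσ'
  ext ψ
  rw [psdoDist_apply, hA.formalAdjoint_eq, lpToDist_toLp_apply, lpToDist_toLp_apply]
  simp_rw [schwartzConj_apply, psdoSw_apply]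
  rw [← hA]
  simp_rw [schwartzConj_apply, Complex.conj_conj]

/-- By Fourier inversion the constant part `c k` of the symbol acts as a scalar, and the remainder
is `ε k` times an equicontinuous family. -/
theorem tendsto_psdoSw {n : ℕ} {ι : Type*} {l : Filter ι} {a b : ι → Rn n → Rn n → ℂ}
    (ha : ∀ k, IsAmplitude (fun (_ : Unit) (z : Rn n × Rn n) => a k z.1 z.2))
    (hb : IsAmplitude (fun k (z : Rn n × Rn n) => b k z.1 z.2)) {c : ι → ℂ} {ε : ι → ℝ}
    (hab : ∀ k x ξ, a k x ξ = c k + ε k * b k x ξ) {c₀ : ℂ} (hc : Filter.Tendsto c l (nhds c₀))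
    (hε : Filter.Tendsto ε l (nhds 0)) {φ : ι → 𝓢(Rn n, ℂ)} {φ₀ : 𝓢(Rn n, ℂ)}
    (hφ : Filter.Tendsto φ l (nhds φ₀)) :
    Filter.Tendsto (fun k => psdoSw (ha k) (φ k)) l (nhds (c₀ • φ₀)) := by
  have key : ∀ k, psdoSw (ha k) (φ k) = c k • φ k +
      (ε k : ℂ) • (fourierConst n • hb.toCLM k (fourierSw n (φ k))) := by
    intro k
    ext x
    have h1 : φ k x = fourierConst n * ∫ ξ, Complex.exp (Complex.I * (inner ℝ x ξ : ℝ)) *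
        fourierSw n (φ k) ξ := by
      rw [← fourierInvSw_apply, fourierInvSw_fourierSw]
    change fourierConst n * (∫ ξ, _) = c k * φ k x + ε k * (fourierConst n * ∫ ξ, _)
    have h2 : Integrable (fun ξ : Rn n => Complex.exp (Complex.I * (inner ℝ x ξ : ℝ)) *
        fourierSw n (φ k) ξ) := by
      refine (fourierSw n (φ k)).integrable.bdd_mul (c := 1) ?_ ?_
      · exact (by fun_prop : Continuous fun y : Rn n =>
          Complex.exp (Complex.I * (inner ℝ x y : ℝ))).aestronglyMeasurable
      · exact Filter.Eventually.of_forall fun y => (norm_exp_I_mul_ofReal _).le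
    have h3 := hb.integrable k (fourierSw n (φ k)) x
    have h4 := integral_add (h2.const_mul (c k)) (h3.const_mul (ε k : ℂ))
    rw [integral_const_mul, integral_const_mul] at h4
    rw [h1, mul_left_comm (c k), mul_left_comm (ε k : ℂ), ← mul_add]
    refine congrArg (fourierConst n * ·) (Eq.trans ?_ h4)
    congr 1
    funext ξ
    change Complex.exp (Complex.I * (inner ℝ x ξ : ℝ)) * a k x ξ * fourierSw n (φ k) ξ = _
    rw [hab]
    ring
  simp_rw [key]
  have hε' : Filter.Tendsto (fun k => (ε k : ℂ)) l (nhds 0) := by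
    simpa [Function.comp_def] using (Complex.continuous_ofReal.tendsto 0).comp hε
  have h4 : Filter.Tendsto (fun k => (ε k : ℂ) • (fourierConst n •
      hb.toCLM k (fourierSw n (φ k)))) l (nhds 0) := by
    rw [tendsto_schwartz_iff]
    intro N
    obtain ⟨M, C, hC, h⟩ := hb.exists_swNorm_toCLM_le N
    have h5 : Filter.Tendsto (fun k => swNorm M (fourierSw n (φ k))) l
        (nhds (swNorm M (fourierSw n φ₀))) :=
      ((continuous_swNorm M).comp (fourierSw n).continuous).continuousAt.tendsto.comp hφ
    have h6 : Filter.Tendsto (fun k => |ε k| * (‖fourierConst n‖ *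
        (C * swNorm M (fourierSw n (φ k))))) l (nhds 0) := by
      have := (hε.abs).mul ((h5.const_mul C).const_mul ‖fourierConst n‖)
      simpa using this
    refine squeeze_zero (fun k => apply_nonneg _ _) (fun k => ?_) h6
    rw [sub_zero, map_smul_eq_mul, map_smul_eq_mul, Complex.norm_real, Real.norm_eq_abs]
    gcongr
    exact h k _
  simpa using (hc.smul hφ).add h4

end

/-! ### Powers of a weight function -/

noncomputable section

theorem iterDirDeriv_mul_bound_aux {n : ℕ} {f g : Rn n → ℝ} (hf : ContDiff ℝ ∞ f)
    (hg : ContDiff ℝ ∞ g) (v : Rn n) :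
    dirDeriv v (fun x => f x * g x) = fun x => dirDeriv v f x * g x + f x * dirDeriv v g x := by
  funext x
  simp only [dirDeriv]
  rw [fderiv_fun_mul (hf.differentiable_infty x) (hg.differentiable_infty x)]
  simp
  ring

/-- `f` is smooth and satisfies `|∂^α f| ≤ C_α Λ^{t - ρ|α|}` for `|α| ≤ m`. -/
structure HasWeightOrder {n : ℕ} (Λ : Rn n → ℝ) (ρ t : ℝ) (m : ℕ) (f : Rn n → ℝ) : Prop where
  smooth : ContDiff ℝ ∞ f
  bound : ∀ A : List (Fin n), A.length ≤ m → ∃ C : ℝ, 0 ≤ C ∧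
    ∀ ξ, |iterDirDeriv (A.map stdVec) f ξ| ≤ C * Λ ξ ^ (t - ρ * A.length)

namespace HasWeightOrder

variable {n : ℕ} {Λ : Rn n → ℝ} {ρ s t : ℝ} {m : ℕ} {f g : Rn n → ℝ}

theorem exists_abs_le (hf : HasWeightOrder Λ ρ t m f) :
    ∃ C : ℝ, 0 ≤ C ∧ ∀ ξ, |f ξ| ≤ C * Λ ξ ^ t := by
  obtain ⟨C, hC, h⟩ := hf.bound [] (Nat.zero_le m)
  exact ⟨C, hC, fun ξ => by simpa using h ξ⟩

theorem mono (hf : HasWeightOrder Λ ρ t (m + 1) f) : HasWeightOrder Λ ρ t m f :=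
  ⟨hf.smooth, fun A hA => hf.bound A (by omega)⟩

theorem dirDeriv (hf : HasWeightOrder Λ ρ t (m + 1) f) (i : Fin n) :
    HasWeightOrder Λ ρ (t - ρ) m (dirDeriv (stdVec i) f) := by
  refine ⟨hf.smooth.dirDeriv _, fun A hA => ?_⟩
  obtain ⟨C, hC, h⟩ := hf.bound (A ++ [i]) (by simpa using hA)
  refine ⟨C, hC, fun ξ => ?_⟩
  have h1 := h ξ
  rw [List.map_append, iterDirDeriv_append] at h1
  have h2 : t - ρ - ρ * A.length = t - ρ * (A ++ [i]).length := by
    rw [List.length_append, List.length_singleton]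
    push_cast
    ring
  rw [h2]
  exact h1

theorem of_dirDeriv (hs : ContDiff ℝ ∞ f) (h0 : ∃ C : ℝ, 0 ≤ C ∧ ∀ ξ, |f ξ| ≤ C * Λ ξ ^ t)
    (h : ∀ i, HasWeightOrder Λ ρ (t - ρ) m (_root_.dirDeriv (stdVec i) f)) :
    HasWeightOrder Λ ρ t (m + 1) f := by
  refine ⟨hs, fun A hA => ?_⟩
  rcases List.eq_nil_or_concat A with rfl | ⟨B, i, rfl⟩
  · simpa using h0
  · obtain ⟨C, hC, h1⟩ := (h i).bound B (by simpa using hA)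
    refine ⟨C, hC, fun ξ => ?_⟩
    have h2 := h1 ξ
    rw [List.concat_eq_append, List.map_append, iterDirDeriv_append]
    have h3 : t - ρ * (B ++ [i]).length = t - ρ - ρ * B.length := by
      rw [List.length_append, List.length_singleton]
      push_cast
      ring
    rw [h3]
    exact h2

theorem add (hf : HasWeightOrder Λ ρ t m f) (hg : HasWeightOrder Λ ρ t m g) :
    HasWeightOrder Λ ρ t m (fun ξ => f ξ + g ξ) := by
  have h0 : ∃ C : ℝ, 0 ≤ C ∧ ∀ ξ, |f ξ + g ξ| ≤ C * Λ ξ ^ t := by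
    obtain ⟨C, hC, h⟩ := hf.exists_abs_le
    obtain ⟨C', hC', h'⟩ := hg.exists_abs_le
    refine ⟨C + C', by positivity, fun ξ => (abs_add_le _ _).trans ?_⟩
    rw [add_mul]
    exact add_le_add (h ξ) (h' ξ)
  induction m generalizing t f g with
  | zero =>
    refine ⟨hf.smooth.add hg.smooth, fun A hA => ?_⟩
    obtain rfl : A = [] := List.length_eq_zero_iff.1 (by omega)
    simpa using h0
  | succ m ih =>
    refine of_dirDeriv (hf.smooth.add hg.smooth) h0 fun i => ?_
    rw [dirDeriv_add hf.smooth hg.smooth]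
    exact ih (hf.dirDeriv i) (hg.dirDeriv i) (by
      obtain ⟨C, hC, h⟩ := (hf.dirDeriv i).exists_abs_le
      obtain ⟨C', hC', h'⟩ := (hg.dirDeriv i).exists_abs_le
      refine ⟨C + C', by positivity, fun ξ => (abs_add_le _ _).trans ?_⟩
      rw [add_mul]
      exact add_le_add (h ξ) (h' ξ))

theorem mul (hΛ : ∀ ξ, 0 < Λ ξ) (hf : HasWeightOrder Λ ρ t m f) (hg : HasWeightOrder Λ ρ s m g) :
    HasWeightOrder Λ ρ (t + s) m (fun ξ => f ξ * g ξ) := by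
  have h0 : ∀ {t s : ℝ} {m : ℕ} {f g : Rn n → ℝ}, HasWeightOrder Λ ρ t m f →
      HasWeightOrder Λ ρ s m g → ∃ C : ℝ, 0 ≤ C ∧ ∀ ξ, |f ξ * g ξ| ≤ C * Λ ξ ^ (t + s) := by
    intro t s m f g hf hg
    obtain ⟨C, hC, h⟩ := hf.exists_abs_le
    obtain ⟨C', hC', h'⟩ := hg.exists_abs_le
    refine ⟨C * C', by positivity, fun ξ => ?_⟩
    have hpos := Real.rpow_nonneg (hΛ ξ).le t
    rw [abs_mul, Real.rpow_add (hΛ ξ), mul_mul_mul_comm]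
    exact mul_le_mul (h ξ) (h' ξ) (abs_nonneg _) (mul_nonneg hC hpos)
  induction m generalizing t s f g with
  | zero =>
    refine ⟨hf.smooth.mul hg.smooth, fun A hA => ?_⟩
    obtain rfl : A = [] := List.length_eq_zero_iff.1 (by omega)
    simpa using h0 hf hg
  | succ m ih =>
    refine of_dirDeriv (hf.smooth.mul hg.smooth) (h0 hf hg) fun i => ?_
    rw [iterDirDeriv_mul_bound_aux hf.smooth hg.smooth]
    have h1 := ih (hf.dirDeriv i) hg.mono
    have h2 := ih hf.mono (hg.dirDeriv i)
    rw [show t - ρ + s = t + s - ρ by ring] at h1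
    rw [show t + (s - ρ) = t + s - ρ by ring] at h2
    exact h1.add h2

theorem const_mul (c : ℝ) (hf : HasWeightOrder Λ ρ t m f) :
    HasWeightOrder Λ ρ t m (fun ξ => c * f ξ) := by
  refine ⟨contDiff_const.mul hf.smooth, fun A hA => ?_⟩
  obtain ⟨C, hC, h⟩ := hf.bound A hA
  refine ⟨|c| * C, by positivity, fun ξ => ?_⟩
  have := iterDirDeriv_const_smul hf.smooth c (A.map stdVec)
  simp only [smul_eq_mul] at this
  rw [this, abs_mul, mul_assoc]
  exact mul_le_mul_of_nonneg_left (h ξ) (abs_nonneg c)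

/-- Induction on `m` for all exponents at once: `∂_i Λ^t = t Λ^{t-1} ∂_i Λ`, and the order of the
product is `(t - 1) + (1 - ρ) = t - ρ`. -/
theorem rpow (hΛ : ∀ ξ, 0 < Λ ξ) (h : ∀ m, HasWeightOrder Λ ρ 1 m Λ) (t : ℝ) (m : ℕ) :
    HasWeightOrder Λ ρ t m (fun ξ => Λ ξ ^ t) := by
  have hs : ∀ t : ℝ, ContDiff ℝ ∞ (fun ξ => Λ ξ ^ t) := fun t =>
    (h 0).smooth.rpow_const_of_ne fun ξ => (hΛ ξ).ne'
  have h0 : ∀ t : ℝ, ∃ C : ℝ, 0 ≤ C ∧ ∀ ξ, |Λ ξ ^ t| ≤ C * Λ ξ ^ t := fun t =>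
    ⟨1, zero_le_one, fun ξ => by rw [one_mul, abs_of_nonneg (Real.rpow_nonneg (hΛ ξ).le t)]⟩
  induction m generalizing t with
  | zero =>
    refine ⟨hs t, fun A hA => ?_⟩
    obtain rfl : A = [] := List.length_eq_zero_iff.1 (by omega)
    simpa using h0 t
  | succ m ih =>
    refine of_dirDeriv (hs t) (h0 t) fun i => ?_
    have h1 : _root_.dirDeriv (stdVec i) (fun ξ => Λ ξ ^ t) =
        fun ξ => t * (Λ ξ ^ (t - 1) * _root_.dirDeriv (stdVec i) Λ ξ) := by
      funext ξ
      have h2 := ((h 0).smooth.differentiable_infty ξ).hasFDerivAt.rpow_const (p := t)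
        (Or.inl (hΛ ξ).ne')
      simp only [_root_.dirDeriv]
      rw [h2.fderiv]
      simp [mul_assoc]
    rw [h1]
    have h2 := (ih (t - 1)).mul hΛ ((h (m + 1)).dirDeriv i)
    rw [show t - 1 + (1 - ρ) = t - ρ by ring] at h2
    exact h2.const_mul t

end HasWeightOrder

/-! ### Growth and slow variation of weight functions -/

namespace IsWeightFunction

variable {n : ℕ} {Λ : Rn n → ℝ} {μ ρ : ℝ}

theorem exists_lower_bound (hΛ : IsWeightFunction Λ μ) : ∃ c : ℝ, 0 < c ∧ ∀ ξ, c ≤ Λ ξ := by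
  obtain ⟨μ₀, μ₁, C₀, C₁, h0, -, -, hC₀, -, h⟩ := hΛ.growth
  refine ⟨C₀, hC₀, fun ξ => le_trans ?_ (h ξ).1⟩
  exact le_mul_of_one_le_right hC₀.le
    (Real.one_le_rpow (by linarith [norm_nonneg ξ]) h0.le)

/-- `Λ` is bounded below by a positive constant that need not be `1`; exponents may still be raised,
at the cost of a constant. -/
theorem rpow_le_mul_rpow {c : ℝ} (hc : 0 < c) {x : ℝ} (hx : c ≤ x) {a b : ℝ} (hab : a ≤ b) :
    x ^ a ≤ c ^ (a - b) * x ^ b := by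
  have hx0 : 0 < x := hc.trans_le hx
  calc x ^ a = x ^ (a - b) * x ^ b := by rw [← Real.rpow_add hx0, sub_add_cancel]
    _ ≤ c ^ (a - b) * x ^ b := mul_le_mul_of_nonneg_right
        (Real.rpow_le_rpow_of_nonpos hc hx (by linarith)) (Real.rpow_nonneg hx0.le b)

/-- Take `γ = 0` in the derivative bounds; as `ρ ≤ 1 / μ`, the exponent `1 - |α| / μ` is at most `1
- ρ|α|`. -/
theorem hasWeightOrder_self (hΛ : IsWeightFunction Λ μ) (hρμ : ρ ≤ 1 / μ) (m : ℕ) :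
    HasWeightOrder Λ ρ 1 m Λ := by
  obtain ⟨c, hc, hcΛ⟩ := hΛ.exists_lower_bound
  refine ⟨hΛ.smooth, fun A _ => ?_⟩
  obtain ⟨C, hC, h⟩ := hΛ.deriv_bound (fun i => A.count i) 0 (fun _ => by simp)
  refine ⟨C * c ^ ((1 - (A.length : ℝ) / μ) - (1 - ρ * A.length)), by positivity, fun ξ => ?_⟩
  have h1 := h ξ
  rw [miLength_count, add_zero, show miPow ξ (0 : Fin n → ℕ) = 1 by simp [miPow], one_mul,
    ← iterDirDeriv_map_stdVec hΛ.smooth] at h1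
  refine h1.trans ?_
  rw [mul_assoc]
  refine mul_le_mul_of_nonneg_left (rpow_le_mul_rpow hc (hcΛ ξ) ?_) hC.le
  have : ρ * A.length ≤ 1 / μ * A.length := by gcongr
  have h2 : 1 / μ * (A.length : ℝ) = A.length / μ := by ring
  linarith

theorem hasWeightOrder_rpow (hΛ : IsWeightFunction Λ μ) (hρμ : ρ ≤ 1 / μ) (t : ℝ) (m : ℕ) :
    HasWeightOrder Λ ρ t m (fun ξ => Λ ξ ^ t) :=
  HasWeightOrder.rpow hΛ.pos (hΛ.hasWeightOrder_self hρμ) t m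

theorem exists_rpow_le (hΛ : IsWeightFunction Λ μ) (t : ℝ) :
    ∃ (C : ℝ) (N : ℕ), 0 ≤ C ∧ ∀ ξ, Λ ξ ^ t ≤ C * (1 + ‖ξ‖) ^ N := by
  obtain ⟨c, hc, hcΛ⟩ := hΛ.exists_lower_bound
  obtain ⟨μ₀, μ₁, C₀, C₁, h0, h01, -, hC₀, hC₀₁, h⟩ := hΛ.growth
  have hC₁ : 0 < C₁ := hC₀.trans_le hC₀₁
  rcases le_or_gt 0 t with ht | ht
  · refine ⟨C₁ ^ t, ⌈μ₁ * t⌉₊, by positivity, fun ξ => ?_⟩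
    have h1 : (1 : ℝ) ≤ 1 + ‖ξ‖ := by linarith [norm_nonneg ξ]
    calc Λ ξ ^ t ≤ (C₁ * (1 + ‖ξ‖) ^ μ₁) ^ t :=
          Real.rpow_le_rpow (hΛ.pos ξ).le (h ξ).2 ht
      _ = C₁ ^ t * (1 + ‖ξ‖) ^ (μ₁ * t) := by
          rw [Real.mul_rpow hC₁.le (by positivity), ← Real.rpow_mul (by positivity)]
      _ ≤ C₁ ^ t * (1 + ‖ξ‖) ^ ⌈μ₁ * t⌉₊ := by
          gcongr
          rw [← Real.rpow_natCast]
          exact Real.rpow_le_rpow_of_exponent_le h1 (Nat.le_ceil _)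
  · refine ⟨c ^ t, 0, by positivity, fun ξ => ?_⟩
    simpa using Real.rpow_le_rpow_of_nonpos hc (hcΛ ξ) ht.le

/-- The first derivatives of `Λ^ρ` have order `ρ - ρ = 0`, so they are bounded. -/
theorem exists_lipschitz (hΛ : IsWeightFunction Λ μ) (hρμ : ρ ≤ 1 / μ) :
    ∃ K : ℝ, 0 ≤ K ∧ ∀ x y, |Λ x ^ ρ - Λ y ^ ρ| ≤ K * ‖x - y‖ := by
  have h1 := hΛ.hasWeightOrder_rpow hρμ ρ 1
  have h2 := fun i => (h1.dirDeriv i).exists_abs_le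
  choose C hC h using h2
  refine ⟨∑ i, C i, Finset.sum_nonneg fun i _ => hC i, fun x y => ?_⟩
  have h3 := Convex.norm_image_sub_le_of_norm_fderiv_le (𝕜 := ℝ) (s := Set.univ)
    (f := fun ξ => Λ ξ ^ ρ) (C := ∑ i, C i) (x := y) (y := x)
    (fun z _ => h1.smooth.differentiable_infty z) (fun z _ => ?_) convex_univ trivial trivial
  · simpa [Real.norm_eq_abs] using h3
  · refine (opNorm_le_sum_stdVec _).trans (Finset.sum_le_sum fun i _ => ?_)
    simpa [dirDeriv] using h i z

/-- With `a = Λ(x)^{ρ/2}`, the Lipschitz bound for `Λ^ρ` says that a step `h v` with `h ≤ c₀ a`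
changes `a²` by at most `e a ‖v‖`. This is linear in `a`, hence negligible against `a²` up to powers
of `1 + ‖v‖`. -/
theorem exists_slowly_varying (hΛ : IsWeightFunction Λ μ) (hρ : 0 < ρ) (hρμ : ρ ≤ 1 / μ) (c₀ : ℝ) :
    ∃ C : ℝ, 0 < C ∧ ∀ (x v : Rn n) (h : ℝ), 0 ≤ h → h ≤ c₀ * Λ x ^ (ρ / 2) →
      Λ (x + h • v) ^ ρ ≤ C * Λ x ^ ρ * (1 + ‖v‖) ^ 2 ∧
      Λ x ^ ρ ≤ C * Λ (x + h • v) ^ ρ * (1 + ‖v‖) ^ 2 := by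
  obtain ⟨c, hc, hcΛ⟩ := hΛ.exists_lower_bound
  obtain ⟨K, hK, hlip⟩ := hΛ.exists_lipschitz hρμ
  set d := c ^ (ρ / 2) with hd
  have hdpos : 0 < d := Real.rpow_pos_of_pos hc _
  set e := K * |c₀| with he
  have hepos : 0 ≤ e := by positivity
  refine ⟨2 + e / d + e ^ 2 / d ^ 2, by positivity, fun x v h hh hhx => ?_⟩
  set a := Λ x ^ (ρ / 2) with ha
  have ha2 : Λ x ^ ρ = a ^ 2 := by
    rw [ha, ← Real.rpow_natCast, ← Real.rpow_mul (hΛ.pos x).le]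
    congr 1
    push_cast
    ring
  have hda : d ≤ a := Real.rpow_le_rpow hc.le (hcΛ x) (by positivity)
  have hdB : d ^ 2 ≤ Λ (x + h • v) ^ ρ := by
    have h1 : d ^ 2 = c ^ ρ := by
      rw [hd, ← Real.rpow_natCast, ← Real.rpow_mul hc.le]
      congr 1
      push_cast
      ring
    rw [h1]
    exact Real.rpow_le_rpow hc.le (hcΛ _) hρ.le
  rw [ha2]
  set B := Λ (x + h • v) ^ ρ
  set w := ‖v‖
  have hw : 0 ≤ w := norm_nonneg v
  have hap : 0 < a := hdpos.trans_le hda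
  have hdiff : |B - a ^ 2| ≤ e * a * w := by
    have h1 := hlip (x + h • v) x
    rw [ha2, add_sub_cancel_left, norm_smul, Real.norm_of_nonneg hh] at h1
    refine h1.trans ?_
    have h2 : h ≤ |c₀| * a := hhx.trans (mul_le_mul_of_nonneg_right (le_abs_self _) hap.le)
    calc K * (h * w) ≤ K * (|c₀| * a * w) := by gcongr
      _ = e * a * w := by rw [he]; ring
  have hd1 := (abs_le.1 hdiff).1
  have hd2 := (abs_le.1 hdiff).2
  have hBp : 0 < B := (by positivity : 0 < d ^ 2).trans_le hdB
  have hed : 0 ≤ e / d := by positivity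
  have hed2 : 0 ≤ e ^ 2 / d ^ 2 := by positivity
  constructor
  -- Upper bound for the shifted weight: `d ≤ a` turns the linear error into a multiple of `a²`.
  · have h1 : e * a * w ≤ e / d * a ^ 2 * w := by
      have h2 : e = e / d * d := by field_simp
      calc e * a * w = e / d * (d * a) * w := by rw [h2]; field_simp
        _ ≤ e / d * (a * a) * w := by gcongr
        _ = _ := by ring
    calc B ≤ a ^ 2 + e / d * a ^ 2 * w := by linarith
      _ ≤ (2 + e / d + e ^ 2 / d ^ 2) * a ^ 2 * (1 + w) ^ 2 := by
        have h3 : 1 + e / d * w ≤ (2 + e / d + e ^ 2 / d ^ 2) * (1 + w) ^ 2 := by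
          nlinarith [mul_nonneg hed hw, mul_nonneg hed2 hw, mul_nonneg hed (sq_nonneg w),
            mul_nonneg hed2 (sq_nonneg w)]
        nlinarith [mul_le_mul_of_nonneg_left h3 (sq_nonneg a)]
  -- Lower bound: half of `a²` absorbs the error, and the leftover `e² w²` is controlled by the
  -- shifted weight, which is at least `d²`.
  · have h1 : e * a * w ≤ a ^ 2 / 2 + e ^ 2 * w ^ 2 / 2 := by nlinarith [sq_nonneg (a - e * w)]
    have h2 : a ^ 2 ≤ 2 * B + e ^ 2 * w ^ 2 := by linarith
    have h3 : e ^ 2 * w ^ 2 ≤ e ^ 2 / d ^ 2 * B * w ^ 2 := by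
      calc e ^ 2 * w ^ 2 = e ^ 2 / d ^ 2 * d ^ 2 * w ^ 2 := by field_simp
        _ ≤ _ := by gcongr
    have h4 : 2 + e ^ 2 / d ^ 2 * w ^ 2 ≤ (2 + e / d + e ^ 2 / d ^ 2) * (1 + w) ^ 2 := by
      nlinarith [mul_nonneg hed hw, mul_nonneg hed2 hw, mul_nonneg hed (sq_nonneg w),
            mul_nonneg hed2 (sq_nonneg w)]
    nlinarith [mul_le_mul_of_nonneg_left h4 hBp.le]

theorem rpow_le_of_rpow_le {x y C w s : ℝ} (hx : 0 < x) (hy : 0 < y) (hC : 0 < C) (hw : 1 ≤ w)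
    (hρ : 0 < ρ) (hs : 0 ≤ s) (h : x ^ ρ ≤ C * y ^ ρ * w ^ 2) :
    x ^ s ≤ C ^ (s / ρ) * y ^ s * w ^ ⌈2 * (s / ρ)⌉₊ := by
  have h1 := Real.rpow_le_rpow (by positivity) h (by positivity : 0 ≤ s / ρ)
  have hw0 : 0 < w := by linarith
  have hρs : ρ * (s / ρ) = s := by field_simp
  rw [Real.mul_rpow (by positivity) (by positivity), Real.mul_rpow hC.le (by positivity),
    ← Real.rpow_mul hx.le, ← Real.rpow_mul hy.le, hρs, ← Real.rpow_natCast w 2,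
    ← Real.rpow_mul hw0.le] at h1
  refine h1.trans ?_
  gcongr
  rw [← Real.rpow_natCast]
  exact Real.rpow_le_rpow_of_exponent_le hw (by exact_mod_cast Nat.le_ceil _)

/-- Slow variation raised to the power `|t| / ρ`. For negative `t` the roles of the two points are
exchanged, which is why both inequalities were needed. -/
theorem exists_rpow_shift_le (hΛ : IsWeightFunction Λ μ) (hρ : 0 < ρ) (hρμ : ρ ≤ 1 / μ)
    (c₀ t : ℝ) :
    ∃ (C : ℝ) (N : ℕ), 0 < C ∧ ∀ (x v : Rn n) (h : ℝ), 0 ≤ h → h ≤ c₀ * Λ x ^ (ρ / 2) →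
      Λ (x + h • v) ^ t ≤ C * Λ x ^ t * (1 + ‖v‖) ^ N := by
  obtain ⟨C, hC, hsv⟩ := hΛ.exists_slowly_varying hρ hρμ c₀
  rcases le_or_gt 0 t with ht | ht
  · refine ⟨C ^ (t / ρ), ⌈2 * (t / ρ)⌉₊, by positivity, fun x v h hh hhx => ?_⟩
    exact rpow_le_of_rpow_le (hΛ.pos _) (hΛ.pos _) hC (by linarith [norm_nonneg v]) hρ ht
      (hsv x v h hh hhx).1
  · refine ⟨C ^ (-t / ρ), ⌈2 * (-t / ρ)⌉₊, by positivity, fun x v h hh hhx => ?_⟩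
    have h1 := rpow_le_of_rpow_le (hΛ.pos _) (hΛ.pos _) hC (by linarith [norm_nonneg v]) hρ
      (by linarith : 0 ≤ -t) (hsv x v h hh hhx).2
    rw [Real.rpow_neg (hΛ.pos _).le, Real.rpow_neg (hΛ.pos _).le] at h1
    have hA : 0 < Λ x ^ t := Real.rpow_pos_of_pos (hΛ.pos _) _
    have hB : 0 < Λ (x + h • v) ^ t := Real.rpow_pos_of_pos (hΛ.pos _) _
    calc Λ (x + h • v) ^ t = Λ x ^ t * Λ (x + h • v) ^ t * (Λ x ^ t)⁻¹ := by field_simp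
      _ ≤ Λ x ^ t * Λ (x + h • v) ^ t * (C ^ (-t / ρ) * (Λ (x + h • v) ^ t)⁻¹ *
          (1 + ‖v‖) ^ ⌈2 * (-t / ρ)⌉₊) := by gcongr
      _ = _ := by field_simp

end IsWeightFunction

/-! ### Symbol classes in terms of lists of coordinate directions -/

/-- `σ` is smooth and `|∂_x^α ∂_ξ^β σ| ≤ C_{α,β} Λ(x)^{m₂ - ρ|α|} Λ(ξ)^{m₁ - ρ|β|}`, with the
derivatives taken in any order. -/
structure HasSGBounds {n : ℕ} (Λ : Rn n → ℝ) (ρ m₁ m₂ : ℝ) (σ : Rn n → Rn n → ℂ) : Prop where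
  smooth : ContDiff ℝ ∞ (fun z : Rn n × Rn n => σ z.1 z.2)
  bound : ∀ L : List (Fin n ⊕ Fin n), ∃ C : ℝ, 0 ≤ C ∧ ∀ x ξ,
    ‖iterDirDeriv (L.map phaseVec) (fun z : Rn n × Rn n => σ z.1 z.2) (x, ξ)‖ ≤
      C * Λ x ^ (m₂ - ρ * leftCount L) * Λ ξ ^ (m₁ - ρ * rightCount L)

theorem IsSGSymbol.hasSGBounds {n : ℕ} {Λ : Rn n → ℝ} {ρ m₁ m₂ : ℝ} {σ : Rn n → Rn n → ℂ}
    (hσ : IsSGSymbol Λ ρ m₁ m₂ σ) : HasSGBounds Λ ρ m₁ m₂ σ := by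
  refine ⟨hσ.smooth, fun L => ?_⟩
  obtain ⟨α, β, hα, hβ, h⟩ := exists_symbolDeriv_eq_iterDirDeriv hσ.smooth L
  obtain ⟨C, hC, hb⟩ := hσ.bound α β
  refine ⟨C, hC.le, fun x ξ => ?_⟩
  rw [h, ← hα, ← hβ]
  exact hb x ξ

theorem IsSGMSymbol.hasSGBounds {n : ℕ} {Λ : Rn n → ℝ} {ρ m₁ m₂ : ℝ} {σ : Rn n → Rn n → ℂ}
    (hσ : IsSGMSymbol Λ ρ m₁ m₂ σ) : HasSGBounds Λ ρ m₁ m₂ σ := by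
  have h := hσ.2 0 (fun _ => by simp)
  have h1 : ∀ f : Rn n → ℂ, miDeriv 0 f = f := by
    intro f
    rw [miDeriv_eq_iterDirDeriv]
    have : miList (0 : Fin n → ℕ) = [] := by simp [miList]
    rw [this]
    rfl
  have h2 : (fun x ξ => (miPow ξ (0 : Fin n → ℕ) : ℂ) * miDeriv 0 (σ x) ξ) = σ := by
    funext x ξ
    simp [h1, miPow]
  rw [h2] at h
  exact h.hasSGBounds

theorem exists_iterDirDeriv_tensor {n : ℕ} {f g : Rn n → ℝ} (hf : ContDiff ℝ ∞ f)
    (hg : ContDiff ℝ ∞ g) (L : List (Fin n ⊕ Fin n)) :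
    ∃ A B : List (Fin n), A.length = leftCount L ∧ B.length = rightCount L ∧
      iterDirDeriv (L.map phaseVec) (fun z : Rn n × Rn n => ((f z.1 * g z.2 : ℝ) : ℂ)) =
        fun z => ((iterDirDeriv (A.map stdVec) f z.1 * iterDirDeriv (B.map stdVec) g z.2 : ℝ) : ℂ)
      := by
  induction L with
  | nil => exact ⟨[], [], rfl, rfl, rfl⟩
  | cons d L ih =>
    obtain ⟨A, B, hA, hB, h⟩ := ih
    have hd : ∀ z : Rn n × Rn n, ∀ v, dirDeriv v (fun z : Rn n × Rn n =>
        ((iterDirDeriv (A.map stdVec) f z.1 * iterDirDeriv (B.map stdVec) g z.2 : ℝ) : ℂ)) z =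
        ((fderiv ℝ (iterDirDeriv (A.map stdVec) f) z.1 v.1 * iterDirDeriv (B.map stdVec) g z.2 +
          iterDirDeriv (A.map stdVec) f z.1 *
            fderiv ℝ (iterDirDeriv (B.map stdVec) g) z.2 v.2 : ℝ) : ℂ) := by
      intro z v
      have h1 : HasFDerivAt (fun z : Rn n × Rn n => iterDirDeriv (A.map stdVec) f z.1) _ z :=
        (((hf.iterDirDeriv _).differentiable_infty z.1).hasFDerivAt).comp z hasFDerivAt_fst
      have h2 : HasFDerivAt (fun z : Rn n × Rn n => iterDirDeriv (B.map stdVec) g z.2) _ z :=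
        (((hg.iterDirDeriv _).differentiable_infty z.2).hasFDerivAt).comp z hasFDerivAt_snd
      have h3 := (Complex.ofRealCLM.hasFDerivAt.comp z (h1.mul h2)).fderiv
      refine (congrArg (fun T => T v) h3).trans ?_
      simp
      ring
    cases d with
    | inl i =>
      refine ⟨i :: A, B, by simp [leftCount, hA, List.countP_cons],
        by simp [rightCount, hB], ?_⟩
      rw [List.map_cons, iterDirDeriv_cons, h]
      funext z
      rw [hd]
      simp [phaseVec, dirDeriv]
    | inr i =>
      refine ⟨A, i :: B, by simp [leftCount, hA],
        by simp [rightCount, hB, List.countP_cons], ?_⟩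
      rw [List.map_cons, iterDirDeriv_cons, h]
      funext z
      rw [hd]
      simp [phaseVec, dirDeriv]

theorem IsWeightFunction.hasSGBounds_sgBesselSymbol {n : ℕ} {Λ : Rn n → ℝ} {μ ρ : ℝ}
    (hΛ : IsWeightFunction Λ μ) (hρμ : ρ ≤ 1 / μ) (m₁ m₂ : ℝ) :
    HasSGBounds Λ ρ (-m₁) (-m₂) (sgBesselSymbol Λ m₁ m₂) := by
  have hw := hΛ.hasWeightOrder_rpow hρμ
  refine ⟨Complex.ofRealCLM.contDiff.comp (((hw (-m₂) 0).smooth.comp contDiff_fst).mul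
    ((hw (-m₁) 0).smooth.comp contDiff_snd)), fun L => ?_⟩
  obtain ⟨A, B, hA, hB, h⟩ := exists_iterDirDeriv_tensor (hw (-m₂) 0).smooth
    (hw (-m₁) 0).smooth L
  obtain ⟨C, hC, h1⟩ := (hw (-m₂) A.length).bound A le_rfl
  obtain ⟨C', hC', h2⟩ := (hw (-m₁) B.length).bound B le_rfl
  refine ⟨C * C', by positivity, fun x ξ => ?_⟩
  have h3 := congrFun h (x, ξ)
  unfold sgBesselSymbol
  rw [h3, ← hA, ← hB, Complex.norm_real, Real.norm_eq_abs, abs_mul, mul_assoc, mul_assoc,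
    mul_left_comm C', ← mul_assoc]
  exact mul_le_mul (h1 x) (h2 ξ) (abs_nonneg _)
    (mul_nonneg hC (Real.rpow_nonneg (hΛ.pos x).le _))

/-- Differentiation only lowers the exponents of `Λ`, and `Λ` is bounded below, so the growth of the
undifferentiated symbol serves for all derivatives. This gives the amplitude property in either
order of the variables. -/
theorem HasSGBounds.exists_uniform_bound {n : ℕ} {Λ : Rn n → ℝ} {μ ρ m₁ m₂ : ℝ}
    {σ : Rn n → Rn n → ℂ} (hσ : HasSGBounds Λ ρ m₁ m₂ σ) (hΛ : IsWeightFunction Λ μ)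
    (hρ : 0 < ρ) :
    ∃ N M : ℕ, ∀ L : List (Fin n ⊕ Fin n), ∃ C : ℝ, ∀ x ξ,
      ‖iterDirDeriv (L.map phaseVec) (fun z : Rn n × Rn n => σ z.1 z.2) (x, ξ)‖ ≤
        C * (1 + ‖x‖) ^ N * (1 + ‖ξ‖) ^ M := by
  obtain ⟨c, hc, hcΛ⟩ := hΛ.exists_lower_bound
  obtain ⟨C₂, N, hC₂, h₂⟩ := hΛ.exists_rpow_le m₂
  obtain ⟨C₁, M, hC₁, h₁⟩ := hΛ.exists_rpow_le m₁
  refine ⟨N, M, fun L => ?_⟩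
  obtain ⟨C, hC, h⟩ := hσ.bound L
  refine ⟨C * (c ^ (m₂ - ρ * leftCount L - m₂) * C₂) * (c ^ (m₁ - ρ * rightCount L - m₁) * C₁),
    fun x ξ => (h x ξ).trans ?_⟩
  have hx : Λ x ^ (m₂ - ρ * leftCount L) ≤
      c ^ (m₂ - ρ * leftCount L - m₂) * (C₂ * (1 + ‖x‖) ^ N) :=
    (IsWeightFunction.rpow_le_mul_rpow hc (hcΛ x)
      (by linarith [mul_nonneg hρ.le (Nat.cast_nonneg (α := ℝ) (leftCount L))])).trans
      (mul_le_mul_of_nonneg_left (h₂ x) (by positivity))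
  have hξ : Λ ξ ^ (m₁ - ρ * rightCount L) ≤
      c ^ (m₁ - ρ * rightCount L - m₁) * (C₁ * (1 + ‖ξ‖) ^ M) :=
    (IsWeightFunction.rpow_le_mul_rpow hc (hcΛ ξ)
      (by linarith [mul_nonneg hρ.le (Nat.cast_nonneg (α := ℝ) (rightCount L))])).trans
      (mul_le_mul_of_nonneg_left (h₁ ξ) (by positivity))
  have hx0 := Real.rpow_nonneg (hΛ.pos x).le (m₂ - ρ * leftCount L)
  have hξ0 := Real.rpow_nonneg (hΛ.pos ξ).le (m₁ - ρ * rightCount L)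
  calc _ ≤ C * (c ^ (m₂ - ρ * leftCount L - m₂) * (C₂ * (1 + ‖x‖) ^ N)) *
        (c ^ (m₁ - ρ * rightCount L - m₁) * (C₁ * (1 + ‖ξ‖) ^ M)) := by gcongr
    _ = _ := by ring

theorem HasSGBounds.isAmplitude {n : ℕ} {Λ : Rn n → ℝ} {μ ρ m₁ m₂ : ℝ}
    {σ : Rn n → Rn n → ℂ} (hσ : HasSGBounds Λ ρ m₁ m₂ σ) (hΛ : IsWeightFunction Λ μ)
    (hρ : 0 < ρ) : IsAmplitude (fun (_ : Unit) (z : Rn n × Rn n) => σ z.1 z.2) := by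
  obtain ⟨N, M, h⟩ := hσ.exists_uniform_bound hΛ hρ
  refine ⟨fun _ => hσ.smooth, fun A => ⟨N, fun B => ?_⟩⟩
  obtain ⟨C, hC⟩ := h (B.map Sum.inr ++ A.map Sum.inl)
  exact ⟨C, M, fun _ => hC⟩

theorem HasSGBounds.isAmplitude_swap {n : ℕ} {Λ : Rn n → ℝ} {μ ρ m₁ m₂ : ℝ}
    {σ : Rn n → Rn n → ℂ} (hσ : HasSGBounds Λ ρ m₁ m₂ σ) (hΛ : IsWeightFunction Λ μ)
    (hρ : 0 < ρ) : IsAmplitude (fun (_ : Unit) (z : Rn n × Rn n) => σ z.2 z.1) := by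
  obtain ⟨N, M, h⟩ := hσ.exists_uniform_bound hΛ hρ
  let S : Rn n × Rn n →L[ℝ] Rn n × Rn n :=
    (ContinuousLinearMap.snd ℝ (Rn n) (Rn n)).prod (ContinuousLinearMap.fst ℝ (Rn n) (Rn n))
  refine ⟨fun _ => hσ.smooth.comp (contDiff_snd.prodMk contDiff_fst), fun A => ⟨M, fun B => ?_⟩⟩
  obtain ⟨C, hC⟩ := h ((B.map Sum.inr ++ A.map Sum.inl).map Sum.swap)
  refine ⟨C, N, fun _ x y => ?_⟩
  have h1 := congrFun (iterDirDeriv_comp_affine hσ.smooth 0 S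
    ((B.map Sum.inr ++ A.map Sum.inl).map phaseVec)) (x, y)
  simp only [zero_add] at h1
  have h2 : ((B.map Sum.inr ++ A.map Sum.inl).map phaseVec).map S =
      ((B.map Sum.inr ++ A.map Sum.inl).map Sum.swap).map phaseVec := by
    rw [List.map_map, List.map_map]
    refine List.map_congr_left fun d _ => ?_
    cases d <;> rfl
  rw [h2] at h1
  refine (congrArg norm h1).le.trans ((hC y x).trans (le_of_eq ?_))
  ring

end

/-! ### Rescaled symbols -/

noncomputable section

theorem leftCount_add_rightCount {n : ℕ} (L : List (Fin n ⊕ Fin n)) :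
    leftCount L + rightCount L = L.length := by
  obtain ⟨A, B, h, hA, hB⟩ := perm_inl_append_inr L
  rw [h.length_eq, ← hA, ← hB]
  simp

theorem iterDirDeriv_map_smul_phaseVec {n : ℕ} {F : Rn n × Rn n → ℂ} (hF : ContDiff ℝ ∞ F)
    (r s : ℝ) (L : List (Fin n ⊕ Fin n)) :
    iterDirDeriv (L.map (fun d => (Sum.elim (fun _ => r) (fun _ => s) d : ℝ) • phaseVec d)) F =
      fun z => (r ^ leftCount L * s ^ rightCount L) • iterDirDeriv (L.map phaseVec) F z := by
  induction L with
  | nil => simp [leftCount, rightCount]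
  | cons d L ih =>
    rw [List.map_cons, iterDirDeriv_cons, ih, List.map_cons, iterDirDeriv_cons,
      dirDeriv_smul_left]
    funext z
    have h1 := congrFun (iterDirDeriv_const_smul (hF.iterDirDeriv (L.map phaseVec))
      (r ^ leftCount L * s ^ rightCount L) [phaseVec d]) z
    simp only [iterDirDeriv_cons, iterDirDeriv_nil] at h1
    rw [h1, smul_smul]
    congr 1
    cases d <;> simp [leftCount, rightCount, List.countP_cons] <;> ring

theorem opNorm_le_sum_phaseVec {n : ℕ} (T : Rn n × Rn n →L[ℝ] ℂ) :
    ‖T‖ ≤ ∑ d, ‖T (phaseVec d)‖ := by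
  have h1 := opNorm_le_sum_stdVec (T.comp (ContinuousLinearMap.inl ℝ (Rn n) (Rn n)))
  have h2 := opNorm_le_sum_stdVec (T.comp (ContinuousLinearMap.inr ℝ (Rn n) (Rn n)))
  refine T.opNorm_le_bound (Finset.sum_nonneg fun _ _ => norm_nonneg _) fun v => ?_
  have h3 : T v = T.comp (ContinuousLinearMap.inl ℝ (Rn n) (Rn n)) v.1 +
      T.comp (ContinuousLinearMap.inr ℝ (Rn n) (Rn n)) v.2 := by
    rw [ContinuousLinearMap.comp_apply, ContinuousLinearMap.comp_apply, ← map_add]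
    simp
  rw [h3, Fintype.sum_sum_type, add_mul]
  refine (norm_add_le _ _).trans (add_le_add ?_ ?_)
  · exact (ContinuousLinearMap.le_opNorm _ _).trans
      (mul_le_mul h1 (norm_fst_le v) (norm_nonneg _)
        (Finset.sum_nonneg fun _ _ => norm_nonneg _))
  · exact (ContinuousLinearMap.le_opNorm _ _).trans
      (mul_le_mul h2 (norm_snd_le v) (norm_nonneg _)
        (Finset.sum_nonneg fun _ _ => norm_nonneg _))

/-- The symbol `σ(x₀ + h x, ξ₀ + h⁻¹ ξ)`, divided by `Λ(x₀)^{m₂} Λ(ξ₀)^{m₁}`. -/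
def scaledSymbol {n : ℕ} (Λ : Rn n → ℝ) (m₁ m₂ : ℝ) (σ : Rn n → Rn n → ℂ) (x₀ ξ₀ : Rn n)
    (h : ℝ) (x ξ : Rn n) : ℂ :=
  (Λ x₀ ^ (-m₂) * Λ ξ₀ ^ (-m₁)) • σ (x₀ + h • x) (ξ₀ + h⁻¹ • ξ)

/-- Points `(x₀, ξ₀)` of phase space and scales `h` at which symbols vary slowly: after the
substitution `(x₀ + h x, ξ₀ + h⁻¹ ξ)`, each derivative gains a factor `ε`. -/
structure IsScaling {n : ℕ} {ι : Type*} (Λ : Rn n → ℝ) (ρ : ℝ) (x₀ ξ₀ : ι → Rn n)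
    (h ε : ι → ℝ) : Prop where
  pos : ∀ k, 0 < h k
  eps_pos : ∀ k, 0 < ε k
  bounded : ∃ c : ℝ, 0 < c ∧ ∀ k, ε k ≤ c ∧ h k ≤ c * Λ (x₀ k) ^ (ρ / 2) ∧
    (h k)⁻¹ ≤ c * Λ (ξ₀ k) ^ (ρ / 2)
  left : ∀ k, h k * Λ (x₀ k) ^ (-ρ) ≤ ε k
  right : ∀ k, (h k)⁻¹ * Λ (ξ₀ k) ^ (-ρ) ≤ ε k

namespace HasSGBounds

variable {n : ℕ} {ι : Type*} {Λ : Rn n → ℝ} {μ ρ m₁ m₂ : ℝ} {σ : Rn n → Rn n → ℂ}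
  {x₀ ξ₀ : ι → Rn n} {h ε : ι → ℝ}

theorem contDiff_scaledSymbol (hσ : HasSGBounds Λ ρ m₁ m₂ σ) (x₀ ξ₀ : Rn n) (h : ℝ) :
    ContDiff ℝ ∞ (fun z : Rn n × Rn n => scaledSymbol Λ m₁ m₂ σ x₀ ξ₀ h z.1 z.2) := by
  have h1 : ContDiff ℝ ∞ (fun z : Rn n × Rn n => (x₀ + h • z.1, ξ₀ + h⁻¹ • z.2)) :=
    (contDiff_const.add (contDiff_fst.const_smul h)).prodMk
      (contDiff_const.add (contDiff_snd.const_smul h⁻¹))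
  exact (hσ.smooth.comp h1).const_smul (Λ x₀ ^ (-m₂) * Λ ξ₀ ^ (-m₁))

theorem iterDirDeriv_scaledSymbol (hσ : HasSGBounds Λ ρ m₁ m₂ σ) (x₀ ξ₀ : Rn n) (h : ℝ)
    (L : List (Fin n ⊕ Fin n)) (x ξ : Rn n) :
    iterDirDeriv (L.map phaseVec)
      (fun z : Rn n × Rn n => scaledSymbol Λ m₁ m₂ σ x₀ ξ₀ h z.1 z.2) (x, ξ) =
      (Λ x₀ ^ (-m₂) * Λ ξ₀ ^ (-m₁)) • (h ^ leftCount L * h⁻¹ ^ rightCount L) •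
        iterDirDeriv (L.map phaseVec) (fun z : Rn n × Rn n => σ z.1 z.2)
          (x₀ + h • x, ξ₀ + h⁻¹ • ξ) := by
  let A : Rn n × Rn n →L[ℝ] Rn n × Rn n :=
    (h • ContinuousLinearMap.fst ℝ (Rn n) (Rn n)).prod
      (h⁻¹ • ContinuousLinearMap.snd ℝ (Rn n) (Rn n))
  have h1 : (fun z : Rn n × Rn n => scaledSymbol Λ m₁ m₂ σ x₀ ξ₀ h z.1 z.2) =
      fun z => (Λ x₀ ^ (-m₂) * Λ ξ₀ ^ (-m₁)) •
        (fun w : Rn n × Rn n => σ w.1 w.2) ((x₀, ξ₀) + A z) := rfl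
  have h2 : ContDiff ℝ ∞ (fun z => (fun w : Rn n × Rn n => σ w.1 w.2) ((x₀, ξ₀) + A z)) :=
    hσ.smooth.comp (contDiff_const.add A.contDiff)
  rw [h1, iterDirDeriv_const_smul h2, iterDirDeriv_comp_affine hσ.smooth]
  have h3 : (L.map phaseVec).map A =
      L.map (fun d => (Sum.elim (fun _ => h) (fun _ => h⁻¹) d : ℝ) • phaseVec d) := by
    rw [List.map_map]
    refine List.map_congr_left fun d _ => ?_
    cases d <;> simp [A, phaseVec]
  rw [h3, iterDirDeriv_map_smul_phaseVec hσ.smooth]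
  rfl

/-- The chain rule gives `h^p h^{-q}`. Slow variation replaces the weights at the shifted points by
those at the centre, leaving `(h Λ(x₀)^{-ρ})^p (h⁻¹ Λ(ξ₀)^{-ρ})^q`, which is at most `ε^{p+q}`. The
exponent `N` depends on the number `p` of `x`-derivatives only, as an amplitude requires. -/
theorem exists_scaledSymbol_bound (hσ : HasSGBounds Λ ρ m₁ m₂ σ) (hΛ : IsWeightFunction Λ μ)
    (hρ : 0 < ρ) (hρμ : ρ ≤ 1 / μ) (hs : IsScaling Λ ρ x₀ ξ₀ h ε) (p : ℕ) :
    ∃ N : ℕ, ∀ L : List (Fin n ⊕ Fin n), leftCount L = p → ∃ (C : ℝ) (M : ℕ), 0 ≤ C ∧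
      ∀ k x ξ, ‖iterDirDeriv (L.map phaseVec)
        (fun z : Rn n × Rn n => scaledSymbol Λ m₁ m₂ σ (x₀ k) (ξ₀ k) (h k) z.1 z.2) (x, ξ)‖ ≤
          C * ε k ^ L.length * (1 + ‖x‖) ^ N * (1 + ‖ξ‖) ^ M := by
  obtain ⟨c, hc, hcb⟩ := hs.bounded
  obtain ⟨C₂, N, hC₂, h₂⟩ := hΛ.exists_rpow_shift_le hρ hρμ c (m₂ - ρ * p)
  refine ⟨N, fun L hL => ?_⟩
  set q := rightCount L with hq
  obtain ⟨C₁, M, hC₁, h₁⟩ := hΛ.exists_rpow_shift_le hρ hρμ c (m₁ - ρ * q)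
  obtain ⟨C, hC, hb⟩ := hσ.bound L
  refine ⟨C * C₂ * C₁, M, by positivity, fun k x ξ => ?_⟩
  have hk := hs.pos k
  have hx := hΛ.pos (x₀ k)
  have hξ := hΛ.pos (ξ₀ k)
  have e2 := h₂ (x₀ k) x (h k) hk.le (hcb k).2.1
  have e1 := h₁ (ξ₀ k) ξ (h k)⁻¹ (inv_pos.2 hk).le (hcb k).2.2
  have e0 := hb (x₀ k + h k • x) (ξ₀ k + (h k)⁻¹ • ξ)
  rw [hL, ← hq] at e0
  rw [hσ.iterDirDeriv_scaledSymbol, hL, ← hq, norm_smul, norm_smul,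
    Real.norm_of_nonneg (by positivity), Real.norm_of_nonneg (by positivity)]
  have split : ∀ {y : ℝ}, 0 < y → ∀ (m : ℝ) (j : ℕ),
      y ^ (-m) * y ^ (m - ρ * j) = (y ^ (-ρ)) ^ j := by
    intro y hy m j
    rw [← Real.rpow_add hy, ← Real.rpow_natCast, ← Real.rpow_mul hy.le]
    congr 1
    ring
  have e0' : ‖iterDirDeriv (L.map phaseVec) (fun z : Rn n × Rn n => σ z.1 z.2)
      (x₀ k + h k • x, ξ₀ k + (h k)⁻¹ • ξ)‖ ≤
      C * (C₂ * Λ (x₀ k) ^ (m₂ - ρ * p) * (1 + ‖x‖) ^ N) *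
        (C₁ * Λ (ξ₀ k) ^ (m₁ - ρ * q) * (1 + ‖ξ‖) ^ M) := by
    refine e0.trans ?_
    have hx' := Real.rpow_nonneg (hΛ.pos (x₀ k + h k • x)).le (m₂ - ρ * p)
    have hξ' := Real.rpow_nonneg (hΛ.pos (ξ₀ k + (h k)⁻¹ • ξ)).le (m₁ - ρ * q)
    gcongr
  have el := hs.left k
  have er := hs.right k
  have hlen : L.length = p + q := by rw [← hL, hq, leftCount_add_rightCount]
  calc _ ≤ Λ (x₀ k) ^ (-m₂) * Λ (ξ₀ k) ^ (-m₁) * (h k ^ p * (h k)⁻¹ ^ q *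
        (C * (C₂ * Λ (x₀ k) ^ (m₂ - ρ * p) * (1 + ‖x‖) ^ N) *
        (C₁ * Λ (ξ₀ k) ^ (m₁ - ρ * q) * (1 + ‖ξ‖) ^ M))) := by gcongr
    _ = C * C₂ * C₁ * (h k ^ p * (Λ (x₀ k) ^ (-m₂) * Λ (x₀ k) ^ (m₂ - ρ * p))) *
        ((h k)⁻¹ ^ q * (Λ (ξ₀ k) ^ (-m₁) * Λ (ξ₀ k) ^ (m₁ - ρ * q))) *
          (1 + ‖x‖) ^ N * (1 + ‖ξ‖) ^ M := by ring
    _ = C * C₂ * C₁ * (h k * Λ (x₀ k) ^ (-ρ)) ^ p * ((h k)⁻¹ * Λ (ξ₀ k) ^ (-ρ)) ^ q *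
          (1 + ‖x‖) ^ N * (1 + ‖ξ‖) ^ M := by rw [split hx, split hξ, mul_pow, mul_pow]
    _ ≤ C * C₂ * C₁ * (ε k) ^ p * (ε k) ^ q * (1 + ‖x‖) ^ N * (1 + ‖ξ‖) ^ M := by
      have := hs.eps_pos k
      gcongr
    _ = _ := by rw [hlen, pow_add]; ring

theorem leftCount_inr_append_inl (A B : List (Fin n)) :
    leftCount (B.map Sum.inr ++ A.map Sum.inl : List (Fin n ⊕ Fin n)) = A.length := by
  rw [leftCount, List.countP_append, List.countP_map, List.countP_map]
  simp [Function.comp_def]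

theorem isAmplitude_scaledSymbol (hσ : HasSGBounds Λ ρ m₁ m₂ σ) (hΛ : IsWeightFunction Λ μ)
    (hρ : 0 < ρ) (hρμ : ρ ≤ 1 / μ) (hs : IsScaling Λ ρ x₀ ξ₀ h ε) (k : ι) :
    IsAmplitude (fun (_ : Unit) (z : Rn n × Rn n) =>
      scaledSymbol Λ m₁ m₂ σ (x₀ k) (ξ₀ k) (h k) z.1 z.2) := by
  refine ⟨fun _ => hσ.contDiff_scaledSymbol _ _ _, fun A => ?_⟩
  obtain ⟨N, hN⟩ := hσ.exists_scaledSymbol_bound hΛ hρ hρμ hs A.length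
  refine ⟨N, fun B => ?_⟩
  obtain ⟨C, M, hC, hb⟩ := hN _ (leftCount_inr_append_inl A B)
  exact ⟨_, M, fun _ x ξ => hb k x ξ⟩

theorem exists_norm_scaledSymbol_sub_le (hσ : HasSGBounds Λ ρ m₁ m₂ σ)
    (hΛ : IsWeightFunction Λ μ) (hρ : 0 < ρ) (hρμ : ρ ≤ 1 / μ)
    (hs : IsScaling Λ ρ x₀ ξ₀ h ε) :
    ∃ (C : ℝ) (N M : ℕ), 0 ≤ C ∧ ∀ k x ξ,
      ‖scaledSymbol Λ m₁ m₂ σ (x₀ k) (ξ₀ k) (h k) x ξ -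
        scaledSymbol Λ m₁ m₂ σ (x₀ k) (ξ₀ k) (h k) 0 0‖ ≤
          C * ε k * (1 + ‖x‖) ^ N * (1 + ‖ξ‖) ^ M := by
  have key : ∀ d : Fin n ⊕ Fin n, ∃ (C : ℝ) (N M : ℕ), 0 ≤ C ∧ ∀ k x ξ,
      ‖dirDeriv (phaseVec d) (fun z : Rn n × Rn n =>
        scaledSymbol Λ m₁ m₂ σ (x₀ k) (ξ₀ k) (h k) z.1 z.2) (x, ξ)‖ ≤
          C * ε k * (1 + ‖x‖) ^ N * (1 + ‖ξ‖) ^ M := by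
    intro d
    obtain ⟨N, hN⟩ := hσ.exists_scaledSymbol_bound hΛ hρ hρμ hs (leftCount [d])
    obtain ⟨C, M, hC, hb⟩ := hN [d] rfl
    exact ⟨C, N, M, hC, fun k x ξ => by simpa using hb k x ξ⟩
  choose C N M hC hb using key
  -- The extra power in each variable absorbs the length of the segment from the origin to `(x, ξ)`.
  refine ⟨∑ d, C d, ∑ d, N d + 1, ∑ d, M d + 1, Finset.sum_nonneg fun d _ => hC d,
    fun k x ξ => ?_⟩
  set G : Rn n × Rn n → ℂ := fun z =>
    scaledSymbol Λ m₁ m₂ σ (x₀ k) (ξ₀ k) (h k) z.1 z.2 with hG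
  have hGd := (hσ.contDiff_scaledSymbol (x₀ k) (ξ₀ k) (h k)).differentiable_infty
  have hε := (hs.eps_pos k).le
  have h1x : (1 : ℝ) ≤ 1 + ‖x‖ := by linarith [norm_nonneg x]
  have h1ξ : (1 : ℝ) ≤ 1 + ‖ξ‖ := by linarith [norm_nonneg ξ]
  -- On this product of balls the polynomial bounds on the gradient are at most their values at `(x,
  -- ξ)`.
  have hmv := Convex.norm_image_sub_le_of_norm_fderiv_le (𝕜 := ℝ) (f := G)
    (s := {z : Rn n × Rn n | ‖z.1‖ ≤ ‖x‖ ∧ ‖z.2‖ ≤ ‖ξ‖})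
    (C := (∑ d, C d) * ε k * (1 + ‖x‖) ^ (∑ d, N d) * (1 + ‖ξ‖) ^ (∑ d, M d))
    (x := (0, 0)) (y := (x, ξ)) (fun z _ => hGd z) (fun z hz => ?_) ?_ (by simp) (by simp)
  · refine hmv.trans ?_
    have h2 : ‖((x, ξ) : Rn n × Rn n) - (0, 0)‖ ≤ (1 + ‖x‖) * (1 + ‖ξ‖) := by
      have h3 : ‖((x, ξ) : Rn n × Rn n) - (0, 0)‖ = max ‖x‖ ‖ξ‖ := by simp [Prod.norm_def]
      rw [h3]
      refine max_le ?_ ?_ <;> nlinarith [norm_nonneg x, norm_nonneg ξ]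
    have hCs : 0 ≤ ∑ d, C d := Finset.sum_nonneg fun d _ => hC d
    calc _ ≤ (∑ d, C d) * ε k * (1 + ‖x‖) ^ (∑ d, N d) * (1 + ‖ξ‖) ^ (∑ d, M d) *
          ((1 + ‖x‖) * (1 + ‖ξ‖)) := by gcongr
      _ = _ := by ring
  · refine (opNorm_le_sum_phaseVec _).trans ?_
    rw [Finset.sum_mul, Finset.sum_mul, Finset.sum_mul]
    refine Finset.sum_le_sum fun d _ => (hb d k z.1 z.2).trans ?_
    have hCd := hC d
    calc _ ≤ C d * ε k * (1 + ‖x‖) ^ (N d) * (1 + ‖ξ‖) ^ (M d) := by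
          gcongr
          · exact hz.1
          · exact hz.2
      _ ≤ _ := by
          gcongr
          · exact Finset.single_le_sum (f := N) (fun _ _ => Nat.zero_le _) (Finset.mem_univ d)
          · exact Finset.single_le_sum (f := M) (fun _ _ => Nat.zero_le _) (Finset.mem_univ d)
  · have h2 : {z : Rn n × Rn n | ‖z.1‖ ≤ ‖x‖ ∧ ‖z.2‖ ≤ ‖ξ‖} =
        Metric.closedBall 0 ‖x‖ ×ˢ Metric.closedBall 0 ‖ξ‖ := by
      ext z
      simp
    rw [h2]
    exact (convex_closedBall _ _).prod (convex_closedBall _ _)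

/-- One factor `ε` can be divided out uniformly in `k`: without derivatives by the mean value
inequality, and with derivatives because each of them supplies a factor `ε`. -/
theorem isAmplitude_scaledSymbol_sub (hσ : HasSGBounds Λ ρ m₁ m₂ σ) (hΛ : IsWeightFunction Λ μ)
    (hρ : 0 < ρ) (hρμ : ρ ≤ 1 / μ) (hs : IsScaling Λ ρ x₀ ξ₀ h ε) :
    IsAmplitude (fun k (z : Rn n × Rn n) => (ε k)⁻¹ •
      (scaledSymbol Λ m₁ m₂ σ (x₀ k) (ξ₀ k) (h k) z.1 z.2 -
        scaledSymbol Λ m₁ m₂ σ (x₀ k) (ξ₀ k) (h k) 0 0)) := by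
  have hsub : ∀ k, ContDiff ℝ ∞ (fun z : Rn n × Rn n =>
      scaledSymbol Λ m₁ m₂ σ (x₀ k) (ξ₀ k) (h k) z.1 z.2 -
        scaledSymbol Λ m₁ m₂ σ (x₀ k) (ξ₀ k) (h k) 0 0) := fun k =>
    (hσ.contDiff_scaledSymbol (x₀ k) (ξ₀ k) (h k)).sub contDiff_const
  refine ⟨fun k => (hsub k).const_smul (ε k)⁻¹, fun A => ?_⟩
  obtain ⟨c, hc, hcb⟩ := hs.bounded
  obtain ⟨C₀, N₀, M₀, hC₀, h₀⟩ := hσ.exists_norm_scaledSymbol_sub_le hΛ hρ hρμ hs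
  obtain ⟨N, hN⟩ := hσ.exists_scaledSymbol_bound hΛ hρ hρμ hs A.length
  -- The exponent must be fixed before `B`, so it covers both the undifferentiated case and the
  -- others.
  refine ⟨N₀ + N, fun B => ?_⟩
  obtain ⟨C, M, hC, hb⟩ := hN _ (leftCount_inr_append_inl A B)
  set L : List (Fin n ⊕ Fin n) := B.map Sum.inr ++ A.map Sum.inl
  have h1 : ∀ k x ξ, ‖iterDirDeriv (L.map phaseVec) (fun z : Rn n × Rn n => (ε k)⁻¹ •
      (scaledSymbol Λ m₁ m₂ σ (x₀ k) (ξ₀ k) (h k) z.1 z.2 -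
        scaledSymbol Λ m₁ m₂ σ (x₀ k) (ξ₀ k) (h k) 0 0)) (x, ξ)‖ =
      (ε k)⁻¹ * ‖iterDirDeriv (L.map phaseVec) (fun z : Rn n × Rn n =>
      (scaledSymbol Λ m₁ m₂ σ (x₀ k) (ξ₀ k) (h k) z.1 z.2 -
        scaledSymbol Λ m₁ m₂ σ (x₀ k) (ξ₀ k) (h k) 0 0)) (x, ξ)‖ := by
    intro k x ξ
    rw [iterDirDeriv_const_smul (hsub k), norm_smul,
      Real.norm_of_nonneg (inv_nonneg.2 (hs.eps_pos k).le)]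
  rcases eq_or_ne L [] with hL | hL
  · refine ⟨C₀, M₀, fun k x ξ => ?_⟩
    have hε := hs.eps_pos k
    rw [h1, hL, inv_mul_le_iff₀ hε]
    refine (h₀ k x ξ).trans ?_
    calc C₀ * ε k * (1 + ‖x‖) ^ N₀ * (1 + ‖ξ‖) ^ M₀
        ≤ C₀ * ε k * (1 + ‖x‖) ^ (N₀ + N) * (1 + ‖ξ‖) ^ M₀ := by
          gcongr
          · linarith [norm_nonneg x]
          · omega
      _ = _ := by ring
  -- The list is nonempty here. One factor `ε k` is cancelled and the remaining `L.length - 1` are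
  -- bounded by `c`.
  · refine ⟨C * c ^ (L.length - 1), M, fun k x ξ => ?_⟩
    have hε := hs.eps_pos k
    rw [h1, inv_mul_le_iff₀ hε, iterDirDeriv_sub_const _ (by simpa using hL)]
    refine (hb k x ξ).trans ?_
    have hlen : ε k ^ L.length ≤ ε k * c ^ (L.length - 1) := by
      obtain ⟨m, hm⟩ : ∃ m, L.length = m + 1 :=
        ⟨L.length - 1, by have := List.length_pos_iff.2 hL; omega⟩
      rw [hm, Nat.add_sub_cancel, pow_succ, mul_comm]
      have := (hcb k).1
      gcongr
    calc C * ε k ^ L.length * (1 + ‖x‖) ^ N * (1 + ‖ξ‖) ^ M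
        ≤ C * (ε k * c ^ (L.length - 1)) * (1 + ‖x‖) ^ (N₀ + N) * (1 + ‖ξ‖) ^ M := by
          gcongr
          · linarith [norm_nonneg x]
          · omega
      _ = _ := by ring

theorem tendsto_psdoSw_scaledSymbol (hσ : HasSGBounds Λ ρ m₁ m₂ σ) (hΛ : IsWeightFunction Λ μ)
    (hρ : 0 < ρ) (hρμ : ρ ≤ 1 / μ) (hs : IsScaling Λ ρ x₀ ξ₀ h ε) {l : Filter ι}
    (hε : Filter.Tendsto ε l (nhds 0)) {c : ℂ}
    (hc : Filter.Tendsto (fun k => scaledSymbol Λ m₁ m₂ σ (x₀ k) (ξ₀ k) (h k) 0 0) l (nhds c))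
    {φ : ι → 𝓢(Rn n, ℂ)} {φ₀ : 𝓢(Rn n, ℂ)} (hφ : Filter.Tendsto φ l (nhds φ₀)) :
    Filter.Tendsto
      (fun k => psdoSw (hσ.isAmplitude_scaledSymbol hΛ hρ hρμ hs k) (φ k)) l (nhds (c • φ₀)) := by
  refine tendsto_psdoSw _
    (b := fun k x ξ => (ε k)⁻¹ • (scaledSymbol Λ m₁ m₂ σ (x₀ k) (ξ₀ k) (h k) x ξ -
        scaledSymbol Λ m₁ m₂ σ (x₀ k) (ξ₀ k) (h k) 0 0))
    (hσ.isAmplitude_scaledSymbol_sub hΛ hρ hρμ hs) (fun k x ξ => ?_) hc hε hφ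
  have : (ε k : ℂ) ≠ 0 := by exact_mod_cast (hs.eps_pos k).ne'
  rw [Complex.real_smul, Complex.ofReal_inv, mul_inv_cancel_left₀ this]
  ring

end HasSGBounds

end

/-! ### Wave packets -/

noncomputable section

theorem iteratedDeriv_exp_I_mul (k : ℕ) :
    iteratedDeriv k (fun t : ℝ => Complex.exp (Complex.I * t)) =
      fun t : ℝ => Complex.I ^ k * Complex.exp (Complex.I * t) := by
  induction k with
  | zero => simp
  | succ k ih =>
    rw [iteratedDeriv_succ, ih]
    funext t
    have h1 : HasDerivAt (fun t : ℝ => Complex.I * (t : ℂ)) Complex.I t := by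
      simpa using (Complex.ofRealCLM.hasDerivAt (x := t)).const_mul Complex.I
    rw [(h1.cexp.const_mul (Complex.I ^ k)).deriv]
    ring

theorem hasTemperateGrowth_exp_I_mul :
    Function.HasTemperateGrowth (fun t : ℝ => Complex.exp (Complex.I * t)) := by
  refine ⟨(contDiff_const.mul Complex.ofRealCLM.contDiff).cexp, fun k => ⟨0, 1, fun t => ?_⟩⟩
  rw [norm_iteratedFDeriv_eq_norm_iteratedDeriv, iteratedDeriv_exp_I_mul, norm_mul,
    norm_exp_I_mul_ofReal]
  simp

theorem hasTemperateGrowth_exp_I_inner {n : ℕ} (ξ₀ : Rn n) :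
    Function.HasTemperateGrowth
      (fun x : Rn n => Complex.exp (Complex.I * (inner ℝ x ξ₀ : ℝ))) :=
  hasTemperateGrowth_exp_I_mul.comp (Function.hasTemperateGrowth_inner_left ξ₀)

/-- The wave packet `x ↦ e^{i x·ξ₀} φ((x - x₀) / h)`. -/
def wavePacket {n : ℕ} (x₀ ξ₀ : Rn n) {h : ℝ} (hh : 0 < h) : 𝓢(Rn n, ℂ) →L[ℂ] 𝓢(Rn n, ℂ) :=
  (SchwartzMap.smulLeftCLM ℂ
    (fun x : Rn n => Complex.exp (Complex.I * (inner ℝ x ξ₀ : ℝ)))).comp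
    ((SchwartzMap.compSubConstCLM ℂ x₀).comp
      (SchwartzMap.compCLMOfContinuousLinearEquiv ℂ (dilation n h⁻¹ (inv_ne_zero hh.ne'))))

/-! ### Transformation rules and norms of wave packets -/

section

variable {n : ℕ} (x₀ ξ₀ : Rn n) {h : ℝ} (hh : 0 < h)

theorem wavePacket_apply (φ : 𝓢(Rn n, ℂ)) (x : Rn n) :
    wavePacket x₀ ξ₀ hh φ x =
      Complex.exp (Complex.I * (inner ℝ x ξ₀ : ℝ)) * φ (h⁻¹ • (x - x₀)) := by
  rw [wavePacket, ContinuousLinearMap.comp_apply,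
    SchwartzMap.smulLeftCLM_apply_apply (hasTemperateGrowth_exp_I_inner ξ₀)]
  rfl

theorem wavePacket_apply_add_smul (φ : 𝓢(Rn n, ℂ)) (y : Rn n) :
    wavePacket x₀ ξ₀ hh φ (x₀ + h • y) =
      Complex.exp (Complex.I * (inner ℝ (x₀ + h • y) ξ₀ : ℝ)) * φ y := by
  rw [wavePacket_apply, add_sub_cancel_left, smul_smul, inv_mul_cancel₀ hh.ne', one_smul]

theorem norm_wavePacket_apply (φ : 𝓢(Rn n, ℂ)) (x : Rn n) :
    ‖wavePacket x₀ ξ₀ hh φ x‖ = ‖φ (h⁻¹ • (x - x₀))‖ := by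
  rw [wavePacket_apply, norm_mul, norm_exp_I_mul_ofReal, one_mul]

include hh in
theorem integral_eq_pow_smul_integral_comp_add_smul {F : Type*} [NormedAddCommGroup F]
    [NormedSpace ℝ F] (f : Rn n → F) :
    ∫ x, f x = h ^ n • ∫ y, f (x₀ + h • y) := by
  have h1 := Measure.integral_comp_smul (volume : Measure (Rn n)) (fun y => f (x₀ + y)) h
  rw [finrank_euclideanSpace_fin, abs_of_pos (by positivity), integral_add_left_eq_self] at h1
  rw [h1, smul_smul, mul_inv_cancel₀ (by positivity), one_smul]

/-- The Fourier transform of the packet is concentrated at `ξ₀` on the reciprocal scale `h⁻¹`, with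
a phase recording the position `x₀`. -/
theorem fourierRn_wavePacket (φ : 𝓢(Rn n, ℂ)) (η : Rn n) :
    fourierRn (wavePacket x₀ ξ₀ hh φ) (ξ₀ + h⁻¹ • η) =
      ((h ^ n : ℝ) : ℂ) * Complex.exp (-Complex.I * (inner ℝ x₀ (h⁻¹ • η) : ℝ)) *
        fourierRn φ η := by
  rw [fourierRn, fourierRn, integral_eq_pow_smul_integral_comp_add_smul x₀ hh, Complex.real_smul]
  simp only [← integral_const_mul]
  refine integral_congr_ae (Filter.Eventually.of_forall fun y => ?_)
  change _ * (_ * (_ * wavePacket x₀ ξ₀ hh φ (x₀ + h • y))) = _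
  have h1 : inner ℝ (h • y) (h⁻¹ • η) = inner ℝ y η := by
    rw [real_inner_smul_left, real_inner_smul_right, ← mul_assoc, mul_inv_cancel₀ hh.ne', one_mul]
  have h2 : Complex.exp (-Complex.I * (inner ℝ (x₀ + h • y) (ξ₀ + h⁻¹ • η) : ℝ)) *
      Complex.exp (Complex.I * (inner ℝ (x₀ + h • y) ξ₀ : ℝ)) =
      Complex.exp (-Complex.I * (inner ℝ x₀ (h⁻¹ • η) : ℝ)) *
        Complex.exp (-Complex.I * (inner ℝ y η : ℝ)) := by
    rw [← Complex.exp_add, ← Complex.exp_add, inner_add_right, inner_add_left x₀ _ (h⁻¹ • η), h1]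
    push_cast
    ring_nf
  rw [wavePacket_apply_add_smul]
  linear_combination
    ((((2 * Real.pi) ^ (-(n : ℝ) / 2) : ℝ) : ℂ) * ((h ^ n : ℝ) : ℂ) * φ y) * h2

/-- Substitute `ξ = ξ₀ + h⁻¹ η`: the Jacobian `h^{-n}` cancels the factor `h^n` of the transformed
packet, the phases in `x₀` cancel, and the pairing of `h y` with `h⁻¹ η` is scale invariant. -/
theorem psdo_wavePacket (σ : Rn n → Rn n → ℂ) (φ : 𝓢(Rn n, ℂ)) (y : Rn n) :
    psdo σ (wavePacket x₀ ξ₀ hh φ) (x₀ + h • y) =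
      Complex.exp (Complex.I * (inner ℝ (x₀ + h • y) ξ₀ : ℝ)) *
        psdo (fun x ξ => σ (x₀ + h • x) (ξ₀ + h⁻¹ • ξ)) φ y := by
  rw [psdo, psdo, integral_eq_pow_smul_integral_comp_add_smul ξ₀ (inv_pos.2 hh),
    Complex.real_smul]
  simp only [← integral_const_mul]
  refine integral_congr_ae (Filter.Eventually.of_forall fun η => ?_)
  change _ * (_ * (_ * fourierRn (wavePacket x₀ ξ₀ hh φ) (ξ₀ + h⁻¹ • η))) = _
  rw [fourierRn_wavePacket]
  have h1 : inner ℝ (h • y) (h⁻¹ • η) = inner ℝ y η := by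
    rw [real_inner_smul_left, real_inner_smul_right, ← mul_assoc, mul_inv_cancel₀ hh.ne', one_mul]
  have h2 : Complex.exp (Complex.I * (inner ℝ (x₀ + h • y) (ξ₀ + h⁻¹ • η) : ℝ)) *
      Complex.exp (-Complex.I * (inner ℝ x₀ (h⁻¹ • η) : ℝ)) =
      Complex.exp (Complex.I * (inner ℝ (x₀ + h • y) ξ₀ : ℝ)) *
        Complex.exp (Complex.I * (inner ℝ y η : ℝ)) := by
    rw [← Complex.exp_add, ← Complex.exp_add, inner_add_right, inner_add_left x₀ _ (h⁻¹ • η), h1]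
    push_cast
    ring_nf
  have h3 : (((h⁻¹) ^ n : ℝ) : ℂ) * ((h ^ n : ℝ) : ℂ) = 1 := by
    rw [← Complex.ofReal_mul, ← mul_pow, inv_mul_cancel₀ hh.ne', one_pow, Complex.ofReal_one]
  linear_combination
    ((((2 * Real.pi) ^ (-(n : ℝ) / 2) : ℝ) : ℂ) * σ (x₀ + h • y) (ξ₀ + h⁻¹ • η) * fourierRn φ η *
      Complex.exp (Complex.I * (inner ℝ (x₀ + h • y) (ξ₀ + h⁻¹ • η) : ℝ)) *
      Complex.exp (-Complex.I * (inner ℝ x₀ (h⁻¹ • η) : ℝ))) * h3 +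
    ((((2 * Real.pi) ^ (-(n : ℝ) / 2) : ℝ) : ℂ) * σ (x₀ + h • y) (ξ₀ + h⁻¹ • η) * fourierRn φ η) * h2

theorem psdo_const_smul (c : ℝ) (σ : Rn n → Rn n → ℂ) (φ : 𝓢(Rn n, ℂ)) (x : Rn n) :
    psdo (fun x ξ => c • σ x ξ) φ x = c * psdo σ φ x := by
  simp only [psdo, ← integral_const_mul]
  refine integral_congr_ae (Filter.Eventually.of_forall fun ξ => ?_)
  simp only [Complex.real_smul]
  ring

theorem psdoSw_wavePacket {Λ : Rn n → ℝ} {m₁ m₂ : ℝ} {σ : Rn n → Rn n → ℂ} (hΛ : ∀ x, 0 < Λ x)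
    (hσ : IsAmplitude (fun (_ : Unit) (z : Rn n × Rn n) => σ z.1 z.2))
    (hs : IsAmplitude (fun (_ : Unit) (z : Rn n × Rn n) =>
      scaledSymbol Λ m₁ m₂ σ x₀ ξ₀ h z.1 z.2)) (φ : 𝓢(Rn n, ℂ)) :
    psdoSw hσ (wavePacket x₀ ξ₀ hh φ) =
      (Λ x₀ ^ m₂ * Λ ξ₀ ^ m₁) • wavePacket x₀ ξ₀ hh (psdoSw hs φ) := by
  ext x
  obtain ⟨y, rfl⟩ : ∃ y, x = x₀ + h • y :=
    ⟨h⁻¹ • (x - x₀), by rw [smul_smul, mul_inv_cancel₀ hh.ne', one_smul, add_sub_cancel]⟩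
  have h1 : psdoSw hs φ y = _ := (psdoSw_apply hs φ y).trans
    (psdo_const_smul (Λ x₀ ^ (-m₂) * Λ ξ₀ ^ (-m₁)) _ φ y)
  rw [psdoSw_apply, psdo_wavePacket, smul_apply, wavePacket_apply_add_smul, h1,
    Complex.real_smul, mul_left_comm, ← mul_assoc (((_ : ℝ) : ℂ)), ← Complex.ofReal_mul]
  have h2 : Λ x₀ ^ m₂ * Λ ξ₀ ^ m₁ * (Λ x₀ ^ (-m₂) * Λ ξ₀ ^ (-m₁)) = 1 := by
    have := hΛ x₀
    have := hΛ ξ₀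
    rw [Real.rpow_neg (hΛ _).le, Real.rpow_neg (hΛ _).le]
    field_simp
  rw [h2, Complex.ofReal_one, one_mul]

theorem norm_toLp_wavePacket {p : ℝ≥0∞} [Fact (1 ≤ p)] (hp : p ≠ ⊤) (φ : 𝓢(Rn n, ℂ)) :
    ‖(wavePacket x₀ ξ₀ hh φ).toLp p‖ = h ^ ((n : ℝ) / p.toReal) * ‖φ.toLp p‖ := by
  have hp0 : p ≠ 0 := (zero_lt_one.trans_le (Fact.out : 1 ≤ p)).ne'
  rw [SchwartzMap.norm_toLp' hp0 hp, SchwartzMap.norm_toLp' hp0 hp,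
    integral_eq_pow_smul_integral_comp_add_smul x₀ hh, smul_eq_mul,
    Real.mul_rpow (by positivity) (integral_nonneg fun _ => by positivity),
    ← Real.rpow_natCast, ← Real.rpow_mul hh.le, div_eq_mul_inv]
  congr 4
  funext y
  rw [norm_wavePacket_apply, add_sub_cancel_left, smul_smul, inv_mul_cancel₀ hh.ne', one_smul]

theorem norm_le_swNorm (φ : 𝓢(Rn n, ℂ)) (x : Rn n) : ‖φ x‖ ≤ swNorm 0 φ := by
  simpa using pow_mul_norm_le_swNorm 0 φ x

theorem norm_integral_wavePacket_mul_le (φ ψ : 𝓢(Rn n, ℂ)) :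
    ‖∫ x, wavePacket x₀ ξ₀ hh φ x * ψ x‖ ≤ swNorm 0 φ * ∫ x, ‖ψ x‖ := by
  rw [← integral_const_mul]
  refine norm_integral_le_of_norm_le (ψ.integrable.norm.const_mul _)
    (Filter.Eventually.of_forall fun x => ?_)
  rw [norm_mul, norm_wavePacket_apply]
  gcongr
  exact norm_le_swNorm φ _

theorem norm_integral_wavePacket_mul_le_pow (φ ψ : 𝓢(Rn n, ℂ)) :
    ‖∫ x, wavePacket x₀ ξ₀ hh φ x * ψ x‖ ≤ h ^ n * (‖φ.toLp 1‖ * swNorm 0 ψ) := by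
  rw [SchwartzMap.norm_toLp_one, integral_eq_pow_smul_integral_comp_add_smul x₀ hh, norm_smul,
    Real.norm_of_nonneg (by positivity), ← integral_mul_const]
  gcongr
  refine norm_integral_le_of_norm_le (φ.integrable.norm.mul_const _)
    (Filter.Eventually.of_forall fun y => ?_)
  rw [norm_mul, norm_wavePacket_apply, add_sub_cancel_left, smul_smul, inv_mul_cancel₀ hh.ne',
    one_smul]
  gcongr
  exact norm_le_swNorm ψ _

end

/-- If `h → ∞`, the pairing with `ψ` stays bounded while the normalization `h^{-n/q}` tends to `0`.
If `h → 0`, the support factor `h^n` wins, since `n - n/q > 0` for `q > 1` and `n > 0`. -/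
theorem tendsto_integral_wavePacket_mul {n : ℕ} (hn : 0 < n) {ι : Type*} {l : Filter ι}
    {q : ℝ} (hq : 1 < q) {x₀ ξ₀ : ι → Rn n} {h : ι → ℝ} (hh : ∀ k, 0 < h k)
    (hl : Filter.Tendsto h l Filter.atTop ∨ Filter.Tendsto h l (nhds 0))
    {φ : ι → 𝓢(Rn n, ℂ)} {φ₀ : 𝓢(Rn n, ℂ)} (hφ : Filter.Tendsto φ l (nhds φ₀))
    (ψ : 𝓢(Rn n, ℂ)) :
    Filter.Tendsto (fun k => h k ^ (-((n : ℝ) / q)) •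
      ∫ x, wavePacket (x₀ k) (ξ₀ k) (hh k) (φ k) x * ψ x) l (nhds 0) := by
  have hn' : (0 : ℝ) < n := by exact_mod_cast hn
  have hq0 : 0 < q := zero_lt_one.trans hq
  rw [tendsto_zero_iff_norm_tendsto_zero]
  rcases hl with hl | hl
  · have h1 : Filter.Tendsto (fun k => h k ^ (-((n : ℝ) / q)) *
        (swNorm 0 (φ k) * ∫ x, ‖ψ x‖)) l (nhds 0) := by
      have h2 := (tendsto_rpow_neg_atTop (div_pos hn' hq0)).comp hl
      have h3 := ((continuous_swNorm 0).tendsto φ₀).comp hφ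
      simpa using h2.mul (h3.mul_const (∫ x, ‖ψ x‖))
    refine squeeze_zero (fun _ => norm_nonneg _) (fun k => ?_) h1
    have := (hh k).le
    rw [norm_smul, Real.norm_of_nonneg (by positivity)]
    gcongr
    exact norm_integral_wavePacket_mul_le _ _ _ _ _
  · have h1 : Filter.Tendsto (fun k => h k ^ ((n : ℝ) - (n : ℝ) / q) *
        (‖(φ k).toLp 1‖ * swNorm 0 ψ)) l (nhds 0) := by
      have h0 : 0 < (n : ℝ) - (n : ℝ) / q := sub_pos.2 (div_lt_self hn' hq)
      have h2 := (Real.continuousAt_rpow_const 0 ((n : ℝ) - (n : ℝ) / q) (Or.inr h0.le)).tendsto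
      rw [Real.zero_rpow h0.ne'] at h2
      have h3 := (((SchwartzMap.toLpCLM ℂ ℂ 1 (volume : Measure (Rn n))).continuous.norm).tendsto
        φ₀).comp hφ
      simpa [Function.comp_def] using (h2.comp hl).mul (h3.mul_const (swNorm 0 ψ))
    refine squeeze_zero (fun _ => norm_nonneg _) (fun k => ?_) h1
    have hk := hh k
    rw [norm_smul, Real.norm_of_nonneg (by positivity), sub_eq_neg_add, Real.rpow_add hk,
      Real.rpow_natCast, mul_assoc]
    gcongr
    exact norm_integral_wavePacket_mul_le_pow _ _ _ _ _

end

/-! ### Fredholm operators and wave packets -/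

noncomputable section

/-- A Fredholm operator is bounded below modulo a finite-dimensional subspace. -/
theorem ContinuousLinearMap.IsFredholm.exists_norm_sub_le {E F : Type*}
    [SeminormedAddCommGroup E] [NormedSpace ℂ E] [SeminormedAddCommGroup F] [NormedSpace ℂ F]
    {A : E →L[ℂ] F} (hA : A.IsFredholm) :
    ∃ (X : Submodule ℂ E) (C : ℝ), FiniteDimensional ℂ X ∧
      ∀ u, ∃ v ∈ X, ‖u - v‖ ≤ C * ‖A u‖ := by
  obtain ⟨pkg⟩ := hA.nonempty_fredholmPackage
  -- `A` is the projection onto a complement of `X₀` followed by an isomorphism onto a summand of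
  -- the target. The approximant `v` is the component of `u` in `X₀`, and `C` is the norm of the
  -- inverse isomorphism.
  refine ⟨pkg.decDom.X₀, ‖(pkg.equiv.symm : pkg.decCodom.X₁ →L[ℂ] pkg.decDom.X₁)‖,
    pkg.decDom.finite_X₀, fun u => ⟨u - (pkg.decDom.proj u : E), ?_, ?_⟩⟩
  · rw [← Submodule.projectionOntoL_apply_eq_zero_iff pkg.decDom.isTopCompl, map_sub,
      Submodule.projectionOntoL_apply_left, sub_self]
  · rw [sub_sub_cancel]
    have h1 := (pkg.equiv.symm : pkg.decCodom.X₁ →L[ℂ] pkg.decDom.X₁).le_opNorm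
      (pkg.equiv (pkg.decDom.proj u))
    have h2 : (pkg.equiv (pkg.decDom.proj u) : F) = A u := by
      conv_rhs => rw [pkg.eq_equiv]
      rfl
    rw [← h2]
    simpa using h1

theorem continuous_lpToDist_apply {n : ℕ} {p : ℝ≥0∞} [Fact (1 ≤ p)] (ψ : 𝓢(Rn n, ℂ)) :
    Continuous (fun f : Lp ℂ p (volume : Measure (Rn n)) => lpToDist n p f ψ) :=
  (PointwiseConvergenceCLM.evalCLM (RingHom.id ℂ) ℂ ψ).continuous.comp
    (Lp.toTemperedDistributionCLM ℂ (volume : Measure (Rn n)) p).continuous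

/-- A sequence that tends weakly to zero in `L^p` and on which a Fredholm operator is small tends
to zero in norm. -/
theorem SGSobolev.tendsto_norm_zero_of_isFredholm {n : ℕ} {Λ : Rn n → ℝ} {p : ℝ≥0∞}
    [Fact (1 ≤ p)] {s₁ s₂ t₁ t₂ : ℝ} {A : SGSobolev Λ s₁ s₂ p →L[ℂ] SGSobolev Λ t₁ t₂ p}
    (hA : A.IsFredholm) {ι : Type*} {l : Filter ι} [l.NeBot] {u : ι → SGSobolev Λ s₁ s₂ p} {c : ℝ}
    (hu : Filter.Tendsto (fun k => ‖u k‖) l (nhds c))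
    (hAu : Filter.Tendsto (fun k => ‖A (u k)‖) l (nhds 0))
    (hw : ∀ ψ, Filter.Tendsto (fun k => lpToDist n p (toLp (u k)) ψ) l (nhds 0)) : c = 0 := by
  obtain ⟨X, C, hX, h⟩ := hA.exists_norm_sub_le
  choose v hvX hv using fun k => h (u k)
  -- The Sobolev space carries only a seminorm here, so compactness is used in the isometric image
  -- in `L^p`, a genuine normed space of finite dimension.
  let Y : Submodule ℂ (Lp ℂ p (volume : Measure (Rn n))) := X.map toLp
  have hY : FiniteDimensional ℂ Y := Module.Finite.map X toLp
  have : ProperSpace Y := FiniteDimensional.proper ℂ Y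
  let w : ι → Y := fun k => ⟨toLp (v k), Submodule.mem_map_of_mem (hvX k)⟩
  have hwn : ∀ k, ‖w k‖ = ‖v k‖ := fun k => rfl
  have hd : Filter.Tendsto (fun k => ‖u k - v k‖) l (nhds 0) :=
    squeeze_zero (fun _ => norm_nonneg _) hv (by simpa using hAu.const_mul C)
  have hvc : Filter.Tendsto (fun k => ‖v k‖) l (nhds c) := by
    have h1 : Filter.Tendsto (fun k => ‖v k‖ - ‖u k‖) l (nhds 0) := by
      refine squeeze_zero_norm (fun k => ?_) hd
      rw [norm_sub_rev, Real.norm_eq_abs]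
      exact abs_norm_sub_norm_le _ _
    simpa using h1.add hu
  let U : Ultrafilter ι := Ultrafilter.of l
  have hUl : (U : Filter ι) ≤ l := Ultrafilter.of_le l
  have hmem : ((U.map w : Ultrafilter Y) : Filter Y) ≤
      Filter.principal (Metric.closedBall 0 (c + 1)) := by
    rw [Filter.le_principal_iff]
    have h1 : ∀ᶠ k in l, ‖v k‖ < c + 1 := hvc.eventually (gt_mem_nhds (by linarith))
    have h2 := hUl h1
    refine Filter.mem_of_superset (Filter.mem_map.2 ?_) subset_rfl
    filter_upwards [h2] with k hk
    simpa [hwn] using hk.le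
  obtain ⟨g, -, hg⟩ := (isCompact_closedBall (0 : Y) (c + 1)).ultrafilter_le_nhds _ hmem
  have hg' : Filter.Tendsto w U (nhds g) := hg
  -- The approximants differ from `u k` by a null sequence in norm, so they inherit weak convergence
  -- to `0`. Their norm limit along the ultrafilter is therefore `0` as a distribution.
  have hg0 : (g : Lp ℂ p (volume : Measure (Rn n))) = 0 := by
    refine lpToDist_injective n p ?_
    rw [map_zero]
    ext ψ
    have h1 : Filter.Tendsto (fun k => lpToDist n p (w k) ψ) U (nhds (lpToDist n p g ψ)) :=
      ((continuous_lpToDist_apply ψ).comp continuous_subtype_val).continuousAt.tendsto.comp hg'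
    have h2 : Filter.Tendsto (fun k => toLp (u k - v k)) l (nhds 0) :=
      tendsto_zero_iff_norm_tendsto_zero.2 hd
    have h3 := ((continuous_lpToDist_apply (p := p) ψ).tendsto 0).comp h2
    have h4 : Filter.Tendsto (fun k => lpToDist n p (w k) ψ) l (nhds 0) := by
      have h5 := (hw ψ).sub h3
      rw [map_zero] at h5
      simp only [Function.comp_def, map_sub] at h5
      simpa using h5
    exact tendsto_nhds_unique h1 (h4.mono_left hUl)
  have hfin : Filter.Tendsto (fun k => ‖v k‖) U (nhds ‖g‖) := hg'.norm
  rw [← tendsto_nhds_unique hfin (hvc.mono_left hUl)]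
  exact (congrArg norm hg0).trans norm_zero

end

/-! ### Schwartz functions in SG Sobolev spaces -/

noncomputable section

/-- A smooth bump function equal to `1` at the origin serves as the profile of the wave packets. -/
theorem exists_schwartz_toLp_ne_zero (n : ℕ) (p : ℝ≥0∞) [Fact (1 ≤ p)] :
    ∃ φ : 𝓢(Rn n, ℂ), φ.toLp p ≠ 0 := by
  let b : ContDiffBump (0 : Rn n) := ⟨1, 2, one_pos, one_lt_two⟩
  have h1 : HasCompactSupport (fun x => (b x : ℂ)) :=
    b.hasCompactSupport.comp_left Complex.ofReal_zero
  have h2 : ContDiff ℝ ∞ (fun x => (b x : ℂ)) := Complex.ofRealCLM.contDiff.comp b.contDiff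
  refine ⟨h1.toSchwartzMap h2, fun h => ?_⟩
  have h3 : (0 : 𝓢(Rn n, ℂ)).toLp p = 0 := map_zero (SchwartzMap.toLpCLM ℂ ℂ p volume)
  have h4 := SchwartzMap.injective_toLp p volume (h.trans h3.symm)
  have h5 : (b 0 : ℂ) = 0 := congrArg (fun f : 𝓢(Rn n, ℂ) => f 0) h4
  rw [b.one_of_mem_closedBall (by simp [b.rIn_pos.le])] at h5
  exact one_ne_zero (Complex.ofReal_eq_zero.1 h5)

theorem scaledSymbol_zero {n : ℕ} (Λ : Rn n → ℝ) (m₁ m₂ : ℝ) (σ : Rn n → Rn n → ℂ)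
    (x₀ ξ₀ : Rn n) (h : ℝ) :
    scaledSymbol Λ m₁ m₂ σ x₀ ξ₀ h 0 0 = (Λ x₀ ^ (-m₂) * Λ ξ₀ ^ (-m₁)) • σ x₀ ξ₀ := by
  simp [scaledSymbol]

theorem scaledSymbol_sgBesselSymbol_zero {n : ℕ} {Λ : Rn n → ℝ} (hΛ : ∀ x, 0 < Λ x)
    (s₁ s₂ : ℝ) (x₀ ξ₀ : Rn n) (h : ℝ) :
    scaledSymbol Λ s₁ s₂ (sgBesselSymbol Λ (-s₁) (-s₂)) x₀ ξ₀ h 0 0 = 1 := by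
  rw [scaledSymbol_zero, sgBesselSymbol, Complex.real_smul, ← Complex.ofReal_mul, neg_neg, neg_neg,
    Real.rpow_neg (hΛ _).le, Real.rpow_neg (hΛ _).le]
  have h1 := Real.rpow_pos_of_pos (hΛ x₀) s₂
  have h2 := Real.rpow_pos_of_pos (hΛ ξ₀) s₁
  rw [show (Λ x₀ ^ s₂)⁻¹ * (Λ ξ₀ ^ s₁)⁻¹ * (Λ x₀ ^ s₂ * Λ ξ₀ ^ s₁) = 1 by field_simp,
    Complex.ofReal_one]

section

variable {n : ℕ} {Λ : Rn n → ℝ} {μ ρ : ℝ}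

theorem IsWeightFunction.hasSGBounds_bessel (hΛ : IsWeightFunction Λ μ) (hρμ : ρ ≤ 1 / μ)
    (s₁ s₂ : ℝ) : HasSGBounds Λ ρ s₁ s₂ (sgBesselSymbol Λ (-s₁) (-s₂)) := by
  simpa using hΛ.hasSGBounds_sgBesselSymbol hρμ (-s₁) (-s₂)

/-- The operator `J_{-s₁,-s₂}` on the Schwartz space. -/
def IsWeightFunction.besselSw (hΛ : IsWeightFunction Λ μ) (hρ : 0 < ρ) (hρμ : ρ ≤ 1 / μ)
    (s₁ s₂ : ℝ) : 𝓢(Rn n, ℂ) →L[ℂ] 𝓢(Rn n, ℂ) :=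
  psdoSw ((hΛ.hasSGBounds_bessel hρμ s₁ s₂).isAmplitude hΛ hρ)

theorem IsWeightFunction.sgBessel_lpToDist (hΛ : IsWeightFunction Λ μ) (hρ : 0 < ρ)
    (hρμ : ρ ≤ 1 / μ) (s₁ s₂ : ℝ) {p : ℝ≥0∞} [Fact (1 ≤ p)] (f : 𝓢(Rn n, ℂ)) :
    sgBessel Λ (-s₁) (-s₂) (lpToDist n p (f.toLp p)) =
      lpToDist n p ((hΛ.besselSw hρ hρμ s₁ s₂ f).toLp p) :=
  psdoDist_lpToDist _ ((hΛ.hasSGBounds_bessel hρμ s₁ s₂).isAmplitude_swap hΛ hρ) f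

theorem IsWeightFunction.lpToDist_mem_sgSobolevSubmodule (hΛ : IsWeightFunction Λ μ)
    (hρ : 0 < ρ) (hρμ : ρ ≤ 1 / μ) (s₁ s₂ : ℝ) {p : ℝ≥0∞} [Fact (1 ≤ p)] (f : 𝓢(Rn n, ℂ)) :
    lpToDist n p (f.toLp p) ∈ sgSobolevSubmodule Λ s₁ s₂ p := by
  rw [sgSobolevSubmodule, Submodule.mem_comap, ContinuousLinearMap.coe_coe,
    hΛ.sgBessel_lpToDist hρ hρμ]
  exact LinearMap.mem_range_self _ _

/-- A Schwartz function as an element of the SG Sobolev space. -/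
def SGSobolev.ofSchwartz (hΛ : IsWeightFunction Λ μ) (hρ : 0 < ρ) (hρμ : ρ ≤ 1 / μ) (s₁ s₂ : ℝ)
    (p : ℝ≥0∞) [Fact (1 ≤ p)] (f : 𝓢(Rn n, ℂ)) : SGSobolev Λ s₁ s₂ p :=
  ⟨_, hΛ.lpToDist_mem_sgSobolevSubmodule hρ hρμ s₁ s₂ f⟩

variable (hΛ : IsWeightFunction Λ μ) (hρ : 0 < ρ) (hρμ : ρ ≤ 1 / μ) (s₁ s₂ : ℝ)
  {p : ℝ≥0∞} [Fact (1 ≤ p)]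

theorem SGSobolev.toDist_ofSchwartz (f : 𝓢(Rn n, ℂ)) :
    toDist (ofSchwartz hΛ hρ hρμ s₁ s₂ p f) = lpToDist n p (f.toLp p) := rfl

theorem SGSobolev.toLp_ofSchwartz (f : 𝓢(Rn n, ℂ)) :
    toLp (ofSchwartz hΛ hρ hρμ s₁ s₂ p f) = (hΛ.besselSw hρ hρμ s₁ s₂ f).toLp p := by
  refine lpToDist_injective n p ?_
  rw [lpToDist_toLp, toDist_ofSchwartz, hΛ.sgBessel_lpToDist hρ hρμ]

end

theorem toLp_real_smul {n : ℕ} {p : ℝ≥0∞} [Fact (1 ≤ p)] (c : ℝ) (f : 𝓢(Rn n, ℂ)) :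
    (c • f).toLp p = c • f.toLp p :=
  map_smul (SchwartzMap.toLpCLM ℝ ℂ p volume) c f

/-- The wave packet normalized to preserve `L^p` norms. -/
def lpWavePacket {n : ℕ} (p : ℝ≥0∞) (x₀ ξ₀ : Rn n) {h : ℝ} (hh : 0 < h) (φ : 𝓢(Rn n, ℂ)) :
    𝓢(Rn n, ℂ) :=
  h ^ (-((n : ℝ) / p.toReal)) • wavePacket x₀ ξ₀ hh φ

theorem norm_toLp_lpWavePacket {n : ℕ} {p : ℝ≥0∞} [Fact (1 ≤ p)] (hp : p ≠ ⊤) (x₀ ξ₀ : Rn n)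
    {h : ℝ} (hh : 0 < h) (φ : 𝓢(Rn n, ℂ)) : ‖(lpWavePacket p x₀ ξ₀ hh φ).toLp p‖ = ‖φ.toLp p‖ := by
  rw [lpWavePacket, toLp_real_smul, norm_smul, norm_toLp_wavePacket x₀ ξ₀ hh hp,
    Real.norm_of_nonneg (by positivity), ← mul_assoc, ← Real.rpow_add hh, neg_add_cancel,
    Real.rpow_zero, one_mul]

/-- Up to a change of profile, applying an operator of order `(m₁, m₂)` to a weighted packet only
shifts the exponents of the weights at its centre. -/
theorem psdoSw_smul_lpWavePacket {n : ℕ} {Λ : Rn n → ℝ} {p : ℝ≥0∞} {m₁ m₂ : ℝ}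
    {σ : Rn n → Rn n → ℂ} (hΛ : ∀ x, 0 < Λ x)
    (hσ : IsAmplitude (fun (_ : Unit) (z : Rn n × Rn n) => σ z.1 z.2)) {x₀ ξ₀ : Rn n} {h : ℝ}
    (hh : 0 < h) (hs : IsAmplitude (fun (_ : Unit) (z : Rn n × Rn n) =>
      scaledSymbol Λ m₁ m₂ σ x₀ ξ₀ h z.1 z.2)) (t₁ t₂ : ℝ) (φ : 𝓢(Rn n, ℂ)) :
    psdoSw hσ ((Λ x₀ ^ t₂ * Λ ξ₀ ^ t₁) • lpWavePacket p x₀ ξ₀ hh φ) =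
      (Λ x₀ ^ (t₂ + m₂) * Λ ξ₀ ^ (t₁ + m₁)) • lpWavePacket p x₀ ξ₀ hh (psdoSw hs φ) := by
  have h1 : ∀ (c : ℝ) (f : 𝓢(Rn n, ℂ)), psdoSw hσ (c • f) = c • psdoSw hσ f := fun c f =>
    map_smul ((psdoSw hσ).restrictScalars ℝ) c f
  rw [lpWavePacket, h1, h1, psdoSw_wavePacket x₀ ξ₀ hh hΛ hσ hs, lpWavePacket, smul_smul,
    smul_smul, smul_smul, Real.rpow_add (hΛ x₀), Real.rpow_add (hΛ ξ₀)]
  congr 1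
  ring

/-- If the symbol, divided by `Λ(x)^{m₂} Λ(ξ)^{m₁}`, tends to zero along a sequence of points at
which there is a scaling, then the operator is not Fredholm. -/
theorem not_isSGFredholm_of_isScaling {n : ℕ} (hn : 0 < n) {Λ : Rn n → ℝ} {μ ρ : ℝ}
    (hΛ : IsWeightFunction Λ μ) (hρ : 0 < ρ) (hρμ : ρ ≤ 1 / μ) {p : ℝ≥0∞} [Fact (1 ≤ p)]
    (hp : 1 < p) (hp' : p < ⊤) {m₁ m₂ s₁ s₂ : ℝ} {σ : Rn n → Rn n → ℂ}
    (hσ : HasSGBounds Λ ρ m₁ m₂ σ) {ι : Type*} {l : Filter ι} [l.NeBot] {x₀ ξ₀ : ι → Rn n}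
    {h ε : ι → ℝ} (hs : IsScaling Λ ρ x₀ ξ₀ h ε) (hε : Filter.Tendsto ε l (nhds 0))
    (hl : Filter.Tendsto h l Filter.atTop ∨ Filter.Tendsto h l (nhds 0))
    (hlim : Filter.Tendsto (fun k => (Λ (x₀ k) ^ (-m₂) * Λ (ξ₀ k) ^ (-m₁)) • σ (x₀ k) (ξ₀ k)) l
      (nhds 0)) :
    ¬ IsSGFredholm Λ p s₁ s₂ (s₁ - m₁) (s₂ - m₂) σ := by
  rintro ⟨A, hA, hF⟩
  obtain ⟨φ, hφ⟩ := exists_schwartz_toLp_ne_zero n p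
  have hq : 1 < p.toReal := by
    rw [← ENNReal.toReal_one]
    exact (ENNReal.toReal_lt_toReal ENNReal.one_ne_top hp'.ne).2 hp
  have hB := hΛ.hasSGBounds_bessel hρμ s₁ s₂
  have hB' := hΛ.hasSGBounds_bessel hρμ (s₁ - m₁) (s₂ - m₂)
  -- The weights are chosen so that `J_{-s₁,-s₂}` turns `f k` into an `L^p`-normalized packet
  -- without a prefactor. Below, `φ₁`, `φ₂` and `φ₃` are the profiles after `J_{-s₁,-s₂}`, after
  -- `T_σ`, and after `T_σ` followed by the Bessel operator of the target space.
  let f : ι → 𝓢(Rn n, ℂ) := fun k =>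
    (Λ (x₀ k) ^ (-s₂) * Λ (ξ₀ k) ^ (-s₁)) • lpWavePacket p (x₀ k) (ξ₀ k) (hs.pos k) φ
  let u : ι → SGSobolev Λ s₁ s₂ p := fun k => SGSobolev.ofSchwartz hΛ hρ hρμ s₁ s₂ p (f k)
  let φ₁ : ι → 𝓢(Rn n, ℂ) := fun k => psdoSw (hB.isAmplitude_scaledSymbol hΛ hρ hρμ hs k) φ
  let φ₂ : ι → 𝓢(Rn n, ℂ) := fun k => psdoSw (hσ.isAmplitude_scaledSymbol hΛ hρ hρμ hs k) φ
  let φ₃ : ι → 𝓢(Rn n, ℂ) := fun k =>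
    psdoSw (hB'.isAmplitude_scaledSymbol hΛ hρ hρμ hs k) (φ₂ k)
  have hφ₁ : Filter.Tendsto φ₁ l (nhds φ) := by
    have := hB.tendsto_psdoSw_scaledSymbol hΛ hρ hρμ hs hε (c := 1)
      (by simp_rw [scaledSymbol_sgBesselSymbol_zero hΛ.pos]; exact tendsto_const_nhds)
      (tendsto_const_nhds (x := φ))
    rwa [one_smul] at this
  have hφ₂ : Filter.Tendsto φ₂ l (nhds 0) := by
    have := hσ.tendsto_psdoSw_scaledSymbol hΛ hρ hρμ hs hε (c := 0)
      (by simp_rw [scaledSymbol_zero]; exact hlim) (tendsto_const_nhds (x := φ))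
    rwa [zero_smul] at this
  have hφ₃ : Filter.Tendsto φ₃ l (nhds 0) := by
    have := hB'.tendsto_psdoSw_scaledSymbol hΛ hρ hρμ hs hε (c := 1)
      (by simp_rw [scaledSymbol_sgBesselSymbol_zero hΛ.pos]; exact tendsto_const_nhds) hφ₂
    rwa [smul_zero] at this
  have htoLp : ∀ k, SGSobolev.toLp (u k) =
      (lpWavePacket p (x₀ k) (ξ₀ k) (hs.pos k) (φ₁ k)).toLp p := by
    intro k
    rw [SGSobolev.toLp_ofSchwartz]
    congr 1
    refine (psdoSw_smul_lpWavePacket hΛ.pos _ (hs.pos k)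
      (hB.isAmplitude_scaledSymbol hΛ hρ hρμ hs k) _ _ φ).trans ?_
    rw [neg_add_cancel, neg_add_cancel, Real.rpow_zero, Real.rpow_zero, one_mul, one_smul]
  have hAu : ∀ k, SGSobolev.toLp (A (u k)) =
      (lpWavePacket p (x₀ k) (ξ₀ k) (hs.pos k) (φ₃ k)).toLp p := by
    intro k
    have h1 : A (u k) = SGSobolev.ofSchwartz hΛ hρ hρμ (s₁ - m₁) (s₂ - m₂) p
        (psdoSw (hσ.isAmplitude hΛ hρ) (f k)) := by
      refine Subtype.ext ?_
      exact (hA (u k)).trans (psdoDist_lpToDist _ (hσ.isAmplitude_swap hΛ hρ) (f k))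
    rw [h1, SGSobolev.toLp_ofSchwartz]
    congr 1
    rw [psdoSw_smul_lpWavePacket hΛ.pos _ (hs.pos k)
      (hσ.isAmplitude_scaledSymbol hΛ hρ hρμ hs k)]
    refine (psdoSw_smul_lpWavePacket hΛ.pos _ (hs.pos k)
      (hB'.isAmplitude_scaledSymbol hΛ hρ hρμ hs k) _ _ (φ₂ k)).trans ?_
    -- The prefactors cancel because the target orders are exactly `s₁ - m₁` and `s₂ - m₂`.
    rw [show -s₂ + m₂ + (s₂ - m₂) = 0 by ring, show -s₁ + m₁ + (s₁ - m₁) = 0 by ring,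
      Real.rpow_zero, Real.rpow_zero, one_mul, one_smul]
  have hcont := (SchwartzMap.toLpCLM ℂ ℂ p (volume : Measure (Rn n))).continuous.norm
  refine hφ (norm_eq_zero.1 (SGSobolev.tendsto_norm_zero_of_isFredholm hF (u := u) (l := l)
    ?_ ?_ fun ψ => ?_))
  · simp_rw [SGSobolev.norm_def, htoLp, norm_toLp_lpWavePacket hp'.ne]
    exact (hcont.tendsto φ).comp hφ₁
  · simp_rw [SGSobolev.norm_def, hAu, norm_toLp_lpWavePacket hp'.ne]
    have := (hcont.tendsto 0).comp hφ₃
    rwa [map_zero, norm_zero] at this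
  · simp_rw [htoLp, lpToDist_toLp_apply]
    refine (tendsto_integral_wavePacket_mul hn hq (x₀ := x₀) (ξ₀ := ξ₀) hs.pos hl hφ₁
      ψ).congr fun k => ?_
    rw [← integral_smul]
    simp only [lpWavePacket, smul_apply, smul_mul_assoc]

end

/-! ### Ellipticity of Fredholm operators -/

noncomputable section

section

variable {n : ℕ} {Λ : Rn n → ℝ} {μ ρ : ℝ}

theorem IsWeightFunction.tendsto_atTop (hΛ : IsWeightFunction Λ μ) {ι : Type*} {l : Filter ι}
    {x : ι → Rn n} (hx : Filter.Tendsto (fun k => ‖x k‖) l Filter.atTop) :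
    Filter.Tendsto (fun k => Λ (x k)) l Filter.atTop := by
  obtain ⟨μ₀, μ₁, C₀, C₁, hμ₀, -, -, hC₀, -, h⟩ := hΛ.growth
  refine Filter.tendsto_atTop_mono (fun k => (h (x k)).1) ?_
  exact ((tendsto_rpow_atTop hμ₀).comp (Filter.tendsto_atTop_add_const_left l 1 hx)).const_mul_atTop
    hC₀

theorem IsWeightFunction.exists_rpow_neg_le (hΛ : IsWeightFunction Λ μ) (hρ : 0 < ρ) :
    ∃ c : ℝ, 1 ≤ c ∧ ∀ x, Λ x ^ (-(ρ / 2)) ≤ c := by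
  obtain ⟨c, hc, h⟩ := hΛ.exists_lower_bound
  refine ⟨max 1 (c ^ (-(ρ / 2))), le_max_left _ _, fun x => le_max_of_le_right ?_⟩
  exact Real.rpow_le_rpow_of_nonpos hc (h x) (by linarith)

theorem rpow_half_mul_rpow_neg {y : ℝ} (hy : 0 < y) (ρ : ℝ) :
    y ^ (ρ / 2) * y ^ (-ρ) = y ^ (-(ρ / 2)) := by
  rw [← Real.rpow_add hy]
  congr 1
  ring

/-- The scale `h = Λ(x)^{ρ/2}` is half of the admissible `Λ(x)^ρ` on the logarithmic scale. It makes
`h Λ(x)^{-ρ}` equal to `Λ(x)^{-ρ/2}`, and `h⁻¹ Λ(ξ)^{-ρ}` a bounded multiple of the same quantity,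
even if `ξ` stays bounded. -/
theorem IsWeightFunction.exists_isScaling_left (hΛ : IsWeightFunction Λ μ) (hρ : 0 < ρ)
    {ι : Type*} (x ξ : ι → Rn n) : ∃ C : ℝ, 0 < C ∧
      IsScaling Λ ρ x ξ (fun k => Λ (x k) ^ (ρ / 2)) (fun k => C * Λ (x k) ^ (-(ρ / 2))) := by
  obtain ⟨c, hc, h⟩ := hΛ.exists_rpow_neg_le hρ
  have hc0 : 0 < c := by linarith
  have hpos := fun y t => Real.rpow_pos_of_pos (hΛ.pos y) t
  -- `Λ^{-ρ/2} ≤ c` gives `Λ(ξ)^{-ρ} ≤ c * c`, the constant in `ε`; one more factor `c` bounds `ε`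
  -- itself.
  refine ⟨c * c, by positivity, fun k => hpos _ _, fun k => mul_pos (by positivity) (hpos _ _),
    ⟨c * c * c, by positivity, fun k => ⟨?_, ?_, ?_⟩⟩, fun k => ?_, fun k => ?_⟩
  · gcongr
    exact h _
  · have h1 : 1 ≤ c * c * c := one_le_mul_of_one_le_of_one_le
      (one_le_mul_of_one_le_of_one_le hc hc) hc
    exact le_mul_of_one_le_left (hpos _ _).le h1
  · rw [← Real.rpow_neg (hΛ.pos _).le]
    have h1 : 1 ≤ c * Λ (ξ k) ^ (ρ / 2) := by
      have h2 := h (ξ k)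
      rw [Real.rpow_neg (hΛ.pos _).le, inv_le_iff_one_le_mul₀ (hpos _ _)] at h2
      exact h2
    calc Λ (x k) ^ (-(ρ / 2)) ≤ c := h _
      _ ≤ c * (c * (c * Λ (ξ k) ^ (ρ / 2))) :=
        le_mul_of_one_le_right hc0.le (one_le_mul_of_one_le_of_one_le hc h1)
      _ = _ := by ring
  · rw [rpow_half_mul_rpow_neg (hΛ.pos _)]
    exact le_mul_of_one_le_left (hpos _ _).le (one_le_mul_of_one_le_of_one_le hc hc)
  · have h1 : Λ (ξ k) ^ (-ρ) ≤ c * c := by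
      have h2 : Λ (ξ k) ^ (-ρ) = Λ (ξ k) ^ (-(ρ / 2)) * Λ (ξ k) ^ (-(ρ / 2)) := by
        rw [← Real.rpow_add (hΛ.pos _)]
        congr 1
        ring
      rw [h2]
      exact mul_le_mul (h _) (h _) (hpos _ _).le hc0.le
    rw [← Real.rpow_neg (hΛ.pos _).le, mul_comm]
    exact mul_le_mul_of_nonneg_right h1 (hpos _ _).le

theorem IsScaling.swap {ι : Type*} {x ξ : ι → Rn n} {h ε : ι → ℝ} (hs : IsScaling Λ ρ x ξ h ε) :
    IsScaling Λ ρ ξ x (fun k => (h k)⁻¹) ε := by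
  obtain ⟨c, hc, hb⟩ := hs.bounded
  refine ⟨fun k => inv_pos.2 (hs.pos k), hs.eps_pos, ⟨c, hc, fun k => ⟨(hb k).1, (hb k).2.2, ?_⟩⟩,
    hs.right, fun k => ?_⟩
  · rw [inv_inv]
    exact (hb k).2.1
  · rw [inv_inv]
    exact hs.left k

theorem tendsto_const_mul_rpow_neg {ι : Type*} {l : Filter ι} {y : ι → ℝ}
    (hy : Filter.Tendsto y l Filter.atTop) (C : ℝ) (hρ : 0 < ρ) :
    Filter.Tendsto (fun k => C * y k ^ (-(ρ / 2))) l (nhds 0) := by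
  simpa using ((tendsto_rpow_neg_atTop (half_pos hρ)).comp hy).const_mul C

/-- When `|ξ|` is unbounded, the scaling built from `ξ` is used with position and frequency
exchanged; this inverts `h`, so the packets concentrate instead of spreading. -/
theorem not_isSGFredholm_of_tendsto (hn : 0 < n) (hΛ : IsWeightFunction Λ μ) (hρ : 0 < ρ)
    (hρμ : ρ ≤ 1 / μ) {p : ℝ≥0∞} [Fact (1 ≤ p)] (hp : 1 < p) (hp' : p < ⊤) {m₁ m₂ s₁ s₂ : ℝ}
    {σ : Rn n → Rn n → ℂ} (hσ : HasSGBounds Λ ρ m₁ m₂ σ) {ι : Type*} {l : Filter ι} [l.NeBot]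
    {x ξ : ι → Rn n} (hx : Filter.Tendsto (fun k => ‖x k‖) l Filter.atTop ∨
      Filter.Tendsto (fun k => ‖ξ k‖) l Filter.atTop)
    (hlim : Filter.Tendsto (fun k => (Λ (x k) ^ (-m₂) * Λ (ξ k) ^ (-m₁)) • σ (x k) (ξ k)) l
      (nhds 0)) :
    ¬ IsSGFredholm Λ p s₁ s₂ (s₁ - m₁) (s₂ - m₂) σ := by
  rcases hx with hx | hx
  · obtain ⟨C, -, hs⟩ := hΛ.exists_isScaling_left hρ x ξ
    exact not_isSGFredholm_of_isScaling hn hΛ hρ hρμ hp hp' hσ hs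
      (tendsto_const_mul_rpow_neg (hΛ.tendsto_atTop hx) C hρ)
      (Or.inl ((tendsto_rpow_atTop (half_pos hρ)).comp (hΛ.tendsto_atTop hx))) hlim
  · obtain ⟨C, -, hs⟩ := hΛ.exists_isScaling_left hρ ξ x
    exact not_isSGFredholm_of_isScaling hn hΛ hρ hρμ hp hp' hσ hs.swap
      (tendsto_const_mul_rpow_neg (hΛ.tendsto_atTop hx) C hρ)
      (Or.inr (((tendsto_rpow_atTop (half_pos hρ)).comp (hΛ.tendsto_atTop hx)).inv_tendsto_atTop))
      hlim

/-- A symbol that is not elliptic tends to zero, relative to its order, along a sequence of points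
of phase space that tends to infinity. -/
theorem exists_seq_of_not_isSGMElliptic (hΛ : ∀ x, 0 < Λ x) {m₁ m₂ : ℝ} {σ : Rn n → Rn n → ℂ}
    (h : ¬ IsSGMElliptic Λ m₁ m₂ σ) : ∃ x ξ : ℕ → Rn n,
      Filter.Tendsto (fun k => ‖x k‖ + ‖ξ k‖) Filter.atTop Filter.atTop ∧
      Filter.Tendsto (fun k => (Λ (x k) ^ (-m₂) * Λ (ξ k) ^ (-m₁)) • σ (x k) (ξ k)) Filter.atTop
        (nhds 0) := by
  have h1 : ∀ k : ℕ, ∃ x ξ : Rn n, ((k : ℝ) + 1) ^ 2 ≤ ‖x‖ ^ 2 + ‖ξ‖ ^ 2 ∧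
      ‖σ x ξ‖ < 1 / ((k : ℝ) + 1) * Λ x ^ m₂ * Λ ξ ^ m₁ := by
    intro k
    by_contra hk
    push Not at hk
    exact h ⟨1 / ((k : ℝ) + 1), (k : ℝ) + 1, by positivity, by positivity, hk⟩
  choose x ξ hR hσ using h1
  refine ⟨x, ξ, ?_, ?_⟩
  · refine Filter.tendsto_atTop_mono (fun k => ?_) tendsto_natCast_atTop_atTop
    have h2 := hR k
    by_contra hk
    push Not at hk
    nlinarith [norm_nonneg (x k), norm_nonneg (ξ k)]
  · refine squeeze_zero_norm (fun k => ?_) tendsto_one_div_add_atTop_nhds_zero_nat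
    have hx := Real.rpow_pos_of_pos (hΛ (x k)) m₂
    have hξ := Real.rpow_pos_of_pos (hΛ (ξ k)) m₁
    rw [Real.rpow_neg (hΛ _).le, Real.rpow_neg (hΛ _).le, norm_smul,
      Real.norm_of_nonneg (by positivity), ← mul_inv, inv_mul_le_iff₀ (by positivity)]
    refine (hσ k).le.trans_eq ?_
    ring

end

end

theorem mainTheorem4 (n : ℕ) (Λ : Rn n → ℝ) (μ ρ : ℝ) (hΛ : IsWeightFunction Λ μ)
    (hρ : 0 < ρ) (hρμ : ρ ≤ 1 / μ) (p : ℝ≥0∞) [Fact (1 ≤ p)] (hp : 1 < p) (hp' : p < ⊤)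
    (m₁ m₂ s₁ s₂ : ℝ) (σ : Rn n → Rn n → ℂ) (hσ : IsSGMSymbol Λ ρ m₁ m₂ σ)
    (hF : IsSGFredholm Λ p s₁ s₂ (s₁ - m₁) (s₂ - m₂) σ) :
    IsSGMElliptic Λ m₁ m₂ σ := by
  rcases Nat.eq_zero_or_pos n with rfl | hn
  -- In dimension zero no point satisfies `1 ≤ ‖x‖ ^ 2 + ‖ξ‖ ^ 2`, so the claim is vacuous.
  · refine ⟨1, 1, one_pos, one_pos, fun x ξ h => ?_⟩
    rw [Subsingleton.elim x 0, Subsingleton.elim ξ 0] at h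
    norm_num at h
  by_contra hell
  obtain ⟨x, ξ, hx, hlim⟩ := exists_seq_of_not_isSGMElliptic hΛ.pos hell
  -- Neither `‖x k‖` nor `‖ξ k‖` alone need tend to infinity. An ultrafilter decides which of the
  -- two is the larger, and that one is at least half of the divergent sum; it plays the role of a
  -- subsequence.
  let U : Ultrafilter ℕ := Ultrafilter.of Filter.atTop
  have hU : (U : Filter ℕ) ≤ Filter.atTop := Ultrafilter.of_le _
  have hx' := (hx.mono_left hU).atTop_div_const (two_pos (α := ℝ))
  refine not_isSGFredholm_of_tendsto hn hΛ hρ hρμ hp hp' hσ.hasSGBounds (l := U) (x := x) (ξ := ξ)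
    ?_ (hlim.mono_left hU) hF
  rcases U.eventually_or.1 (Filter.Eventually.of_forall fun k => le_total ‖ξ k‖ ‖x k‖) with h | h
  · refine Or.inl (Filter.tendsto_atTop_mono' _ ?_ hx')
    filter_upwards [h] with k hk
    linarith
  · refine Or.inr (Filter.tendsto_atTop_mono' _ ?_ hx')
    filter_upwards [h] with k hk
    linarith
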